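/- **Model.** An agent moves in the plane at constant speed $v$ along a random-waypoint trajectory. The hop durations are i.i.d. exponential with rate $\lambda>0$, and the hop directions are i.i.d. uniform on $(0,2\pi]$. At each hop instant a position update is generated. It is polled with probability $p\in(0,1]$, independently of everything else, and otherwise discarded. The polled updates enter a single-server FCFS queue with i.i.d. exponential service times of rate $\mu>0$, independent of the arrivals, and the queue is stationary (M/M/1); we take time $0$ to be the generation time of a polled update. Let $\rho=p\lambda/\mu<1$. Each polled update carries an unbiased position estimate with a fixed error covariance matrix $\mathbf C_o$, and ${\rm PEB}_o=\operatorname{tr}\mathbf C_o$. The timing is independent of the directions and errors, and the directions are independent of all errors. At time $t$ the server's estimate is the one carried by the latest update that has left the queue (before the first departure, the estimate made at time $0$). In motion-agnostic operation ($c=0$) it is used as it is. In dead-reckoning operation ($c=1$) it is extrapolated along the sensed directions $\hat\theta=\theta+\Delta$, with $\Delta\sim{\rm Unif}(-\epsilon,\epsilon)$. Let ${\rm PEB}(t)$ be the trace of the mean squared error matrix of this estimate, given the timing. With $\delta_n$ the time spent in hop $n$ between the generation of that update and $t$, it equals ${\rm PEB}_o+\kappa_*\sum_n v^2\delta_n^2$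 with $\kappa_*=1+c^2-2c\,\mathbb E[\cos\Delta]$. Replacing $\cos\Delta$ by $1-\Delta^2/2$ gives the small-angle form ${\rm PEB}_o+\kappa\sum_n v^2\delta_n^2$ with $\kappa=1-c+c\,\mathbb E[\Delta^2]$. The age of positioning is the long-run average $${\rm AoP}=\lim_{\mathcal T\to\infty}\frac1{\mathcal T}\int_0^{\mathcal T}\big({\rm PEB}(t)-{\rm PEB}_o\big)\,dt .$$ For the $i$-th polled update ($i\ge1$), let $Y_1,\dots,Y_k$ be the durations of the hops between the generation of updates $i-1$ and $i$, and let $T_i$ be the waiting plus service time of update $i$. Let $Q_i$ be the area under the uncertainty curve $t\mapsto\sum_n v^2\delta_n(t)^2$ started at the generation of update $i-1$, up to the departure of update $i$, minus the area under the curve started at the generation of update $i$, up to the same departure. **Theorem 1.** Almost surely $$Q_i=\sum_{j=1}^k\frac{v^2}{3}Y_j^3+\sum_{j=1}^kY_j\sum_{l=1}^{j-1}v^2Y_l^2+\Big(\sum_{j=1}^kv^2Y_j^2\Big)T_i .$$ Moreover $Q_i$ is integrable and, with $\rho_e=\dfrac{\lambda}{\mu(1-\rho)+\lambda}$, $$\mathbb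 E[Q_i]=\frac{2v^2(1-p)}{p^2\lambda^3}+\frac{2v^2}{p\lambda^3}+\frac{2v^2}{p\lambda^2\mu}+\frac{2v^2p\rho_e}{\mu(1-\rho)}\cdot\frac{1}{(\mu(1-\rho)+\lambda)^2(1-\rho_e(1-p))^2}.$$ The limit defining the AoP exists almost surely, and ${\rm AoP}=p\,\kappa_*\,\lambda\,\mathbb E[Q_i]$. For the small-angle form of ${\rm PEB}$ the limit also exists almost surely, and ${\rm AoP}=p\,\kappa\,\lambda\,\mathbb E[Q_i]$. For $c=0$, $\kappa_*=\kappa=1$. For $c=1$, $\kappa=\epsilon^2/3$ and $0\le\kappa-\kappa_*\le\epsilon^4/60$. -/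

import Mathlib

open MeasureTheory ProbabilityTheory Filter Topology

noncomputable section

/-- One realisation of all the time-related randomness.
`hop n` is the duration of the `n`-th hop (`n = 0, 1, …`), `poll n` says whether the update generated
at the `n`-th hop instant is polled (the update at instant `0` is always polled, see `updateHop`),
`service i` is the service time of the `i`-th polled update (`i ≥ 1`), and `first` is the time
which the `0`-th polled update, generated at time `0`, spends in the queueing system. -/
structure Timing where
  hop : ℕ → ℝ
  poll : ℕ → Bool
  service : ℕ → ℝ
  first : ℝ

/-- One realisation of the spatial randomness: the true direction `heading n` of hop `n`, the error
`headingErr n` with which that direction is sensed, and the error `fixErr i` (true position minus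
estimate) of the position estimate carried by the `i`-th polled update. -/
structure Motion where
  heading : ℕ → ℝ
  headingErr : ℕ → ℝ
  fixErr : ℕ → Fin 2 → ℝ

namespace Timing

/-- The `n`-th hop instant: start of hop `n` and end of hop `n - 1`. -/
def hopInstant (τ : Timing) (n : ℕ) : ℝ := ∑ j ∈ Finset.range n, τ.hop j

/-- Index of the hop instant at which the `i`-th polled update is generated. -/
def updateHop (τ : Timing) (i : ℕ) : ℕ := Nat.nth (fun n => n = 0 ∨ τ.poll n = true) i

/-- Generation time of the `i`-th polled update (arrival time in the queue). -/
def updateInstant (τ : Timing) (i : ℕ) : ℝ := τ.hopInstant (τ.updateHop i)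

/-- Departure time of the `i`-th polled update from the single FCFS server, that is, the time at
which it becomes available at the central server. -/
def departure (τ : Timing) : ℕ → ℝ
  | 0 => τ.first
  | i + 1 => max (τ.departure i) (τ.updateInstant (i + 1)) + τ.service (i + 1)

/-- The system time (waiting plus service) of the `i`-th polled update. -/
def sysTime (τ : Timing) (i : ℕ) : ℝ := τ.departure i - τ.updateInstant i

/-- The time spent in the `n`-th hop during the time interval `[a, t]`. -/
def timeInHop (τ : Timing) (a t : ℝ) (n : ℕ) : ℝ :=
  max 0 (min t (τ.hopInstant (n + 1)) - max a (τ.hopInstant n))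

/-- The growth `∑ v² δₙ²` of the uncertainty between the times `a` and `t`, where `δₙ` is the time
spent in the `n`-th hop during `[a, t]`. -/
def growth (τ : Timing) (v a t : ℝ) : ℝ := ∑' n, v ^ 2 * (τ.timeInHop a t n) ^ 2

/-- Index of the most recent update available at the central server at time `t` (updates depart in
order of generation). Before the first departure this is `0`: the position estimate made at time `0`
initialises the server. -/
def latest (τ : Timing) (t : ℝ) : ℕ := sSup {i : ℕ | τ.departure i ≤ t}

/-- The area `Q` attributed to update `i + 1`: the area under the uncertainty curve that
starts at update `i`, until update `i + 1` becomes available, minus the part of it that lies under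
the next curve, which starts at update `i + 1`. -/
def areaQ (τ : Timing) (v : ℝ) (i : ℕ) : ℝ :=
  (∫ t in (τ.updateInstant i)..(τ.departure (i + 1)), τ.growth v (τ.updateInstant i) t) -
  ∫ t in (τ.updateInstant (i + 1))..(τ.departure (i + 1)), τ.growth v (τ.updateInstant (i + 1)) t

/-- The indices of the hops between the updates `i` and `i + 1`. -/
def hopsBetween (τ : Timing) (i : ℕ) : Finset ℕ := Finset.Ico (τ.updateHop i) (τ.updateHop (i + 1))

/-- Sub-area `G₁ = ∑ⱼ v² Yⱼ³ / 3`. -/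
def areaG1 (τ : Timing) (v : ℝ) (i : ℕ) : ℝ := ∑ j ∈ τ.hopsBetween i, v ^ 2 / 3 * τ.hop j ^ 3

/-- Sub-area `G₂ = ∑ⱼ Yⱼ ∑_{l < j} v² Yₗ²`. -/
def areaG2 (τ : Timing) (v : ℝ) (i : ℕ) : ℝ :=
  ∑ j ∈ τ.hopsBetween i, τ.hop j * ∑ l ∈ Finset.Ico (τ.updateHop i) j, v ^ 2 * τ.hop l ^ 2

/-- Sub-area `G₃ = H T` with `H = ∑ⱼ v² Yⱼ²`. -/
def areaG3 (τ : Timing) (v : ℝ) (i : ℕ) : ℝ :=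
  (∑ j ∈ τ.hopsBetween i, v ^ 2 * τ.hop j ^ 2) * τ.sysTime (i + 1)

end Timing

/-- The unit vector with direction `α`. -/
def unitVec (α : ℝ) : Fin 2 → ℝ := ![Real.cos α, Real.sin α]

/-- The agent's true position at time `t`, having started from `x₀` at time `0`. -/
def position (x₀ : Fin 2 → ℝ) (v : ℝ) (τ : Timing) (m : Motion) (t : ℝ) : Fin 2 → ℝ :=
  x₀ + ∑' n, (v * τ.timeInHop 0 t n) • unitVec (m.heading n)

/-- The server's estimate of the position at time `t`: the estimate carried by the latest available
update plus, if `c = 1`, the dead reckoning since the generation of that update. -/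
def positionEstimate (c : ℝ) (x₀ : Fin 2 → ℝ) (v : ℝ) (τ : Timing) (m : Motion) (t : ℝ) :
    Fin 2 → ℝ :=
  (position x₀ v τ m (τ.updateInstant (τ.latest t)) - m.fixErr (τ.latest t)) +
    c • ∑' n, (v * τ.timeInHop (τ.updateInstant (τ.latest t)) t n) •
      unitVec (m.heading n + m.headingErr n)

/-- Error of the real-time position estimate. -/
def positionError (c : ℝ) (x₀ : Fin 2 → ℝ) (v : ℝ) (τ : Timing) (m : Motion) (t : ℝ) :
    Fin 2 → ℝ :=
  position x₀ v τ m t - positionEstimate c x₀ v τ m t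

/-- The mean squared error matrix at time `t`, for given timing `τ`; the expectation is
over the spatial randomness. -/
def mse {Ω' : Type*} [MeasurableSpace Ω'] (P' : Measure Ω') (c : ℝ) (x₀ : Fin 2 → ℝ) (v : ℝ)
    (τ : Timing) (M : Ω' → Motion) (t : ℝ) : Matrix (Fin 2) (Fin 2) ℝ :=
  Matrix.of fun a b =>
    ∫ ω', positionError c x₀ v τ (M ω') t a * positionError c x₀ v τ (M ω') t b ∂P'

/-- `PEB(t)`, the trace of the mean squared error matrix. -/
def peb {Ω' : Type*} [MeasurableSpace Ω'] (P' : Measure Ω') (c : ℝ) (x₀ : Fin 2 → ℝ) (v : ℝ)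
    (τ : Timing) (M : Ω' → Motion) (t : ℝ) : ℝ :=
  (mse P' c x₀ v τ M t).trace

/-- The uniform distribution on `(-ε, ε)`, the law of the heading errors. -/
def headingErrLaw (ε : ℝ) : Measure ℝ := ProbabilityTheory.cond volume (Set.Ioo (-ε) ε)

/-- The exact growth factor `1 + c² - 2 c E[cos Δ]` of the trace of the mean squared error. -/
def kappaExact (c ε : ℝ) : ℝ := 1 + c ^ 2 - 2 * c * ∫ δ, Real.cos δ ∂(headingErrLaw ε)

/-- The growth factor `κ = 1 - c + c E[Δ²]` obtained from `cos Δ ≈ 1 - Δ² / 2`. -/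
def kappa (c ε : ℝ) : ℝ := 1 - c + c * ∫ δ, δ ^ 2 ∂(headingErrLaw ε)

/-- `PEB(t)` in the small-angle form `PEBₒ + κ ∑ v² δₙ²`, where `δₙ` is the time spent in hop `n` since
the generation of the latest available update. -/
def pebSmallAngle (pebo c ε v : ℝ) (τ : Timing) (t : ℝ) : ℝ :=
  pebo + kappa c ε * τ.growth v (τ.updateInstant (τ.latest t)) t

/-- `A` is the age of positioning of the trajectory `f` of the PEB with baseline `pebo`: the long-run
time average of `f - pebo`. -/
def IsAoP (f : ℝ → ℝ) (pebo A : ℝ) : Prop :=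
  (∀ T : ℝ, 0 ≤ T → IntervalIntegrable (fun t => f t - pebo) volume 0 T) ∧
  Tendsto (fun T : ℝ => (1 / T) * ∫ t in (0 : ℝ)..T, (f t - pebo)) atTop (𝓝 A)

/-- The random timing `τ` of a stationary M/M/1 FCFS queue which is fed by the hop updates: the hop
instants form a Poisson process of rate `lam`, each hop update is polled with probability `p`, the
service times are exponential of rate `mu`, everything is independent (also of the
system time of the update generated at time `0`), and the system times are stationary. -/
structure IsStationaryMM1 {Ω : Type*} [MeasurableSpace Ω] (P : Measure Ω) (lam mu p : ℝ)
    (τ : Ω → Timing) : Prop where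
  hop_law : ∀ n, HasLaw (fun ω => (τ ω).hop n) (expMeasure lam) P
  hop_indep : iIndepFun (fun n ω => (τ ω).hop n) P
  poll_meas : ∀ n, Measurable fun ω => (τ ω).poll n
  poll_law : ∀ n, P {ω | (τ ω).poll n = true} = ENNReal.ofReal p
  poll_indep : iIndepFun (fun n ω => (τ ω).poll n) P
  service_law : ∀ i, HasLaw (fun ω => (τ ω).service i) (expMeasure mu) P
  service_indep : iIndepFun (fun i ω => (τ ω).service i) P
  indep_first : IndepFun (fun ω => (τ ω).first)
    (fun ω => ((τ ω).hop, (τ ω).poll, (τ ω).service)) P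
  indep_hop : IndepFun (fun ω => (τ ω).hop) (fun ω => ((τ ω).poll, (τ ω).service)) P
  indep_poll : IndepFun (fun ω => (τ ω).poll) (fun ω => (τ ω).service) P
  stationary : ∀ i, IdentDistrib (fun ω => (τ ω).sysTime i) (fun ω => (τ ω).sysTime 0) P P

/-- The spatial randomness of the random waypoint model: the headings are independent and uniform on
`(0, 2π]`, the heading errors are uniform on `(-ε, ε)`, the position estimates are unbiased with
covariance matrix `Co`, and the headings are independent of all these errors (no
assumption is made on the dependence of the errors among themselves). -/
structure IsRWPMotion {Ω' : Type*} [MeasurableSpace Ω'] (P' : Measure Ω') (ε : ℝ)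
    (Co : Matrix (Fin 2) (Fin 2) ℝ) (M : Ω' → Motion) : Prop where
  heading_law : ∀ n, HasLaw (fun ω' => (M ω').heading n)
    (ProbabilityTheory.cond volume (Set.Ioc 0 (2 * Real.pi))) P'
  heading_indep : iIndepFun (fun n ω' => (M ω').heading n) P'
  headingErr_law : ∀ n, HasLaw (fun ω' => (M ω').headingErr n) (headingErrLaw ε) P'
  fixErr_memLp : ∀ i a, MemLp (fun ω' => (M ω').fixErr i a) 2 P'
  fixErr_mean : ∀ i a, ∫ ω', (M ω').fixErr i a ∂P' = 0
  fixErr_cov : ∀ i a b, ∫ ω', (M ω').fixErr i a * (M ω').fixErr i b ∂P' = Co a b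
  indep : IndepFun (fun ω' => (M ω').heading)
    (fun ω' => ((M ω').headingErr, (M ω').fixErr)) P'

end

/-!
The sample-path part of the theorem is deterministic. For a realisation with positive hops that
exhaust the time axis and with infinitely many polled updates, the uncertainty accumulated before a
hop instant and after it add up (`growth_add`). Hence the area between two consecutive uncertainty
curves is the area under the first curve up to the next update plus a rectangle whose width is the
system time (`areaQ_eq`), and the area under the sawtooth up to the `n`-th departure is the sum of the
`Q`s up to a last piece of order `sysTime ^ 3`. The time average of the sawtooth therefore converges
to `β q` as soon as the `Q`s have the average `q`, updates come at rate `β`, and `sysTime n ^ 3 = o(n)`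
(`tendsto_average_currentGrowth`). Conditionally on the timing, independence of the uniform headings
makes the contributions of different hops to the position error uncorrelated, which turns the trace
of the mean squared error into `tr Co + κ * currentGrowth` (`peb_eq`).

The probabilistic part regards the queue as driven by a sequence of independent blocks: the hops
between two polled updates together with a service time. By the strong Markov property of the polling
trials (`map_blockStats_nextBlock`), what follows a polled update is a fresh copy of the whole driving
randomness, independent of the past. A first-step analysis (`blockLaw_eq`) gives the moments of a
block and the exponential law of its duration. System times follow Lindley's recursion, and a
comparison of characteristic functions shows that its only invariant law is exponential of rate
`mu - p * lam` (`eq_expMeasure_of_map_lindley`). So every `Q` is one and the same square integrable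
function of a stationary state of the queue, whose mean is an explicit integral (`integral_blockArea`).

The average of the `Q`s converges by a strong law for square integrable functions with geometrically
decaying correlations (`ae_tendsto_average_iterate`). The decay comes from a coupling: two queues fed
by the same blocks, one of them started from an independent stationary state, differ after `k` steps
by at most an exponential functional of the blocks whose mean is geometric in `k`
(`orbitArea_iterate_le`, `couplingBound_integral`).
-/

noncomputable section

/-! ### Sample paths of the queue -/

namespace Timing

/-- The realisations for which the sample-path identities hold: hops have positive durations and
exhaust the time axis, infinitely many updates are polled, and services take nonnegative time. -/
structure IsRegular (τ : Timing) : Prop where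
  hop_pos : ∀ n, 0 < τ.hop n
  tendsto_hopInstant : Tendsto τ.hopInstant atTop atTop
  poll_infinite : {n | τ.poll n = true}.Infinite
  service_nonneg : ∀ i, 0 ≤ τ.service (i + 1)
  first_nonneg : 0 ≤ τ.first

lemma hopInstant_zero (τ : Timing) : τ.hopInstant 0 = 0 := by simp [hopInstant]

lemma hopInstant_succ (τ : Timing) (n : ℕ) : τ.hopInstant (n + 1) = τ.hopInstant n + τ.hop n := by
  simp [hopInstant, Finset.sum_range_succ]

lemma timeInHop_nonneg (τ : Timing) (a t : ℝ) (n : ℕ) : 0 ≤ τ.timeInHop a t n := le_max_left _ _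

lemma continuous_timeInHop (τ : Timing) (a : ℝ) (n : ℕ) :
    Continuous fun t => τ.timeInHop a t n := by
  unfold timeInHop; fun_prop

lemma updateHop_zero (τ : Timing) : τ.updateHop 0 = 0 := Nat.nth_zero_of_zero (Or.inl rfl)

lemma updateInstant_zero (τ : Timing) : τ.updateInstant 0 = 0 := by
  rw [updateInstant, updateHop_zero, hopInstant_zero]

namespace IsRegular

variable {τ : Timing}

lemma strictMono_hopInstant (hτ : τ.IsRegular) : StrictMono τ.hopInstant :=
  strictMono_nat_of_lt_succ fun n => by
    rw [hopInstant_succ]; linarith [hτ.hop_pos n]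

lemma hopInstant_nonneg (hτ : τ.IsRegular) (n : ℕ) : 0 ≤ τ.hopInstant n := by
  rw [← τ.hopInstant_zero]; exact hτ.strictMono_hopInstant.monotone (Nat.zero_le n)

lemma exists_lt_hopInstant (hτ : τ.IsRegular) (t : ℝ) : ∃ N, t < τ.hopInstant N :=
  (hτ.tendsto_hopInstant.eventually_gt_atTop t).exists

lemma timeInHop_eq_zero_of_ge (hτ : τ.IsRegular) {a t : ℝ} {n N : ℕ} (ht : t ≤ τ.hopInstant N)
    (hn : N ≤ n) : τ.timeInHop a t n = 0 := by
  have h1 := hτ.strictMono_hopInstant.monotone hn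
  refine max_eq_left ?_
  linarith [min_le_left t (τ.hopInstant (n + 1)), le_max_right a (τ.hopInstant n)]

lemma timeInHop_eq_zero_of_lt (hτ : τ.IsRegular) {a t : ℝ} {n N : ℕ} (ha : τ.hopInstant N ≤ a)
    (hn : n < N) : τ.timeInHop a t n = 0 := by
  have h1 : τ.hopInstant (n + 1) ≤ τ.hopInstant N := hτ.strictMono_hopInstant.monotone hn
  refine max_eq_left ?_
  linarith [min_le_right t (τ.hopInstant (n + 1)), le_max_left a (τ.hopInstant n)]

lemma growth_eq_sum (hτ : τ.IsRegular) (v : ℝ) {a t : ℝ} {N : ℕ} (ht : t ≤ τ.hopInstant N) :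
    τ.growth v a t = ∑ n ∈ Finset.range N, v ^ 2 * τ.timeInHop a t n ^ 2 := by
  refine tsum_eq_sum fun n hn => ?_
  rw [hτ.timeInHop_eq_zero_of_ge ht (by simpa using hn)]; simp

lemma continuous_growth (hτ : τ.IsRegular) (v a : ℝ) : Continuous (τ.growth v a) := by
  rw [continuous_iff_continuousAt]
  intro t
  obtain ⟨N, hN⟩ := hτ.exists_lt_hopInstant t
  have hc : Continuous fun s => ∑ n ∈ Finset.range N, v ^ 2 * τ.timeInHop a s n ^ 2 := by
    have := τ.continuous_timeInHop a
    fun_prop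
  refine hc.continuousAt.congr ?_
  filter_upwards [Iio_mem_nhds hN] with s hs
  exact (hτ.growth_eq_sum v (le_of_lt hs)).symm

lemma growth_nonneg (τ : Timing) (v a t : ℝ) : 0 ≤ τ.growth v a t :=
  tsum_nonneg fun n => by positivity

/-- The times spent in the hops during `[a, t]` add up to the length of that interval. -/
lemma sum_timeInHop (hτ : τ.IsRegular) {a t : ℝ} (ha : 0 ≤ a) (hat : a ≤ t) {N : ℕ}
    (ht : t ≤ τ.hopInstant N) : ∑ n ∈ Finset.range N, τ.timeInHop a t n = t - a := by
  have h : ∀ n, τ.timeInHop a t n =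
      max a (min t (τ.hopInstant (n + 1))) - max a (min t (τ.hopInstant n)) := by
    intro n
    have h1 := hτ.strictMono_hopInstant n.lt_succ_self
    simp only [Nat.succ_eq_add_one] at h1
    simp only [timeInHop, max_def, min_def]
    split_ifs <;> linarith
  simp_rw [h]
  rw [Finset.sum_range_sub (fun n => max a (min t (τ.hopInstant n))), min_eq_left ht,
    max_eq_right hat, τ.hopInstant_zero, max_eq_left ((min_le_right _ _).trans ha)]

lemma growth_le (hτ : τ.IsRegular) (v : ℝ) {a t : ℝ} (ha : 0 ≤ a) (hat : a ≤ t) :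
    τ.growth v a t ≤ v ^ 2 * (t - a) ^ 2 := by
  obtain ⟨N, hN⟩ := hτ.exists_lt_hopInstant t
  rw [hτ.growth_eq_sum v hN.le, ← hτ.sum_timeInHop ha hat hN.le, ← Finset.mul_sum]
  gcongr
  exact Finset.sum_sq_le_sq_sum_of_nonneg fun n _ => τ.timeInHop_nonneg a t n

/-- The uncertainty accumulated before a hop instant and after it add up: no hop contributes to
both. -/
lemma growth_add (hτ : τ.IsRegular) (v : ℝ) {a t : ℝ} {b : ℕ} (hab : a ≤ τ.hopInstant b)
    (hbt : τ.hopInstant b ≤ t) :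
    τ.growth v a t = τ.growth v a (τ.hopInstant b) + τ.growth v (τ.hopInstant b) t := by
  obtain ⟨N, hN⟩ := hτ.exists_lt_hopInstant t
  rw [hτ.growth_eq_sum v hN.le, hτ.growth_eq_sum v (hbt.trans hN.le), hτ.growth_eq_sum v hN.le,
    ← Finset.sum_add_distrib]
  refine Finset.sum_congr rfl fun n _ => ?_
  rcases lt_or_ge n b with hn | hn
  · have h1 : τ.hopInstant (n + 1) ≤ τ.hopInstant b := hτ.strictMono_hopInstant.monotone hn
    rw [hτ.timeInHop_eq_zero_of_lt (t := t) le_rfl hn]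
    simp [timeInHop, min_eq_right h1, min_eq_right (h1.trans hbt)]
  · have h1 : τ.hopInstant b ≤ τ.hopInstant n := hτ.strictMono_hopInstant.monotone hn
    rw [hτ.timeInHop_eq_zero_of_ge (a := a) le_rfl hn]
    simp [timeInHop, max_eq_right h1, max_eq_right (hab.trans h1)]

lemma growth_within_hop (hτ : τ.IsRegular) (v : ℝ) {t : ℝ} {b : ℕ} (h1 : τ.hopInstant b ≤ t)
    (h2 : t ≤ τ.hopInstant (b + 1)) :
    τ.growth v (τ.hopInstant b) t = v ^ 2 * (t - τ.hopInstant b) ^ 2 := by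
  rw [hτ.growth_eq_sum v h2, Finset.sum_range_succ, Finset.sum_eq_zero, zero_add]
  · simp [timeInHop, min_eq_left h2, max_eq_right (sub_nonneg.2 h1)]
  · intro n hn
    rw [hτ.timeInHop_eq_zero_of_lt le_rfl (by simpa using hn)]; simp

lemma growth_hopInstant (hτ : τ.IsRegular) (v : ℝ) {a b : ℕ} (hab : a ≤ b) :
    τ.growth v (τ.hopInstant a) (τ.hopInstant b) = ∑ j ∈ Finset.Ico a b, v ^ 2 * τ.hop j ^ 2 := by
  induction b, hab using Nat.le_induction with
  | base =>
    have := growth_nonneg τ v (τ.hopInstant a) (τ.hopInstant a)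
    have := hτ.growth_le v (hτ.hopInstant_nonneg a) le_rfl
    simp only [sub_self] at this
    simp only [Finset.Ico_self, Finset.sum_empty]
    nlinarith
  | succ b hab ih =>
    have h1 := hτ.strictMono_hopInstant.monotone b.le_succ
    simp only [Nat.succ_eq_add_one] at h1
    rw [hτ.growth_add v (hτ.strictMono_hopInstant.monotone hab) h1,
      ih, hτ.growth_within_hop v h1 le_rfl, Finset.sum_Ico_succ_top hab, hopInstant_succ]
    ring

lemma integral_growth_hopInstant (hτ : τ.IsRegular) (v : ℝ) {a b : ℕ} (hab : a ≤ b) :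
    ∫ t in (τ.hopInstant a)..(τ.hopInstant b), τ.growth v (τ.hopInstant a) t =
      ∑ j ∈ Finset.Ico a b, v ^ 2 / 3 * τ.hop j ^ 3 +
      ∑ j ∈ Finset.Ico a b, τ.hop j * ∑ l ∈ Finset.Ico a j, v ^ 2 * τ.hop l ^ 2 := by
  induction b, hab using Nat.le_induction with
  | base => simp
  | succ b hab ih =>
    have h1 : τ.hopInstant b ≤ τ.hopInstant (b + 1) :=
      hτ.strictMono_hopInstant.monotone b.le_succ
    have hii : ∀ x y, IntervalIntegrable (τ.growth v (τ.hopInstant a)) volume x y :=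
      fun x y => (hτ.continuous_growth v _).intervalIntegrable x y
    rw [← intervalIntegral.integral_add_adjacent_intervals (hii _ (τ.hopInstant b)) (hii _ _), ih,
      Finset.sum_Ico_succ_top hab, Finset.sum_Ico_succ_top hab]
    have h2 : ∫ t in (τ.hopInstant b)..(τ.hopInstant (b + 1)), τ.growth v (τ.hopInstant a) t =
        ∫ t in (τ.hopInstant b)..(τ.hopInstant (b + 1)),
          ((∑ l ∈ Finset.Ico a b, v ^ 2 * τ.hop l ^ 2) + v ^ 2 * (t - τ.hopInstant b) ^ 2) := by
      refine intervalIntegral.integral_congr fun t ht => ?_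
      rw [Set.uIcc_of_le h1] at ht
      rw [hτ.growth_add v (hτ.strictMono_hopInstant.monotone hab) ht.1,
        hτ.growth_hopInstant v hab, hτ.growth_within_hop v ht.1 ht.2]
    rw [h2, intervalIntegral.integral_add (by simp)
      (Continuous.intervalIntegrable (by fun_prop) _ _), intervalIntegral.integral_const,
      intervalIntegral.integral_const_mul,
      intervalIntegral.integral_comp_sub_right (fun t => t ^ 2), integral_pow, hopInstant_succ]
    simp only [smul_eq_mul]
    ring

lemma infinite_updates (hτ : τ.IsRegular) :
    (Set.ofPred fun n => n = 0 ∨ τ.poll n = true).Infinite :=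
  hτ.poll_infinite.mono fun _ h => Or.inr h

lemma strictMono_updateHop (hτ : τ.IsRegular) : StrictMono τ.updateHop :=
  Nat.nth_strictMono hτ.infinite_updates

lemma updateInstant_nonneg (hτ : τ.IsRegular) (i : ℕ) : 0 ≤ τ.updateInstant i :=
  hτ.hopInstant_nonneg _

lemma tendsto_updateInstant (hτ : τ.IsRegular) : Tendsto τ.updateInstant atTop atTop :=
  hτ.tendsto_hopInstant.comp hτ.strictMono_updateHop.tendsto_atTop

lemma updateInstant_le_departure (hτ : τ.IsRegular) (i : ℕ) :
    τ.updateInstant i ≤ τ.departure i := by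
  cases i with
  | zero => rw [updateInstant_zero]; exact hτ.first_nonneg
  | succ i =>
    rw [departure]
    linarith [le_max_right (τ.departure i) (τ.updateInstant (i + 1)), hτ.service_nonneg i]

lemma sysTime_nonneg (hτ : τ.IsRegular) (i : ℕ) : 0 ≤ τ.sysTime i :=
  sub_nonneg.2 (hτ.updateInstant_le_departure i)

lemma monotone_departure (hτ : τ.IsRegular) : Monotone τ.departure :=
  monotone_nat_of_le_succ fun i => by
    rw [departure]
    linarith [le_max_left (τ.departure i) (τ.updateInstant (i + 1)), hτ.service_nonneg i]

lemma departure_nonneg (hτ : τ.IsRegular) (i : ℕ) : 0 ≤ τ.departure i :=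
  (hτ.updateInstant_nonneg i).trans (hτ.updateInstant_le_departure i)

lemma tendsto_departure (hτ : τ.IsRegular) : Tendsto τ.departure atTop atTop :=
  tendsto_atTop_mono hτ.updateInstant_le_departure hτ.tendsto_updateInstant

/-- The area between two consecutive uncertainty curves splits into the area under the first curve
up to the next update and a rectangle of width equal to the system time. -/
theorem areaQ_eq (hτ : τ.IsRegular) (v : ℝ) (i : ℕ) :
    τ.areaQ v i = τ.areaG1 v i + τ.areaG2 v i + τ.areaG3 v i := by
  have hab : τ.updateHop i ≤ τ.updateHop (i + 1) := hτ.strictMono_updateHop.monotone i.le_succ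
  have hD := hτ.updateInstant_le_departure (i + 1)
  have hii : ∀ x y z, IntervalIntegrable (τ.growth v x) volume y z :=
    fun x y z => (hτ.continuous_growth v x).intervalIntegrable y z
  unfold areaQ areaG1 areaG2 areaG3 hopsBetween sysTime
  rw [← intervalIntegral.integral_add_adjacent_intervals (hii _ _ (τ.updateInstant (i + 1)))
    (hii _ _ _), add_sub_assoc, ← intervalIntegral.integral_sub (hii _ _ _) (hii _ _ _)]
  have h2 : ∫ t in (τ.updateInstant (i + 1))..(τ.departure (i + 1)),
      (τ.growth v (τ.updateInstant i) t - τ.growth v (τ.updateInstant (i + 1)) t) =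
      ∫ t in (τ.updateInstant (i + 1))..(τ.departure (i + 1)),
        ∑ j ∈ Finset.Ico (τ.updateHop i) (τ.updateHop (i + 1)), v ^ 2 * τ.hop j ^ 2 := by
    refine intervalIntegral.integral_congr fun t ht => ?_
    rw [Set.uIcc_of_le hD] at ht
    have := hτ.growth_add v (hτ.strictMono_hopInstant.monotone hab) ht.1
    rw [hτ.growth_hopInstant v hab] at this
    rw [updateInstant, updateInstant, this]; ring
  rw [h2, intervalIntegral.integral_const, smul_eq_mul, mul_comm (_ - _)]
  congr 1
  exact hτ.integral_growth_hopInstant v hab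

lemma latest_eq (hτ : τ.IsRegular) {i : ℕ} {t : ℝ} (h1 : τ.departure i ≤ t)
    (h2 : t < τ.departure (i + 1)) : τ.latest t = i := by
  refine IsGreatest.csSup_eq ⟨h1, fun j (hj : τ.departure j ≤ t) => ?_⟩
  by_contra hij
  have := hτ.monotone_departure (show i + 1 ≤ j by omega)
  linarith

/-- Before the departure of update `1` the server uses update `0`, departed or not. -/
lemma latest_eq_zero (hτ : τ.IsRegular) {t : ℝ} (h : t < τ.departure 1) : τ.latest t = 0 := by
  rcases le_or_gt (τ.departure 0) t with h0 | h0
  · exact hτ.latest_eq h0 h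
  · have : {i : ℕ | τ.departure i ≤ t} = ∅ := by
      ext i
      simp only [Set.mem_ofPred_eq, Set.mem_empty_iff_false, iff_false, not_le]
      exact h0.trans_le (hτ.monotone_departure (Nat.zero_le i))
    rw [latest, this, csSup_empty]; rfl

lemma exists_departure_le_lt (hτ : τ.IsRegular) {t : ℝ} (ht : τ.departure 0 ≤ t) :
    τ.departure (τ.latest t) ≤ t ∧ t < τ.departure (τ.latest t + 1) := by
  have hex : ∃ n, t < τ.departure n := (hτ.tendsto_departure.eventually_gt_atTop t).exists
  classical
  obtain ⟨k, hk⟩ : ∃ k, Nat.find hex = k + 1 := Nat.exists_eq_succ_of_ne_zero fun h0 => by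
    have := Nat.find_spec hex
    rw [h0] at this; linarith
  have h1 : t < τ.departure (k + 1) := hk ▸ Nat.find_spec hex
  have h2 : τ.departure k ≤ t := not_lt.1 (Nat.find_min hex (by omega))
  rw [hτ.latest_eq h2 h1]
  exact ⟨h2, h1⟩

lemma updateInstant_latest_le (hτ : τ.IsRegular) {t : ℝ} (ht : 0 ≤ t) :
    τ.updateInstant (τ.latest t) ≤ t := by
  rcases le_or_gt (τ.departure 0) t with h0 | h0
  · exact (hτ.updateInstant_le_departure _).trans (hτ.exists_departure_le_lt h0).1
  · rw [hτ.latest_eq_zero (h0.trans_le (hτ.monotone_departure zero_le_one)), updateInstant_zero]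
    exact ht

/-- The sawtooth: the uncertainty accumulated at time `t` since the generation of the latest available
update. -/
def _root_.Timing.currentGrowth (τ : Timing) (v t : ℝ) : ℝ :=
  τ.growth v (τ.updateInstant (τ.latest t)) t

lemma _root_.Timing.ae_currentGrowth_eq (τ : Timing) (v : ℝ) {i : ℕ} {x : ℝ}
    (hx : ∀ t, x < t → t < τ.departure (i + 1) → τ.latest t = i) (hxD : x ≤ τ.departure (i + 1)) :
    ∀ᵐ t ∂volume.restrict (Set.uIoc x (τ.departure (i + 1))),
      τ.growth v (τ.updateInstant i) t = τ.currentGrowth v t := by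
  rw [Set.uIoc_of_le hxD, ← Measure.restrict_congr_set Ioo_ae_eq_Ioc]
  refine (ae_restrict_iff' measurableSet_Ioo).2 (Eventually.of_forall fun t ht => ?_)
  rw [currentGrowth, hx t ht.1 ht.2]

/-- The area under the sawtooth up to a departure. The part of each uncertainty curve that lies under
the preceding one is counted once, so that the `Q`s telescope. -/
lemma integral_currentGrowth (hτ : τ.IsRegular) (v : ℝ) (n : ℕ) :
    IntervalIntegrable (τ.currentGrowth v) volume 0 (τ.departure (n + 1)) ∧
    ∫ t in (0 : ℝ)..(τ.departure (n + 1)), τ.currentGrowth v t =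
      ∑ i ∈ Finset.range (n + 1), τ.areaQ v i +
      ∫ t in (τ.updateInstant (n + 1))..(τ.departure (n + 1)),
        τ.growth v (τ.updateInstant (n + 1)) t := by
  have hii : ∀ x y z, IntervalIntegrable (τ.growth v x) volume y z :=
    fun x y z => (hτ.continuous_growth v x).intervalIntegrable y z
  induction n with
  | zero =>
    have h := τ.ae_currentGrowth_eq v (i := 0) (x := 0) (fun t _ ht => hτ.latest_eq_zero ht)
      (hτ.departure_nonneg _)
    refine ⟨(hii _ _ _).congr_ae h, ?_⟩
    rw [← intervalIntegral.integral_congr_ae_restrict h]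
    simp [areaQ, updateInstant_zero]
  | succ n ih =>
    have hD := hτ.monotone_departure (n + 1).le_succ
    have h := τ.ae_currentGrowth_eq v (i := n + 1) (fun t h1 h2 => hτ.latest_eq h1.le h2) hD
    have hint := (hii _ (τ.departure (n + 1)) _).congr_ae h
    refine ⟨ih.1.trans hint, ?_⟩
    rw [← intervalIntegral.integral_add_adjacent_intervals ih.1 hint, ih.2,
      ← intervalIntegral.integral_congr_ae_restrict h, Finset.sum_range_succ _ (n + 1)]
    have h1 := intervalIntegral.integral_add_adjacent_intervals
      (hii (τ.updateInstant (n + 1)) (τ.updateInstant (n + 1)) (τ.departure (n + 1)))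
      (hii _ _ (τ.departure (n + 1 + 1)))
    have h2 : τ.areaQ v (n + 1) + ∫ t in (τ.updateInstant (n + 1 + 1))..(τ.departure (n + 1 + 1)),
        τ.growth v (τ.updateInstant (n + 1 + 1)) t = ∫ t in
          (τ.updateInstant (n + 1))..(τ.departure (n + 1 + 1)),
            τ.growth v (τ.updateInstant (n + 1)) t := sub_add_cancel _ _
    linarith

lemma intervalIntegrable_currentGrowth (hτ : τ.IsRegular) (v : ℝ) {T : ℝ} (hT : 0 ≤ T) :
    IntervalIntegrable (τ.currentGrowth v) volume 0 T := by
  obtain ⟨n, hn⟩ := ((hτ.tendsto_departure.comp (tendsto_add_atTop_nat 1)).eventually_ge_atTop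
    T).exists
  refine (hτ.integral_currentGrowth v n).1.mono_set ?_
  rw [Set.uIcc_of_le hT, Set.uIcc_of_le (hτ.departure_nonneg _)]
  exact Set.Icc_subset_Icc_right hn

/-- Renewal-reward on a sample path: if the areas `Q` average to `q`, the updates are generated at
rate `β` and the system times grow slower than `n ^ (1/3)`, then the sawtooth averages to `β q`. -/
theorem tendsto_average_currentGrowth (hτ : τ.IsRegular) (v : ℝ) {q β : ℝ} (hβ : 0 < β)
    (hQ : Tendsto (fun n : ℕ => (∑ i ∈ Finset.range n, τ.areaQ v i) / n) atTop (𝓝 q))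
    (hu : Tendsto (fun n : ℕ => τ.updateInstant n / n) atTop (𝓝 β⁻¹))
    (hT : Tendsto (fun n : ℕ => τ.sysTime n ^ 3 / n) atTop (𝓝 0)) :
    Tendsto (fun T : ℝ => (1 / T) * ∫ t in (0 : ℝ)..T, τ.currentGrowth v t) atTop
      (𝓝 (β * q)) := by
  set F : ℝ → ℝ := fun T => ∫ t in (0 : ℝ)..T, τ.currentGrowth v t with hF
  have hFmono : ∀ {x y}, 0 ≤ x → x ≤ y → F x ≤ F y := fun {x y} hx hxy =>
    intervalIntegral.integral_mono_interval le_rfl hx hxy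
      (Eventually.of_forall fun t => growth_nonneg _ _ _ _)
      (hτ.intervalIntegrable_currentGrowth v (hx.trans hxy))
  have hFnn : ∀ {x}, 0 ≤ x → 0 ≤ F x := fun {x} hx => by
    have := hFmono le_rfl hx
    simpa [hF] using this
  have hD : Tendsto (fun n : ℕ => τ.departure n / n) atTop (𝓝 β⁻¹) := by
    have h1 : Tendsto (fun n : ℕ => τ.sysTime n / n) atTop (𝓝 0) := by
      refine squeeze_zero (g := fun n : ℕ => 1 / (n : ℝ) + τ.sysTime n ^ 3 / n)
        (fun n => div_nonneg (hτ.sysTime_nonneg n) n.cast_nonneg) (fun n => ?_) ?_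
      · rw [← add_div]
        gcongr
        have h0 := hτ.sysTime_nonneg n
        rcases le_total (τ.sysTime n) 1 with h | h
        · have : 0 ≤ τ.sysTime n ^ 3 := by positivity
          linarith
        · nlinarith [mul_nonneg h0 (sub_nonneg.2 h), mul_nonneg (mul_nonneg h0 h0) (sub_nonneg.2 h)]
      · simpa using tendsto_one_div_atTop_nhds_zero_nat.add hT
    have := hu.add h1
    rw [add_zero] at this
    refine this.congr fun n => ?_
    rw [← add_div, sysTime]; ring
  have hFD : Tendsto (fun n : ℕ => F (τ.departure (n + 1)) / (n + 1 : ℕ)) atTop (𝓝 q) := by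
    have hR : Tendsto (fun n : ℕ => (∫ t in (τ.updateInstant n)..(τ.departure n),
        τ.growth v (τ.updateInstant n) t) / n) atTop (𝓝 0) := by
      refine squeeze_zero (g := fun n : ℕ => v ^ 2 * (τ.sysTime n ^ 3 / n))
        (fun n => ?_) (fun n => ?_) (by simpa using hT.const_mul (v ^ 2))
      · exact div_nonneg (intervalIntegral.integral_nonneg (hτ.updateInstant_le_departure n)
          fun t _ => growth_nonneg _ _ _ _) n.cast_nonneg
      · rw [← mul_div_assoc]
        gcongr
        have hle := hτ.updateInstant_le_departure n
        have h1 : ∀ t ∈ Set.Icc (τ.updateInstant n) (τ.departure n),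
            τ.growth v (τ.updateInstant n) t ≤ v ^ 2 * τ.sysTime n ^ 2 := fun t ht => by
          refine (hτ.growth_le v (hτ.updateInstant_nonneg n) ht.1).trans ?_
          have := ht.1
          gcongr
          rw [sysTime]; linarith [ht.2]
        have h2 := intervalIntegral.integral_mono_on hle
          ((hτ.continuous_growth v _).intervalIntegrable _ _)
          (continuous_const.intervalIntegrable (μ := volume) _ _) h1
        refine h2.trans_eq ?_
        rw [intervalIntegral.integral_const, smul_eq_mul, sysTime]; ring
    have := (hQ.add hR).comp (tendsto_add_atTop_nat 1)
    rw [add_zero] at this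
    refine this.congr fun n => ?_
    simp only [Function.comp_apply]
    rw [← add_div, hF]
    simp only
    rw [(hτ.integral_currentGrowth v n).2]
  have hDne : ∀ᶠ n : ℕ in atTop, 0 < τ.departure n := hτ.tendsto_departure.eventually_gt_atTop 0
  have hratio : Tendsto (fun n : ℕ => ((n + 1 : ℕ) : ℝ) / n) atTop (𝓝 1) := by
    have := tendsto_one_div_atTop_nhds_zero_nat (𝕜 := ℝ)
    have := this.const_add 1
    rw [add_zero] at this
    refine this.congr' ?_
    filter_upwards [eventually_gt_atTop 0] with n hn
    have : (n : ℝ) ≠ 0 := by positivity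
    field_simp
    push_cast; ring
  -- upper and lower comparison sequences along the departures
  have hup : Tendsto (fun n : ℕ => F (τ.departure (n + 1)) / τ.departure n) atTop (𝓝 (β * q)) := by
    have := (hFD.mul hratio).div hD (inv_ne_zero hβ.ne')
    rw [show q * 1 / β⁻¹ = β * q by rw [div_inv_eq_mul]; ring] at this
    refine this.congr' ?_
    filter_upwards [eventually_gt_atTop 0, hDne] with n hn hn'
    have : (n : ℝ) ≠ 0 := by positivity
    have : ((n + 1 : ℕ) : ℝ) ≠ 0 := by positivity
    have := hn'.ne'
    simp only [Pi.div_apply]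
    field_simp
  have hlo : Tendsto (fun n : ℕ => F (τ.departure n) / τ.departure (n + 1)) atTop
      (𝓝 (β * q)) := by
    rw [← tendsto_add_atTop_iff_nat 1]
    have h2 : Tendsto (fun n : ℕ => τ.departure (n + 1 + 1) / (n + 1 + 1 : ℕ)) atTop (𝓝 β⁻¹) :=
      hD.comp (tendsto_add_atTop_nat 2)
    have h3 : Tendsto (fun n : ℕ => ((n + 1 + 1 : ℕ) : ℝ) / (n + 1 : ℕ)) atTop (𝓝 1) :=
      hratio.comp (tendsto_add_atTop_nat 1)
    have := (hFD.div (h3.mul h2) (by simpa using hβ.ne'))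
    rw [show q / (1 * β⁻¹) = β * q by rw [one_mul, div_inv_eq_mul]; ring] at this
    refine this.congr' ?_
    filter_upwards [(hDne.filter_mono (tendsto_add_atTop_nat 2))] with n hn'
    have : ((n + 1 : ℕ) : ℝ) ≠ 0 := by positivity
    have : ((n + 1 + 1 : ℕ) : ℝ) ≠ 0 := by positivity
    have h4 : τ.departure (n + 1 + 1) ≠ 0 := hn'.ne'
    simp only [Pi.div_apply]
    field_simp
  have hlat : Tendsto τ.latest atTop atTop := by
    refine tendsto_atTop.2 fun N => ?_
    filter_upwards [eventually_ge_atTop (τ.departure N)] with t ht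
    have h0 := hτ.exists_departure_le_lt ((hτ.monotone_departure (Nat.zero_le N)).trans ht)
    by_contra hN
    have := hτ.monotone_departure (show τ.latest t + 1 ≤ N by omega)
    linarith
  refine tendsto_of_tendsto_of_tendsto_of_le_of_le' (hlo.comp hlat) (hup.comp hlat) ?_ ?_
  · filter_upwards [eventually_ge_atTop (τ.departure 0), eventually_gt_atTop 0] with t ht h0
    obtain ⟨h1, h2⟩ := hτ.exists_departure_le_lt ht
    rw [one_div_mul_eq_div]
    exact div_le_div₀ (hFnn h0.le) (hFmono (hτ.departure_nonneg _) h1) h0 h2.le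
  · filter_upwards [eventually_ge_atTop (τ.departure 0), eventually_gt_atTop 0,
      hlat.eventually hDne] with t ht h0 hpos
    obtain ⟨h1, h2⟩ := hτ.exists_departure_le_lt ht
    rw [one_div_mul_eq_div]
    exact div_le_div₀ (hFnn (hτ.departure_nonneg _)) (hFmono h0.le h2.le) hpos h1

end IsRegular

end Timing

/-! ### The growth factors -/

lemma integral_headingErrLaw {ε : ℝ} (hε : 0 < ε) (f : ℝ → ℝ) :
    ∫ δ, f δ ∂(headingErrLaw ε) = (2 * ε)⁻¹ * ∫ δ in (-ε)..ε, f δ := by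
  rw [headingErrLaw, ProbabilityTheory.cond, integral_smul_measure,
    intervalIntegral.integral_of_le (by linarith), integral_Ioc_eq_integral_Ioo, Real.volume_Ioo,
    ENNReal.toReal_inv, ENNReal.toReal_ofReal (by linarith), smul_eq_mul]
  ring_nf

lemma integral_cos_headingErrLaw {ε : ℝ} (hε : 0 < ε) :
    ∫ δ, Real.cos δ ∂(headingErrLaw ε) = Real.sin ε / ε := by
  rw [integral_headingErrLaw hε, integral_cos, Real.sin_neg]
  field_simp
  ring

lemma integral_sq_headingErrLaw {ε : ℝ} (hε : 0 < ε) :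
    ∫ δ, δ ^ 2 ∂(headingErrLaw ε) = ε ^ 2 / 3 := by
  rw [integral_headingErrLaw hε, integral_pow]
  field_simp
  ring

lemma cos_le_quartic {x : ℝ} (hx : 0 ≤ x) : Real.cos x ≤ 1 - x ^ 2 / 2 + x ^ 4 / 24 := by
  have hd : ∀ x : ℝ, HasDerivAt (fun x : ℝ => 1 - x ^ 2 / 2 + x ^ 4 / 24 - Real.cos x)
      (-x + x ^ 3 / 6 + Real.sin x) x := fun x => by
    have := ((((hasDerivAt_pow 2 x).div_const 2).const_sub 1).add
      ((hasDerivAt_pow 4 x).div_const 24)).sub (Real.hasDerivAt_cos x)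
    refine this.congr_deriv ?_
    push_cast; ring
  have hm : MonotoneOn (fun x : ℝ => 1 - x ^ 2 / 2 + x ^ 4 / 24 - Real.cos x) (Set.Ici 0) := by
    refine monotoneOn_of_deriv_nonneg (convex_Ici 0) (by fun_prop)
      (fun x _ => (hd x).differentiableAt.differentiableWithinAt) fun x hx => ?_
    rw [interior_Ici] at hx
    rw [(hd x).deriv]
    linarith [Real.sin_gt_sub_cube hx]
  have := hm (Set.mem_Ici.2 le_rfl) hx hx
  simp at this
  linarith

lemma sin_le_quintic {x : ℝ} (hx : 0 ≤ x) : Real.sin x ≤ x - x ^ 3 / 6 + x ^ 5 / 120 := by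
  have hd : ∀ x : ℝ, HasDerivAt (fun x : ℝ => x - x ^ 3 / 6 + x ^ 5 / 120 - Real.sin x)
      (1 - x ^ 2 / 2 + x ^ 4 / 24 - Real.cos x) x := fun x => by
    have := (((hasDerivAt_id' x).sub ((hasDerivAt_pow 3 x).div_const 6)).add
      ((hasDerivAt_pow 5 x).div_const 120)).sub (Real.hasDerivAt_sin x)
    refine this.congr_deriv ?_
    push_cast; ring
  have hm : MonotoneOn (fun x : ℝ => x - x ^ 3 / 6 + x ^ 5 / 120 - Real.sin x) (Set.Ici 0) := by
    refine monotoneOn_of_deriv_nonneg (convex_Ici 0) (by fun_prop)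
      (fun x _ => (hd x).differentiableAt.differentiableWithinAt) fun x hx => ?_
    rw [interior_Ici] at hx
    rw [(hd x).deriv]
    linarith [cos_le_quartic (le_of_lt hx)]
  have := hm (Set.mem_Ici.2 le_rfl) hx hx
  simp at this
  linarith

lemma kappa_zero (ε : ℝ) : kappaExact 0 ε = 1 ∧ kappa 0 ε = 1 := by
  simp [kappaExact, kappa]

lemma kappa_one {ε : ℝ} (hε : 0 < ε) : kappa 1 ε = ε ^ 2 / 3 := by
  rw [kappa, integral_sq_headingErrLaw hε]; ring

lemma kappa_sub_kappaExact_one {ε : ℝ} (hε : 0 < ε) :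
    0 ≤ kappa 1 ε - kappaExact 1 ε ∧ kappa 1 ε - kappaExact 1 ε ≤ ε ^ 4 / 60 := by
  have h1 := Real.sin_gt_sub_cube hε
  have h2 := sin_le_quintic hε.le
  have h3 : 1 - ε ^ 2 / 6 ≤ Real.sin ε / ε := by
    rw [le_div_iff₀ hε]; nlinarith
  have h4 : Real.sin ε / ε ≤ 1 - ε ^ 2 / 6 + ε ^ 4 / 120 := by
    rw [div_le_iff₀ hε]; nlinarith
  rw [kappa_one hε, kappaExact, integral_cos_headingErrLaw hε]
  constructor <;> linarith

/-! ### The mean squared error -/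

lemma integral_unitVec_uniform (b : Fin 2) :
    ∫ α, unitVec α b ∂(ProbabilityTheory.cond volume (Set.Ioc 0 (2 * Real.pi))) = 0 := by
  rw [ProbabilityTheory.cond, integral_smul_measure,
    ← intervalIntegral.integral_of_le (by positivity)]
  fin_cases b <;> simp [unitVec]

lemma continuous_unitVec (b : Fin 2) : Continuous fun α => unitVec α b := by
  fin_cases b <;> simp only [unitVec] <;>
    [exact Real.continuous_cos; exact Real.continuous_sin]

lemma abs_unitVec_le_one (α : ℝ) (b : Fin 2) : |unitVec α b| ≤ 1 := by
  fin_cases b <;> simp [unitVec, Real.abs_cos_le_one, Real.abs_sin_le_one]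

/-- The matrix `1 - c R(δ)`, where `R(δ)` is the rotation by the angle `δ`: it maps the direction of a hop
to the error made per unit length when this direction is sensed with error `δ`. -/
def deadReckoning (c δ : ℝ) : Matrix (Fin 2) (Fin 2) ℝ :=
  !![1 - c * Real.cos δ, c * Real.sin δ; -(c * Real.sin δ), 1 - c * Real.cos δ]

lemma unitVec_sub_smul_unitVec (c θ δ : ℝ) (a : Fin 2) :
    unitVec θ a - c * unitVec (θ + δ) a = ∑ b, deadReckoning c δ a b * unitVec θ b := by
  fin_cases a <;> simp [unitVec, deadReckoning, Real.cos_add, Real.sin_add] <;> ring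

lemma continuous_deadReckoning (c : ℝ) (a b : Fin 2) :
    Continuous fun δ => deadReckoning c δ a b := by
  fin_cases a <;> fin_cases b <;> simp only [deadReckoning] <;> simp <;> fun_prop

lemma abs_deadReckoning_le (c δ : ℝ) (a b : Fin 2) : |deadReckoning c δ a b| ≤ 1 + |c| := by
  have h1 := mul_le_of_le_one_right (abs_nonneg c) (Real.abs_cos_le_one δ)
  have h2 := mul_le_of_le_one_right (abs_nonneg c) (Real.abs_sin_le_one δ)
  rw [← abs_mul] at h1 h2
  have h3 : |1 - c * Real.cos δ| ≤ 1 + |c| := by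
    have := abs_sub (1 : ℝ) (c * Real.cos δ)
    rw [abs_one] at this
    linarith
  fin_cases a <;> fin_cases b <;> simp [deadReckoning] <;> first | exact h3 | (rw [← abs_mul]; linarith)

namespace IsRWPMotion

variable {Ω' : Type*} [MeasurableSpace Ω'] {P' : Measure Ω'} {ε : ℝ}
  {Co : Matrix (Fin 2) (Fin 2) ℝ} {M : Ω' → Motion}

/-- Error per unit length of the extrapolation along hop `n`. -/
def hopErr (c : ℝ) (M : Ω' → Motion) (n : ℕ) (a : Fin 2) (ω' : Ω') : ℝ :=
  ∑ b, deadReckoning c ((M ω').headingErr n) a b * unitVec ((M ω').heading n) b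

lemma aestronglyMeasurable_hopErr (hM : IsRWPMotion P' ε Co M) (c : ℝ) (n : ℕ) (a : Fin 2) :
    AEStronglyMeasurable (hopErr c M n a) P' := by
  refine Finset.aestronglyMeasurable_fun_sum _ fun b _ => AEStronglyMeasurable.mul ?_ ?_
  · exact ((continuous_deadReckoning c a b).measurable.comp_aemeasurable
      (hM.headingErr_law n).aemeasurable).aestronglyMeasurable
  · exact ((continuous_unitVec b).measurable.comp_aemeasurable
      (hM.heading_law n).aemeasurable).aestronglyMeasurable

lemma memLp_hopErr [IsProbabilityMeasure P'] (hM : IsRWPMotion P' ε Co M) (c : ℝ) (n : ℕ)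
    (a : Fin 2) : MemLp (hopErr c M n a) 2 P' := by
  refine MemLp.of_bound (hM.aestronglyMeasurable_hopErr c n a) (∑ _b : Fin 2, (1 + |c|) * 1)
    (Eventually.of_forall fun ω' => ?_)
  refine (norm_sum_le _ _).trans (Finset.sum_le_sum fun b _ => ?_)
  rw [norm_mul]
  exact mul_le_mul (abs_deadReckoning_le _ _ _ _) (abs_unitVec_le_one _ _) (norm_nonneg _)
    (by positivity)

lemma integral_unitVec_heading (hM : IsRWPMotion P' ε Co M) (n : ℕ) (b : Fin 2) :
    ∫ ω', unitVec ((M ω').heading n) b ∂P' = 0 := by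
  rw [← integral_unitVec_uniform b]
  exact (hM.heading_law n).integral_comp (continuous_unitVec b).aestronglyMeasurable

lemma integral_unitVec_mul_unitVec (hM : IsRWPMotion P' ε Co M) {n m : ℕ} (hnm : n ≠ m)
    (b b' : Fin 2) :
    ∫ ω', unitVec ((M ω').heading n) b * unitVec ((M ω').heading m) b' ∂P' = 0 := by
  have h := (hM.heading_indep.indepFun hnm).comp (continuous_unitVec b).measurable
    (continuous_unitVec b').measurable
  have := h.integral_fun_mul_eq_mul_integral
    ((continuous_unitVec b).measurable.comp_aemeasurable
      (hM.heading_law n).aemeasurable).aestronglyMeasurable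
    ((continuous_unitVec b').measurable.comp_aemeasurable
      (hM.heading_law m).aemeasurable).aestronglyMeasurable
  refine this.trans ?_
  simp only [Function.comp_apply]
  rw [hM.integral_unitVec_heading, zero_mul]

lemma aemeasurable_heading (hM : IsRWPMotion P' ε Co M) :
    AEMeasurable (fun ω' => (M ω').heading) P' :=
  aemeasurable_pi_lambda _ fun n => (hM.heading_law n).aemeasurable

lemma aemeasurable_err (hM : IsRWPMotion P' ε Co M) :
    AEMeasurable (fun ω' => ((M ω').headingErr, (M ω').fixErr)) P' :=
  AEMeasurable.prodMk (aemeasurable_pi_lambda _ fun n => (hM.headingErr_law n).aemeasurable)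
    (aemeasurable_pi_lambda _ fun i => aemeasurable_pi_lambda _ fun a =>
      (hM.fixErr_memLp i a).aestronglyMeasurable.aemeasurable)

/-- Errors are uncorrelated with every centred function of the headings. -/
lemma integral_err_mul_heading (hM : IsRWPMotion P' ε Co M)
    {φ : (ℕ → ℝ) → ℝ} {ψ : (ℕ → ℝ) × (ℕ → Fin 2 → ℝ) → ℝ} (hφ : Measurable φ)
    (hψ : Measurable ψ) (h0 : ∫ ω', φ (M ω').heading ∂P' = 0) :
    ∫ ω', ψ ((M ω').headingErr, (M ω').fixErr) * φ (M ω').heading ∂P' = 0 := by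
  have := (hM.indep.comp hφ hψ).symm.integral_fun_mul_eq_mul_integral
    (hψ.comp_aemeasurable hM.aemeasurable_err).aestronglyMeasurable
    (hφ.comp_aemeasurable hM.aemeasurable_heading).aestronglyMeasurable
  refine this.trans ?_
  simp only [Function.comp_apply]
  rw [h0, mul_zero]

lemma integrable_err_mul_heading [IsProbabilityMeasure P'] (hM : IsRWPMotion P' ε Co M)
    {φ : (ℕ → ℝ) → ℝ} {ψ : (ℕ → ℝ) × (ℕ → Fin 2 → ℝ) → ℝ} (hφ : Measurable φ) {C : ℝ}
    (hb : ∀ x, |φ x| ≤ C) (hi : Integrable (fun ω' => ψ ((M ω').headingErr, (M ω').fixErr)) P') :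
    Integrable (fun ω' => ψ ((M ω').headingErr, (M ω').fixErr) * φ (M ω').heading) P' :=
  hi.mul_bdd (c := C) (hφ.comp_aemeasurable hM.aemeasurable_heading).aestronglyMeasurable
    (Eventually.of_forall fun _ => hb _)

/-- The extrapolation errors of different hops are uncorrelated, because the directions of these hops
are independent and centred, whatever the dependence between the sensing errors. -/
lemma integral_hopErr_mul_hopErr [IsProbabilityMeasure P'] (hM : IsRWPMotion P' ε Co M) (c : ℝ)
    {n m : ℕ} (hnm : n ≠ m) (a : Fin 2) :
    ∫ ω', hopErr c M n a ω' * hopErr c M m a ω' ∂P' = 0 := by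
  have h : ∀ b b' : Fin 2,
      Integrable (fun ω' => (deadReckoning c ((M ω').headingErr n) a b *
        deadReckoning c ((M ω').headingErr m) a b') *
        (unitVec ((M ω').heading n) b * unitVec ((M ω').heading m) b')) P' ∧
      ∫ ω', (deadReckoning c ((M ω').headingErr n) a b *
        deadReckoning c ((M ω').headingErr m) a b') *
        (unitVec ((M ω').heading n) b * unitVec ((M ω').heading m) b') ∂P' = 0 := by
    intro b b'
    have hφ : Measurable fun x : ℕ → ℝ => unitVec (x n) b * unitVec (x m) b' :=
      ((continuous_unitVec b).measurable.comp (measurable_pi_apply n)).mul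
        ((continuous_unitVec b').measurable.comp (measurable_pi_apply m))
    have hψ : Measurable fun y : (ℕ → ℝ) × (ℕ → Fin 2 → ℝ) =>
        deadReckoning c (y.1 n) a b * deadReckoning c (y.1 m) a b' :=
      ((continuous_deadReckoning c a b).measurable.comp
          ((measurable_pi_apply n).comp measurable_fst)).mul
        ((continuous_deadReckoning c a b').measurable.comp
          ((measurable_pi_apply m).comp measurable_fst))
    refine ⟨hM.integrable_err_mul_heading hφ (C := 1 * 1)
      (ψ := fun y => deadReckoning c (y.1 n) a b * deadReckoning c (y.1 m) a b')
      (fun x => ?_) ?_,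
      hM.integral_err_mul_heading hφ hψ (hM.integral_unitVec_mul_unitVec hnm b b')⟩
    · rw [abs_mul]
      exact mul_le_mul (abs_unitVec_le_one _ _) (abs_unitVec_le_one _ _) (abs_nonneg _) zero_le_one
    · refine Integrable.of_bound (hψ.comp_aemeasurable hM.aemeasurable_err).aestronglyMeasurable
        ((1 + |c|) * (1 + |c|)) (Eventually.of_forall fun ω' => ?_)
      rw [norm_mul]
      exact mul_le_mul (abs_deadReckoning_le _ _ _ _) (abs_deadReckoning_le _ _ _ _)
        (norm_nonneg _) (by positivity)
  have e : ∀ ω', hopErr c M n a ω' * hopErr c M m a ω' =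
      ∑ b, ∑ b', (deadReckoning c ((M ω').headingErr n) a b *
        deadReckoning c ((M ω').headingErr m) a b') *
        (unitVec ((M ω').heading n) b * unitVec ((M ω').heading m) b') := fun ω' => by
    rw [hopErr, hopErr, Finset.sum_mul_sum]
    exact Finset.sum_congr rfl fun b _ => Finset.sum_congr rfl fun b' _ => by ring
  simp_rw [e]
  rw [integral_finsetSum _ fun b _ => integrable_finsetSum _ fun b' _ => (h b b').1]
  refine Finset.sum_eq_zero fun b _ => ?_
  rw [integral_finsetSum _ fun b' _ => (h b b').1]
  exact Finset.sum_eq_zero fun b' _ => (h b b').2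

lemma integral_fixErr_mul_hopErr [IsProbabilityMeasure P'] (hM : IsRWPMotion P' ε Co M) (c : ℝ)
    (i n : ℕ) (a : Fin 2) :
    ∫ ω', (M ω').fixErr i a * hopErr c M n a ω' ∂P' = 0 := by
  have h : ∀ b : Fin 2,
      Integrable (fun ω' => ((M ω').fixErr i a * deadReckoning c ((M ω').headingErr n) a b) *
        unitVec ((M ω').heading n) b) P' ∧
      ∫ ω', ((M ω').fixErr i a * deadReckoning c ((M ω').headingErr n) a b) *
        unitVec ((M ω').heading n) b ∂P' = 0 := by
    intro b
    have hφ : Measurable fun x : ℕ → ℝ => unitVec (x n) b :=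
      (continuous_unitVec b).measurable.comp (measurable_pi_apply n)
    have hψ : Measurable fun y : (ℕ → ℝ) × (ℕ → Fin 2 → ℝ) =>
        y.2 i a * deadReckoning c (y.1 n) a b := by
      have h1 : Measurable fun y : (ℕ → ℝ) × (ℕ → Fin 2 → ℝ) => y.2 i a := by fun_prop
      exact h1.mul ((continuous_deadReckoning c a b).measurable.comp
        ((measurable_pi_apply n).comp measurable_fst))
    refine ⟨hM.integrable_err_mul_heading hφ (C := 1) (fun x => abs_unitVec_le_one _ _)
      (ψ := fun y => y.2 i a * deadReckoning c (y.1 n) a b) ?_,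
      hM.integral_err_mul_heading hφ hψ (hM.integral_unitVec_heading n b)⟩
    exact ((hM.fixErr_memLp i a).integrable one_le_two).mul_bdd (c := 1 + |c|)
      ((continuous_deadReckoning c a b).measurable.comp_aemeasurable
        (hM.headingErr_law n).aemeasurable).aestronglyMeasurable
      (Eventually.of_forall fun ω' => abs_deadReckoning_le _ _ _ _)
  have e : ∀ ω', (M ω').fixErr i a * hopErr c M n a ω' =
      ∑ b, ((M ω').fixErr i a * deadReckoning c ((M ω').headingErr n) a b) *
        unitVec ((M ω').heading n) b := fun ω' => by
    rw [hopErr, Finset.mul_sum]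
    exact Finset.sum_congr rfl fun b _ => by ring
  simp_rw [e]
  rw [integral_finsetSum _ fun b _ => (h b).1]
  exact Finset.sum_eq_zero fun b _ => (h b).2

lemma sum_integral_hopErr_sq [IsProbabilityMeasure P'] (hM : IsRWPMotion P' ε Co M) (c : ℝ)
    (n : ℕ) : ∑ a, ∫ ω', hopErr c M n a ω' * hopErr c M n a ω' ∂P' = kappaExact c ε := by
  have hi : ∀ a ∈ Finset.univ, Integrable (fun ω' => hopErr c M n a ω' * hopErr c M n a ω') P' :=
    fun a _ => (hM.memLp_hopErr c n a).integrable_mul (hM.memLp_hopErr c n a)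
  rw [← integral_finsetSum _ hi]
  have e : ∀ ω', ∑ a, hopErr c M n a ω' * hopErr c M n a ω' =
      (1 + c ^ 2) - 2 * c * Real.cos ((M ω').headingErr n) := fun ω' => by
    simp only [hopErr, Fin.sum_univ_two, deadReckoning, unitVec]
    simp
    have h1 := Real.sin_sq_add_cos_sq ((M ω').headingErr n)
    have h2 := Real.sin_sq_add_cos_sq ((M ω').heading n)
    linear_combination (c ^ 2 * (Real.sin ((M ω').heading n) ^ 2 +
      Real.cos ((M ω').heading n) ^ 2)) * h1 +
      ((1 + c ^ 2) - 2 * c * Real.cos ((M ω').headingErr n)) * h2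
  simp_rw [e]
  have hcos : ∫ ω', Real.cos ((M ω').headingErr n) ∂P' = ∫ δ, Real.cos δ ∂(headingErrLaw ε) :=
    (hM.headingErr_law n).integral_comp Real.continuous_cos.aestronglyMeasurable
  have hi : Integrable (fun ω' => Real.cos ((M ω').headingErr n)) P' :=
    Integrable.of_bound (Real.continuous_cos.measurable.comp_aemeasurable
      (hM.headingErr_law n).aemeasurable).aestronglyMeasurable 1
      (Eventually.of_forall fun ω' => Real.abs_cos_le_one _)
  rw [integral_sub (integrable_const _) (hi.const_mul _), integral_const_mul, hcos, kappaExact]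
  simp

/-- Mean square of the error of an estimate that is extrapolated over finitely many hops. -/
lemma sum_integral_sq [IsProbabilityMeasure P'] (hM : IsRWPMotion P' ε Co M) (c : ℝ) (i N : ℕ)
    (w : ℕ → ℝ) :
    ∑ a, ∫ ω', ((M ω').fixErr i a + ∑ n ∈ Finset.range N, w n * hopErr c M n a ω') *
      ((M ω').fixErr i a + ∑ n ∈ Finset.range N, w n * hopErr c M n a ω') ∂P' =
    Co.trace + kappaExact c ε * ∑ n ∈ Finset.range N, w n ^ 2 := by
  have hVV : ∀ n m a, Integrable (fun ω' => hopErr c M n a ω' * hopErr c M m a ω') P' :=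
    fun n m a => (hM.memLp_hopErr c n a).integrable_mul (hM.memLp_hopErr c m a)
  have hFV : ∀ n a, Integrable (fun ω' => (M ω').fixErr i a * hopErr c M n a ω') P' :=
    fun n a => (hM.fixErr_memLp i a).integrable_mul (hM.memLp_hopErr c n a)
  have hFF : ∀ a, Integrable (fun ω' => (M ω').fixErr i a * (M ω').fixErr i a) P' :=
    fun a => (hM.fixErr_memLp i a).integrable_mul (hM.fixErr_memLp i a)
  have key : ∀ a, ∫ ω', ((M ω').fixErr i a + ∑ n ∈ Finset.range N, w n * hopErr c M n a ω') *
      ((M ω').fixErr i a + ∑ n ∈ Finset.range N, w n * hopErr c M n a ω') ∂P' =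
      Co a a + ∑ n ∈ Finset.range N, w n ^ 2 *
        ∫ ω', hopErr c M n a ω' * hopErr c M n a ω' ∂P' := by
    intro a
    have e : ∀ ω', ((M ω').fixErr i a + ∑ n ∈ Finset.range N, w n * hopErr c M n a ω') *
        ((M ω').fixErr i a + ∑ n ∈ Finset.range N, w n * hopErr c M n a ω') =
        (M ω').fixErr i a * (M ω').fixErr i a +
        (∑ n ∈ Finset.range N, (2 * w n) * ((M ω').fixErr i a * hopErr c M n a ω') +
        ∑ n ∈ Finset.range N, ∑ m ∈ Finset.range N,
          (w n * w m) * (hopErr c M n a ω' * hopErr c M m a ω')) := fun ω' => by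
      have h1 : ∑ n ∈ Finset.range N, (2 * w n) * ((M ω').fixErr i a * hopErr c M n a ω') =
          2 * (M ω').fixErr i a * ∑ n ∈ Finset.range N, w n * hopErr c M n a ω' := by
        rw [Finset.mul_sum]; exact Finset.sum_congr rfl fun n _ => by ring
      have h2 : ∑ n ∈ Finset.range N, ∑ m ∈ Finset.range N,
          (w n * w m) * (hopErr c M n a ω' * hopErr c M m a ω') =
          (∑ n ∈ Finset.range N, w n * hopErr c M n a ω') *
          ∑ n ∈ Finset.range N, w n * hopErr c M n a ω' := by
        rw [Finset.sum_mul_sum]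
        exact Finset.sum_congr rfl fun n _ => Finset.sum_congr rfl fun m _ => by ring
      rw [h1, h2]; ring
    simp_rw [e]
    have i2 : Integrable (fun ω' => ∑ n ∈ Finset.range N,
        (2 * w n) * ((M ω').fixErr i a * hopErr c M n a ω')) P' :=
      integrable_finsetSum _ fun n _ => (hFV n a).const_mul _
    have i3 : ∀ n, Integrable (fun ω' => ∑ m ∈ Finset.range N,
        (w n * w m) * (hopErr c M n a ω' * hopErr c M m a ω')) P' := fun n =>
      integrable_finsetSum _ fun m _ => (hVV n m a).const_mul _
    have i4 : Integrable (fun ω' => ∑ n ∈ Finset.range N, ∑ m ∈ Finset.range N,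
        (w n * w m) * (hopErr c M n a ω' * hopErr c M m a ω')) P' :=
      integrable_finsetSum _ fun n _ => i3 n
    rw [integral_add (hFF a) (i2.add i4 : Integrable (fun ω' => _ + _) P'), integral_add i2 i4,
      integral_finsetSum _ fun n _ => (hFV n a).const_mul _,
      integral_finsetSum _ fun n _ => i3 n, hM.fixErr_cov]
    congr 1
    rw [Finset.sum_eq_zero fun n _ => by
      rw [integral_const_mul, hM.integral_fixErr_mul_hopErr, mul_zero], zero_add]
    refine Finset.sum_congr rfl fun n hn => ?_
    rw [integral_finsetSum _ fun m _ => (hVV n m a).const_mul _, Finset.sum_eq_single_of_mem n hn,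
      integral_const_mul, sq]
    intro m _ hmn
    rw [integral_const_mul, hM.integral_hopErr_mul_hopErr c hmn.symm, mul_zero]
  simp_rw [key]
  rw [Finset.sum_add_distrib, Finset.sum_comm, Finset.mul_sum]
  congr 1
  refine Finset.sum_congr rfl fun n _ => ?_
  rw [← Finset.mul_sum, hM.sum_integral_hopErr_sq, mul_comm]

end IsRWPMotion

namespace Timing.IsRegular

variable {τ : Timing}

lemma timeInHop_add (hτ : τ.IsRegular) {u t : ℝ} (hut : u ≤ t) (n : ℕ) :
    τ.timeInHop 0 t n = τ.timeInHop 0 u n + τ.timeInHop u t n := by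
  have h1 := hτ.strictMono_hopInstant n.lt_succ_self
  have h0 := hτ.hopInstant_nonneg n
  simp only [Nat.succ_eq_add_one] at h1
  simp only [timeInHop, max_def, min_def]
  split_ifs <;> linarith

lemma position_eq (hτ : τ.IsRegular) (x₀ : Fin 2 → ℝ) (v : ℝ) (m : Motion) {t : ℝ} {N : ℕ}
    (ht : t ≤ τ.hopInstant N) :
    position x₀ v τ m t =
      x₀ + ∑ n ∈ Finset.range N, (v * τ.timeInHop 0 t n) • unitVec (m.heading n) := by
  rw [position, tsum_eq_sum fun n hn => ?_]
  rw [hτ.timeInHop_eq_zero_of_ge ht (by simpa using hn)]; simp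

/-- The trace of the mean squared error, for every regular realisation of the timing. -/
theorem peb_eq (hτ : τ.IsRegular) {Ω' : Type*} [MeasurableSpace Ω'] {P' : Measure Ω'}
    [IsProbabilityMeasure P'] {ε : ℝ} {Co : Matrix (Fin 2) (Fin 2) ℝ} {M : Ω' → Motion}
    (hM : IsRWPMotion P' ε Co M) (c : ℝ) (x₀ : Fin 2 → ℝ) (v : ℝ) {t : ℝ} (ht : 0 ≤ t) :
    peb P' c x₀ v τ M t = Co.trace + kappaExact c ε * τ.currentGrowth v t := by
  obtain ⟨N, hN⟩ := hτ.exists_lt_hopInstant t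
  have hut := hτ.updateInstant_latest_le ht
  have hu := hτ.updateInstant_nonneg (τ.latest t)
  set i := τ.latest t with hi
  set u := τ.updateInstant i with hu'
  have herr : ∀ ω' a, positionError c x₀ v τ (M ω') t a = (M ω').fixErr i a +
      ∑ n ∈ Finset.range N, (v * τ.timeInHop u t n) * IsRWPMotion.hopErr c M n a ω' := by
    intro ω' a
    have htsum : ∑' n, (v * τ.timeInHop u t n) • unitVec ((M ω').heading n + (M ω').headingErr n)
        = ∑ n ∈ Finset.range N, (v * τ.timeInHop u t n) •
          unitVec ((M ω').heading n + (M ω').headingErr n) := tsum_eq_sum fun n hn => by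
      rw [hτ.timeInHop_eq_zero_of_ge hN.le (by simpa using hn)]; simp
    have h2 : ∀ n, IsRWPMotion.hopErr c M n a ω' = unitVec ((M ω').heading n) a -
        c * unitVec ((M ω').heading n + (M ω').headingErr n) a := fun n =>
      (unitVec_sub_smul_unitVec _ _ _ _).symm
    simp only [positionError, positionEstimate, ← hi, ← hu']
    rw [htsum, hτ.position_eq x₀ v _ hN.le, hτ.position_eq x₀ v _ (hut.trans hN.le)]
    simp only [Pi.sub_apply, Pi.add_apply, Pi.smul_apply, Finset.sum_apply, smul_eq_mul, h2,
      hτ.timeInHop_add hut, Finset.mul_sum]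
    have h3 : ∑ n ∈ Finset.range N, v * (τ.timeInHop 0 u n + τ.timeInHop u t n) *
        unitVec ((M ω').heading n) a =
        ∑ n ∈ Finset.range N, v * τ.timeInHop 0 u n * unitVec ((M ω').heading n) a +
        ∑ n ∈ Finset.range N, v * τ.timeInHop u t n * unitVec ((M ω').heading n) a := by
      rw [← Finset.sum_add_distrib]; exact Finset.sum_congr rfl fun n _ => by ring
    have h4 : ∑ n ∈ Finset.range N, v * τ.timeInHop u t n * (unitVec ((M ω').heading n) a -
        c * unitVec ((M ω').heading n + (M ω').headingErr n) a) =
        ∑ n ∈ Finset.range N, v * τ.timeInHop u t n * unitVec ((M ω').heading n) a -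
        ∑ n ∈ Finset.range N, c * (v * τ.timeInHop u t n *
          unitVec ((M ω').heading n + (M ω').headingErr n) a) := by
      rw [← Finset.sum_sub_distrib]; exact Finset.sum_congr rfl fun n _ => by ring
    rw [h3, h4]; ring
  have h := hM.sum_integral_sq c i N fun n => v * τ.timeInHop u t n
  rw [currentGrowth, ← hi, ← hu', hτ.growth_eq_sum v hN.le]
  simp only [mul_pow] at h
  rw [← h, peb, mse, Matrix.trace]
  simp only [Matrix.diag_apply, Matrix.of_apply, herr]

end Timing.IsRegular

/-! ### The exponential distribution -/

section Exponential

lemma expMeasure_eq (r : ℝ) : expMeasure r =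
    (volume.restrict (Set.Ioi 0)).withDensity
      fun x => ENNReal.ofReal (r * Real.exp (-(r * x))) := by
  rw [← withDensity_indicator measurableSet_Ioi, expMeasure, gammaMeasure]
  refine withDensity_congr_ae ?_
  filter_upwards [Measure.ae_ne volume (0 : ℝ)] with x hx
  have := exponentialPDF_eq r x
  rw [exponentialPDF, exponentialPDFReal] at this
  rw [gammaPDF, this, Set.indicator_apply]
  rcases lt_or_gt_of_ne hx with h | h
  · simp [not_le.2 h, not_lt.2 h.le]
  · simp [h, h.le]

variable {E : Type*} [NormedAddCommGroup E] [NormedSpace ℝ E] {r : ℝ}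

lemma integral_expMeasure (hr : 0 < r) (f : ℝ → E) :
    ∫ x, f x ∂(expMeasure r) = ∫ x in Set.Ioi 0, (r * Real.exp (-(r * x))) • f x := by
  rw [expMeasure_eq, integral_withDensity_eq_integral_toReal_smul (by fun_prop) (by simp)]
  refine integral_congr_ae (Eventually.of_forall fun x => ?_)
  simp only
  rw [ENNReal.toReal_ofReal (by positivity)]

lemma integrable_expMeasure_iff (hr : 0 < r) (f : ℝ → E) :
    Integrable f (expMeasure r) ↔
      IntegrableOn (fun x => (r * Real.exp (-(r * x))) • f x) (Set.Ioi 0) := by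
  rw [expMeasure_eq, integrable_withDensity_iff_integrable_smul' (by fun_prop) (by simp)]
  refine integrable_congr (Eventually.of_forall fun x => ?_)
  simp only
  rw [ENNReal.toReal_ofReal (by positivity)]

lemma ae_pos_expMeasure : ∀ᵐ x ∂(expMeasure r), 0 < x := by
  rw [expMeasure_eq]
  exact (withDensity_absolutelyContinuous _ _).ae_le (ae_restrict_mem measurableSet_Ioi)

lemma integrable_pow_mul_exp_expMeasure (hr : 0 < r) (n : ℕ) {s : ℝ} (hs : 0 < r + s) :
    Integrable (fun x => x ^ n * Real.exp (-(s * x))) (expMeasure r) := by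
  rw [integrable_expMeasure_iff hr]
  have h := integrableOn_rpow_mul_exp_neg_mul_rpow (p := 1) (s := n) (b := r + s)
    (by have : (0 : ℝ) ≤ n := n.cast_nonneg
        linarith) one_pos hs
  refine IntegrableOn.congr_fun (h.const_mul r) (fun x _ => ?_) measurableSet_Ioi
  simp only [smul_eq_mul, Real.rpow_natCast, Real.rpow_one]
  rw [show -(r + s) * x = -(r * x) + -(s * x) by ring, Real.exp_add]
  ring

lemma integral_pow_mul_exp_expMeasure (hr : 0 < r) (n : ℕ) {s : ℝ} (hs : 0 < r + s) :
    ∫ x, x ^ n * Real.exp (-(s * x)) ∂(expMeasure r) =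
      r * n.factorial / (r + s) ^ (n + 1) := by
  rw [integral_expMeasure hr]
  have h := Real.integral_rpow_mul_exp_neg_mul_Ioi (a := n + 1) (by positivity) hs
  have h2 : ∫ x in Set.Ioi (0 : ℝ), (r * Real.exp (-(r * x))) • (x ^ n * Real.exp (-(s * x))) =
      ∫ x in Set.Ioi (0 : ℝ), r * (x ^ ((n : ℝ) + 1 - 1) * Real.exp (-((r + s) * x))) := by
    refine setIntegral_congr_fun measurableSet_Ioi fun x _ => ?_
    simp only [smul_eq_mul, add_sub_cancel_right, Real.rpow_natCast]
    rw [show -((r + s) * x) = -(r * x) + -(s * x) by ring, Real.exp_add]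
    ring
  rw [h2, integral_const_mul, h, Real.Gamma_nat_eq_factorial]
  have : (1 / (r + s)) ^ ((n : ℝ) + 1) = 1 / (r + s) ^ (n + 1) := by
    rw [← Nat.cast_add_one, Real.rpow_natCast, one_div_pow]
  rw [this]
  field_simp

lemma integrable_pow_expMeasure (hr : 0 < r) (n : ℕ) :
    Integrable (fun x => x ^ n) (expMeasure r) := by
  simpa using integrable_pow_mul_exp_expMeasure hr n (s := 0) (by simpa)

lemma integral_pow_expMeasure (hr : 0 < r) (n : ℕ) :
    ∫ x, x ^ n ∂(expMeasure r) = n.factorial / r ^ n := by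
  have := integral_pow_mul_exp_expMeasure hr n (s := 0) (by simpa)
  simp only [zero_mul, neg_zero, Real.exp_zero, mul_one, add_zero] at this
  rw [this, pow_succ]
  field_simp

lemma integrable_exp_expMeasure (hr : 0 < r) {s : ℝ} (hs : 0 < r + s) :
    Integrable (fun x => Real.exp (-(s * x))) (expMeasure r) := by
  simpa using integrable_pow_mul_exp_expMeasure hr 0 hs

lemma integral_exp_expMeasure (hr : 0 < r) {s : ℝ} (hs : 0 < r + s) :
    ∫ x, Real.exp (-(s * x)) ∂(expMeasure r) = r / (r + s) := by
  simpa using integral_pow_mul_exp_expMeasure hr 0 hs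

lemma charFun_expMeasure (hr : 0 < r) (t : ℝ) :
    charFun (expMeasure r) t = r / (r - t * Complex.I) := by
  rw [charFun_apply_real, integral_expMeasure hr]
  have h2 : ∫ x in Set.Ioi (0 : ℝ), (r * Real.exp (-(r * x))) • Complex.exp (t * x * Complex.I) =
      ∫ x in Set.Ioi (0 : ℝ), (r : ℂ) * Complex.exp ((-(r : ℂ) + t * Complex.I) * x) := by
    refine setIntegral_congr_fun measurableSet_Ioi fun x _ => ?_
    simp only [Complex.real_smul]
    push_cast
    rw [mul_assoc, ← Complex.exp_add]
    congr 2; ring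
  rw [h2, integral_const_mul, integral_exp_mul_complex_Ioi (by simpa) 0]
  have h3 : (-(r : ℂ) + t * Complex.I) ≠ 0 := fun h => by
    have := congrArg Complex.re h
    simp at this
    exact hr.ne' this
  have h4 : ((r : ℂ) - t * Complex.I) ≠ 0 := fun h => h3 (by rw [← neg_eq_zero, ← h]; ring)
  simp only [Complex.ofReal_zero, mul_zero, Complex.exp_zero]
  field_simp
  ring

/-- The memoryless property, integrated: the mean excess over `x` is the mean times the probability
of exceeding `x`. -/
lemma integral_posPart_sub_expMeasure (hr : 0 < r) {x : ℝ} (hx : 0 ≤ x) :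
    ∫ t, max (t - x) 0 ∂(expMeasure r) = Real.exp (-(r * x)) / r := by
  have h1 := integral_pow_expMeasure hr 1
  simp only [pow_one, Nat.factorial_one, Nat.cast_one] at h1
  rw [integral_expMeasure hr] at h1 ⊢
  rw [← integral_indicator measurableSet_Ioi] at h1 ⊢
  rw [← integral_sub_right_eq_self _ x] at h1
  rw [div_eq_mul_one_div, ← h1, ← integral_const_mul]
  refine integral_congr_ae (Eventually.of_forall fun t => ?_)
  simp only [Set.indicator_apply, Set.mem_Ioi, smul_eq_mul]
  by_cases ht : x < t
  · rw [if_pos (hx.trans_lt ht), if_pos (sub_pos.2 ht), max_eq_left (sub_nonneg.2 ht.le),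
      show -(r * t) = -(r * x) + -(r * (t - x)) by ring, Real.exp_add]
    ring
  · rw [if_neg (fun h => ht (sub_pos.1 h)), max_eq_right (sub_nonpos.2 (not_lt.1 ht))]
    simp

/-- The conditional characteristic function of the waiting time `max (t - X) 0` behind a system
time `t`, for an exponential interarrival time `X`. -/
lemma integral_cexp_posPart_expMeasure (hr : 0 < r) {t : ℝ} (ht : 0 ≤ t) (s : ℝ) :
    ∫ x, Complex.exp (s * (max (t - x) 0 : ℝ) * Complex.I) ∂(expMeasure r) =
      (r * Complex.exp (s * t * Complex.I) + s * Complex.I * Real.exp (-(r * t))) /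
        (r + s * Complex.I) := by
  have hne : ((r : ℂ) + s * Complex.I) ≠ 0 := fun h => by
    have := congrArg Complex.re h
    simp at this
    exact hr.ne' this
  have hne' : (-(r : ℂ) - s * Complex.I) ≠ 0 := fun h => hne (by rw [← neg_eq_zero, ← h]; ring)
  have hr' : (r : ℂ) ≠ 0 := by exact_mod_cast hr.ne'
  rw [integral_expMeasure hr]
  have e1 : Set.EqOn (fun x : ℝ => (r * Real.exp (-(r * x))) •
      Complex.exp (s * (max (t - x) 0 : ℝ) * Complex.I))
      (fun x => (r * Complex.exp (s * t * Complex.I)) *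
        Complex.exp ((-(r : ℂ) - s * Complex.I) * x)) (Set.Ioc 0 t) := fun x hx => by
    simp only [Complex.real_smul]
    rw [max_eq_left (sub_nonneg.2 hx.2)]
    push_cast
    rw [mul_assoc, mul_assoc (r : ℂ), ← Complex.exp_add, ← Complex.exp_add]
    congr 2; ring
  have e2 : Set.EqOn (fun x : ℝ => (r * Real.exp (-(r * x))) •
      Complex.exp (s * (max (t - x) 0 : ℝ) * Complex.I))
      (fun x => (r : ℂ) * Complex.exp (-(r : ℂ) * x)) (Set.Ioi t) := fun x hx => by
    simp only [Complex.real_smul]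
    rw [max_eq_right (sub_nonpos.2 (le_of_lt hx))]
    push_cast
    simp
  have i1 : IntegrableOn (fun x : ℝ => (r * Complex.exp (s * t * Complex.I)) *
      Complex.exp ((-(r : ℂ) - s * Complex.I) * x)) (Set.Ioc 0 t) :=
    (Continuous.integrableOn_Icc (by fun_prop)).mono_set Set.Ioc_subset_Icc_self
  have i2 : IntegrableOn (fun x : ℝ => (r : ℂ) * Complex.exp (-(r : ℂ) * x)) (Set.Ioi t) :=
    (integrableOn_exp_mul_complex_Ioi (a := -(r : ℂ)) (by simpa) t).const_mul _
  rw [← Set.Ioc_union_Ioi_eq_Ioi ht, setIntegral_union (Set.Ioc_disjoint_Ioi le_rfl)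
    measurableSet_Ioi (i1.congr_fun e1.symm measurableSet_Ioc)
    (i2.congr_fun e2.symm measurableSet_Ioi),
    setIntegral_congr_fun measurableSet_Ioc e1, setIntegral_congr_fun measurableSet_Ioi e2,
    ← intervalIntegral.integral_of_le ht, intervalIntegral.integral_const_mul,
    integral_exp_mul_complex hne', integral_const_mul,
    integral_exp_mul_complex_Ioi (by simpa) t]
  have e3 : Complex.exp (s * t * Complex.I) * Complex.exp ((-(r : ℂ) - s * Complex.I) * t) =
      Complex.exp (-(r * t)) := by
    rw [← Complex.exp_add]; congr 1; ring
  push_cast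
  simp only [mul_zero, Complex.exp_zero]
  rw [show -(r : ℂ) * t = -(r * t) by ring, ← e3]
  field_simp
  ring

end Exponential

/-! ### Sequences of independent identically distributed variables -/

/-- The sequence `f` with its first `n` terms removed. -/
def dropSeq {α : Type*} (n : ℕ) (f : ℕ → α) : ℕ → α := fun k => f (n + k)

lemma measurable_dropSeq {α : Type*} [MeasurableSpace α] (n : ℕ) :
    Measurable (dropSeq n : (ℕ → α) → ℕ → α) :=
  measurable_pi_lambda _ fun k => measurable_pi_apply (n + k)

section IID

variable {α : Type*} [MeasurableSpace α] (m : Measure α) [IsProbabilityMeasure m]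

/-- The law of a sequence of independent variables with law `m`. -/
abbrev iidLaw : Measure (ℕ → α) := Measure.infinitePi fun _ : ℕ => m

lemma map_dropSeq_iidLaw (n : ℕ) : (iidLaw m).map (dropSeq n) = iidLaw m :=
  Measure.map_infinitePi_infinitePi_of_inj (P := fun _ : ℕ => m) (add_right_injective n)

/-- Events about the first `n` terms are independent of events about the later ones. -/
lemma iidLaw_inter_preimage_dropSeq [Inhabited α] (n : ℕ) {A C : Set (ℕ → α)}
    (hA : MeasurableSet A) (hdep : ∀ x y : ℕ → α, (∀ k < n, x k = y k) → (x ∈ A ↔ y ∈ A))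
    (hC : MeasurableSet C) :
    iidLaw m (A ∩ dropSeq n ⁻¹' C) = iidLaw m A * iidLaw m C := by
  have hi : iIndepFun (fun (i : ℕ) (x : ℕ → α) => x i) (iidLaw m) :=
    iIndepFun_infinitePi (X := fun _ x => x) fun _ => measurable_id
  have hind := indep_iSup_of_disjoint
    (fun i => (measurable_pi_apply (X := fun _ : ℕ => α) i).comap_le) hi.iIndep
    (S := {i | i < n}) (T := {i | n ≤ i})
    (Set.disjoint_left.2 fun i (h1 : i < n) (h2 : n ≤ i) => by omega)
  have hcoord : ∀ (S : Set ℕ) (k : ℕ), k ∈ S →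
      Measurable[⨆ i ∈ S, MeasurableSpace.comap (fun x : ℕ → α => x i) inferInstance]
        (fun x : ℕ → α => x k) := fun S k hk =>
    Measurable.mono (comap_measurable _) (le_iSup₂_of_le k hk le_rfl) le_rfl
  have h1 : MeasurableSet[⨆ i ∈ {i | i < n},
      MeasurableSpace.comap (fun x : ℕ → α => x i) inferInstance] A := by
    have : A = (fun (x : ℕ → α) k => if k < n then x k else default) ⁻¹' A := by
      ext x
      exact hdep _ _ fun k hk => by simp [hk]
    rw [this]
    refine (@measurable_pi_lambda _ _ _ (_) _ _ fun k => ?_) hA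
    by_cases hk : k < n
    · simp only [hk, if_true]
      exact hcoord _ k hk
    · simp only [hk, if_false]
      exact @measurable_const _ _ _ (_) _
  have h2 : MeasurableSet[⨆ i ∈ {i | n ≤ i},
      MeasurableSpace.comap (fun x : ℕ → α => x i) inferInstance] (dropSeq n ⁻¹' C) :=
    (@measurable_pi_lambda _ _ _ (_) _ _ fun k => hcoord _ (n + k) (Nat.le_add_right n k)) hC
  rw [(Indep_iff _ _ _).1 hind _ _ h1 h2, ← Measure.map_apply (measurable_dropSeq n) hC,
    map_dropSeq_iidLaw]

lemma map_head_tail_iidLaw [Inhabited α] :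
    (iidLaw m).map (fun x => (x 0, dropSeq 1 x)) = m.prod (iidLaw m) := by
  refine (Measure.prod_eq fun s t hs ht => ?_).symm
  rw [Measure.map_apply ((measurable_pi_apply 0).prodMk (measurable_dropSeq 1)) (hs.prod ht)]
  have h := iidLaw_inter_preimage_dropSeq m 1 (A := (fun x => x 0) ⁻¹' s)
    (measurable_pi_apply 0 hs)
    (fun x y hxy => by simp [hxy 0 one_pos]) ht
  rw [← Measure.map_apply (measurable_pi_apply 0) hs, Measure.infinitePi_map_eval] at h
  exact h

end IID

lemma measurePreserving_prodProdProdComm {α β γ δ : Type*} [MeasurableSpace α] [MeasurableSpace β]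
    [MeasurableSpace γ] [MeasurableSpace δ] (a : Measure α) (b : Measure β) (c : Measure γ)
    (d : Measure δ) [SigmaFinite a] [SigmaFinite b] [SigmaFinite c] [SigmaFinite d] :
    MeasurePreserving (fun x : (α × β) × (γ × δ) => ((x.1.1, x.2.1), (x.1.2, x.2.2)))
      ((a.prod b).prod (c.prod d)) ((a.prod c).prod (b.prod d)) := by
  have e1 := measurePreserving_prodAssoc a b (c.prod d)
  have e2 := (MeasurePreserving.id a).prod (measurePreserving_prodAssoc b c d).symm
  have e3 := (MeasurePreserving.id a).prod
    ((Measure.measurePreserving_swap (μ := b) (ν := c)).prod (MeasurePreserving.id d))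
  have e4 := (MeasurePreserving.id a).prod (measurePreserving_prodAssoc c b d)
  have e5 := (measurePreserving_prodAssoc a c (b.prod d)).symm
  exact e5.comp (e4.comp (e3.comp (e2.comp e1)))

/-! ### The hops between two polled updates -/

/-- The law of the indicator of an update being polled. -/
def pollLaw (p : ℝ) : Measure Bool :=
  ENNReal.ofReal p • Measure.dirac true + ENNReal.ofReal (1 - p) • Measure.dirac false

lemma isProbabilityMeasure_pollLaw {p : ℝ} (hp : 0 < p) (hp1 : p ≤ 1) :
    IsProbabilityMeasure (pollLaw p) := ⟨by
  simp only [pollLaw, Measure.add_apply, Measure.smul_apply, measure_univ, smul_eq_mul, mul_one]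
  rw [← ENNReal.ofReal_add hp.le (by linarith)]
  simp⟩

/-- The number of hops until the next polled update, when `b k` tells whether the update at the end of
the `k`-th hop is polled. It is `1` if no update is polled at all, an event of probability zero. -/
def blockLen (b : ℕ → Bool) : ℕ := sInf {k | b k = true} + 1

/-- Duration, sum of squares, and normalised area `∑ⱼ (Yⱼ³ / 3 + Yⱼ ∑_{l < j} Yₗ²)` of the first `n`
hops. -/
def hopStats (n : ℕ) (h : ℕ → ℝ) : ℝ × ℝ × ℝ :=
  (∑ j ∈ Finset.range n, h j, ∑ j ∈ Finset.range n, h j ^ 2,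
    ∑ j ∈ Finset.range n, (h j ^ 3 / 3 + h j * ∑ l ∈ Finset.range j, h l ^ 2))

/-- The statistics of the hops up to the next polled update. -/
def blockStats (x : (ℕ → ℝ) × (ℕ → Bool)) : ℝ × ℝ × ℝ := hopStats (blockLen x.2) x.1

/-- The hops and polls that remain after the next polled update. -/
def nextBlock (x : (ℕ → ℝ) × (ℕ → Bool)) : (ℕ → ℝ) × (ℕ → Bool) :=
  (dropSeq (blockLen x.2) x.1, dropSeq (blockLen x.2) x.2)

/-- The polling patterns for which the next polled update ends hop `l`. -/
def firstPolled (l : ℕ) : Set (ℕ → Bool) := {b | b l = true ∧ ∀ k < l, b k = false}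

lemma measurable_hopStats (n : ℕ) : Measurable (hopStats n) := by
  unfold hopStats; fun_prop

lemma measurableSet_firstPolled (l : ℕ) : MeasurableSet (firstPolled l) := by
  have h : ∀ (k : ℕ) (c : Bool), MeasurableSet {b : ℕ → Bool | b k = c} := fun k c =>
    measurableSet_eq_fun (measurable_pi_apply k) measurable_const
  have : firstPolled l = {b | b l = true} ∩ ⋂ k ∈ Finset.range l, {b : ℕ → Bool | b k = false} := by
    ext b; simp [firstPolled]
  rw [this]
  exact (h l true).inter (Finset.measurableSet_biInter _ fun k _ => h k false)

lemma blockLen_of_mem_firstPolled {l : ℕ} {b : ℕ → Bool} (hb : b ∈ firstPolled l) :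
    blockLen b = l + 1 := by
  have : IsLeast {k | b k = true} l := ⟨hb.1, fun k hk => by
    by_contra h
    have := hb.2 k (not_le.1 h)
    simp_all⟩
  rw [blockLen, this.csInf_eq]

lemma mem_firstPolled_blockLen {b : ℕ → Bool} (hb : ∃ k, b k = true) :
    b ∈ firstPolled (blockLen b - 1) := by
  have h : sInf {k | b k = true} ∈ {k | b k = true} := Nat.sInf_mem hb
  refine ⟨h, fun k hk => ?_⟩
  simpa using Nat.notMem_of_lt_sInf hk

lemma measurable_blockLen : Measurable blockLen := by
  refine (measurable_from_top (f := fun n : ℕ => n + 1)).comp (g := _) ?_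
  refine measurable_to_countable' fun n => ?_
  rcases Nat.eq_zero_or_pos n with rfl | hn
  · have : (fun b : ℕ → Bool => sInf {k | b k = true}) ⁻¹' {0} =
        {b | b 0 = true} ∪ ⋂ k, {b : ℕ → Bool | b k = false} := by
      ext b
      simp [Nat.sInf_eq_zero, Set.eq_empty_iff_forall_notMem]
    rw [this]
    exact (measurable_pi_apply 0 (measurableSet_singleton true)).union
      (MeasurableSet.iInter fun k => measurable_pi_apply k (measurableSet_singleton false))
  · have : (fun b : ℕ → Bool => sInf {k | b k = true}) ⁻¹' {n} = firstPolled n := by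
      ext b
      simp only [Set.mem_preimage, Set.mem_singleton_iff]
      constructor
      · intro h
        have hex : ∃ k, b k = true := by
          by_contra hne
          have : {k | b k = true} = ∅ := Set.eq_empty_iff_forall_notMem.2 fun k hk => hne ⟨k, hk⟩
          rw [this] at h; simp at h; omega
        have := mem_firstPolled_blockLen hex
        rwa [blockLen, h] at this
      · intro h
        have := blockLen_of_mem_firstPolled h
        rw [blockLen] at this; omega
    rw [this]
    exact measurableSet_firstPolled n

lemma measurable_blockStats : Measurable blockStats := by
  have h : Measurable fun y : ℕ × (ℕ → ℝ) => hopStats y.1 y.2 :=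
    measurable_from_prod_countable_right fun n => measurable_hopStats n
  exact h.comp ((measurable_blockLen.comp measurable_snd).prodMk measurable_fst)

lemma measurable_nextBlock : Measurable nextBlock := by
  have h : ∀ {α : Type} [MeasurableSpace α],
      Measurable fun y : ℕ × (ℕ → α) => dropSeq y.1 y.2 := fun {α} _ =>
    measurable_from_prod_countable_right fun n => measurable_dropSeq n
  exact (h.comp ((measurable_blockLen.comp measurable_snd).prodMk measurable_fst)).prodMk
    (h.comp ((measurable_blockLen.comp measurable_snd).prodMk measurable_snd))

section Block

variable {p lam : ℝ}

/-- Almost surely some update is polled. -/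
lemma ae_exists_polled (hp : 0 < p) (hp1 : p ≤ 1) :
    ∀ᵐ b ∂(iidLaw (pollLaw p)), ∃ k, b k = true := by
  have := isProbabilityMeasure_pollLaw hp hp1
  have hm : ∀ (k : ℕ) (c : Bool), MeasurableSet {b : ℕ → Bool | b k = c} := fun k c =>
    measurableSet_eq_fun (measurable_pi_apply k) measurable_const
  have hC : MeasurableSet {b : ℕ → Bool | ∀ k, b k = false} := by
    have : {b : ℕ → Bool | ∀ k, b k = false} = ⋂ k, {b | b k = false} := by ext b; simp
    rw [this]
    exact MeasurableSet.iInter fun k => hm k false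
  -- the probability of no polled update is unchanged by the first trial, hence a fixed point
  have h := iidLaw_inter_preimage_dropSeq (pollLaw p) 1 (hm 0 false)
    (fun x y hxy => by simp [hxy 0 one_pos]) hC
  have h1 : {b : ℕ → Bool | b 0 = false} ∩ dropSeq 1 ⁻¹' {b | ∀ k, b k = false} =
      {b | ∀ k, b k = false} := by
    ext b
    refine ⟨fun hb k => ?_, fun hb => ⟨hb 0, fun k => hb _⟩⟩
    cases k with
    | zero => exact hb.1
    | succ k => have := hb.2 k; rwa [dropSeq, add_comm] at this
  have h2 : iidLaw (pollLaw p) {b : ℕ → Bool | b 0 = false} = ENNReal.ofReal (1 - p) := by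
    have := Measure.infinitePi_map_eval (fun _ : ℕ => pollLaw p) 0
    have e := Measure.map_apply (μ := iidLaw (pollLaw p)) (measurable_pi_apply 0)
      (measurableSet_singleton false)
    rw [this] at e
    exact e.symm.trans (by simp [pollLaw])
  rw [h1, h2] at h
  rw [ae_iff]
  simp only [not_exists, Bool.not_eq_true]
  by_contra hne
  have h3 : ENNReal.ofReal (1 - p) = 1 := by
    have := (ENNReal.mul_left_inj hne (measure_ne_top _ _)).1 ((one_mul _).trans h)
    exact this.symm
  rw [ENNReal.ofReal_eq_one] at h3
  linarith

variable (lam p) in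
/-- The joint law of the hop durations and of the polling indicators. -/
abbrev hopPollLaw : Measure ((ℕ → ℝ) × (ℕ → Bool)) :=
  (Measure.infinitePi fun _ : ℕ => expMeasure lam).prod (Measure.infinitePi fun _ : ℕ => pollLaw p)

lemma ae_exists_polled_hopPollLaw (hp : 0 < p) (hp1 : p ≤ 1) :
    ∀ᵐ x ∂(hopPollLaw p lam), ∃ k, x.2 k = true :=
  Measure.quasiMeasurePreserving_snd.ae (ae_exists_polled hp hp1)

variable [IsProbabilityMeasure (expMeasure lam)] [IsProbabilityMeasure (pollLaw p)]

/-- The strong Markov property at the next polled update: the hops up to this update are independent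
of all that follows it, and what follows has the original law. -/
theorem map_blockStats_nextBlock (hp : 0 < p) (hp1 : p ≤ 1) :
    (hopPollLaw p lam).map (fun x => (blockStats x, nextBlock x)) =
      ((hopPollLaw p lam).map blockStats).prod (hopPollLaw p lam) := by
  have hmeas : Measurable fun x => (blockStats x, nextBlock x) :=
    measurable_blockStats.prodMk measurable_nextBlock
  have : IsProbabilityMeasure ((hopPollLaw p lam).map blockStats) :=
    Measure.isProbabilityMeasure_map measurable_blockStats.aemeasurable
  -- decomposition according to the number of hops before the next polled update
  have key : ∀ (s : Set (ℝ × ℝ × ℝ)) (t : Set (ℕ → ℝ)) (u : Set (ℕ → Bool)), MeasurableSet s →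
      MeasurableSet t → MeasurableSet u →
      hopPollLaw p lam ((fun x => (blockStats x, nextBlock x)) ⁻¹' (s ×ˢ t ×ˢ u)) =
      (∑' l, iidLaw (expMeasure lam) (hopStats (l + 1) ⁻¹' s) *
        iidLaw (pollLaw p) (firstPolled l)) *
        (iidLaw (expMeasure lam) t * iidLaw (pollLaw p) u) := by
    intro s t u hs ht hu
    have hF : ∀ l, MeasurableSet ((fun x : (ℕ → ℝ) × (ℕ → Bool) => x.2) ⁻¹' firstPolled l) :=
      fun l => measurable_snd (measurableSet_firstPolled l)
    have hS := hmeas (hs.prod (ht.prod hu))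
    set S := (fun x => (blockStats x, nextBlock x)) ⁻¹' (s ×ˢ t ×ˢ u) with hSdef
    have h1 : hopPollLaw p lam S =
        hopPollLaw p lam (⋃ l, S ∩ (fun x : (ℕ → ℝ) × (ℕ → Bool) => x.2) ⁻¹' firstPolled l) := by
      refine measure_congr ?_
      filter_upwards [ae_exists_polled_hopPollLaw (lam := lam) hp hp1] with x hx
      refine propext ⟨fun h => Set.mem_iUnion.2 ⟨_, h, mem_firstPolled_blockLen hx⟩, fun h => ?_⟩
      obtain ⟨l, hl⟩ := Set.mem_iUnion.1 h
      exact hl.1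
    rw [h1, measure_iUnion _ fun l => hS.inter (hF l), ← ENNReal.tsum_mul_right]
    · refine tsum_congr fun l => ?_
      have h2 : S ∩ (fun x : (ℕ → ℝ) × (ℕ → Bool) => x.2) ⁻¹' firstPolled l =
          (hopStats (l + 1) ⁻¹' s ∩ dropSeq (l + 1) ⁻¹' t) ×ˢ
            (firstPolled l ∩ dropSeq (l + 1) ⁻¹' u) := by
        ext x
        simp only [hSdef, Set.mem_inter_iff, Set.mem_preimage, Set.mem_prod, blockStats, nextBlock]
        constructor
        · rintro ⟨⟨h1, h2, h3⟩, h4⟩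
          rw [blockLen_of_mem_firstPolled h4] at h1 h2 h3
          exact ⟨⟨h1, h2⟩, h4, h3⟩
        · rintro ⟨⟨h1, h2⟩, h4, h3⟩
          rw [blockLen_of_mem_firstPolled h4]
          exact ⟨⟨h1, h2, h3⟩, h4⟩
      rw [h2, Measure.prod_prod, iidLaw_inter_preimage_dropSeq _ _ (measurable_hopStats _ hs) _ ht,
        iidLaw_inter_preimage_dropSeq _ _ (measurableSet_firstPolled l) _ hu]
      · ring
      · intro x y hxy
        simp only [firstPolled, Set.mem_ofPred_eq]
        rw [hxy l l.lt_succ_self]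
        refine and_congr_right fun _ => forall₂_congr fun k hk => ?_
        rw [hxy k (by omega)]
      · intro x y hxy
        have : hopStats (l + 1) x = hopStats (l + 1) y := by
          have hs : ∀ f : ℝ → ℝ, ∀ n ≤ l + 1,
              ∑ j ∈ Finset.range n, f (x j) = ∑ j ∈ Finset.range n, f (y j) := fun f n hn =>
            Finset.sum_congr rfl fun j hj => by
              rw [hxy j (by have := Finset.mem_range.1 hj; omega)]
          unfold hopStats
          rw [hs (fun z => z) _ le_rfl, hs (fun z => z ^ 2) _ le_rfl]
          refine congrArg _ (congrArg _ (Finset.sum_congr rfl fun j hj => ?_))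
          have hj' := Finset.mem_range.1 hj
          rw [hxy j hj', hs (fun z => z ^ 2) j hj'.le]
        rw [Set.mem_preimage, Set.mem_preimage, this]
    · intro i j hij
      refine Set.disjoint_left.2 fun x hx hy => hij ?_
      have h1 := blockLen_of_mem_firstPolled hx.2
      have h2 := blockLen_of_mem_firstPolled hy.2
      omega
  refine Measure.ext_prod₃ fun {s t u} hs ht hu => ?_
  have hK : (hopPollLaw p lam).map blockStats s =
      ∑' l, iidLaw (expMeasure lam) (hopStats (l + 1) ⁻¹' s) *
        iidLaw (pollLaw p) (firstPolled l) := by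
    have := key s Set.univ Set.univ hs MeasurableSet.univ MeasurableSet.univ
    rw [measure_univ, measure_univ, mul_one, mul_one] at this
    rw [← this, Measure.map_apply measurable_blockStats hs]
    congr 1
    ext x; simp
  rw [Measure.map_apply hmeas (hs.prod (ht.prod hu)), key s t u hs ht hu, Measure.prod_prod, hK,
    Measure.prod_prod]

end Block

/-- Statistics of a block from those of its first hop and those of the remaining hops. -/
def extendStats (y : ℝ) (z : ℝ × ℝ × ℝ) : ℝ × ℝ × ℝ :=
  (y + z.1, y ^ 2 + z.2.1, y ^ 3 / 3 + y ^ 2 * z.1 + z.2.2)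

lemma measurable_extendStats : Measurable fun q : ℝ × ℝ × ℝ × ℝ => extendStats q.1 q.2 := by
  unfold extendStats; fun_prop

lemma hopStats_succ (n : ℕ) (h : ℕ → ℝ) :
    hopStats (n + 1) h = extendStats (h 0) (hopStats n (dropSeq 1 h)) := by
  have hd : ∀ k, dropSeq 1 h k = h (k + 1) := fun k => by rw [dropSeq, add_comm]
  simp only [hopStats, extendStats, Finset.sum_range_succ', hd, Prod.mk.injEq]
  refine ⟨add_comm _ _, add_comm _ _, ?_⟩
  simp only [Finset.range_zero, Finset.sum_empty, mul_zero, add_zero, mul_add,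
    Finset.sum_add_distrib, ← Finset.sum_mul]
  ring

lemma blockLen_of_head {b : ℕ → Bool} (h : b 0 = true) : blockLen b = 1 :=
  blockLen_of_mem_firstPolled (l := 0) ⟨h, fun k hk => absurd hk (Nat.not_lt_zero k)⟩

lemma blockLen_of_not_head {b : ℕ → Bool} (h : b 0 = false) (hex : ∃ k, b k = true) :
    blockLen b = blockLen (dropSeq 1 b) + 1 := by
  have hex' : ∃ k, dropSeq 1 b k = true := by
    obtain ⟨k, hk⟩ := hex
    cases k with
    | zero => simp_all
    | succ k => exact ⟨k, by rw [dropSeq, add_comm]; exact hk⟩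
  have hm := mem_firstPolled_blockLen hex'
  set l := blockLen (dropSeq 1 b) - 1
  rw [blockLen_of_mem_firstPolled hm]
  refine blockLen_of_mem_firstPolled (l := l + 1) ⟨by have := hm.1; rwa [dropSeq, add_comm] at this,
    fun k hk => ?_⟩
  cases k with
  | zero => exact h
  | succ k => have := hm.2 k (by omega); rwa [dropSeq, add_comm] at this

lemma blockStats_eq {x : (ℕ → ℝ) × (ℕ → Bool)} (hex : ∃ k, x.2 k = true) :
    blockStats x = extendStats (x.1 0)
      (if x.2 0 = true then 0 else blockStats (dropSeq 1 x.1, dropSeq 1 x.2)) := by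
  by_cases h : x.2 0 = true
  · rw [blockStats, blockLen_of_head h, hopStats_succ, if_pos h]
    simp [hopStats]; rfl
  · rw [blockStats, blockLen_of_not_head (by simpa using h) hex, hopStats_succ, if_neg h]
    rfl

section BlockLaw

variable {p lam : ℝ}

variable (p lam) in
/-- The joint law of the duration, the sum of squares and the normalised area of the hops between
two successive polled updates. -/
def blockLaw : Measure (ℝ × ℝ × ℝ) := (hopPollLaw p lam).map blockStats

lemma isProbabilityMeasure_blockLaw [IsProbabilityMeasure (expMeasure lam)]
    [IsProbabilityMeasure (pollLaw p)] : IsProbabilityMeasure (blockLaw p lam) :=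
  Measure.isProbabilityMeasure_map measurable_blockStats.aemeasurable

/-- The first-step decomposition: the first hop ends the block with probability `p`, and otherwise
it is followed by a block with the same law. -/
theorem blockLaw_eq (hlam : 0 < lam) (hp : 0 < p) (hp1 : p ≤ 1) :
    blockLaw p lam = ENNReal.ofReal p • (expMeasure lam).map (fun y => extendStats y 0) +
      ENNReal.ofReal (1 - p) •
        ((expMeasure lam).prod (blockLaw p lam)).map (fun q => extendStats q.1 q.2) := by
  have := isProbabilityMeasure_expMeasure hlam
  have := isProbabilityMeasure_pollLaw hp hp1
  have := isProbabilityMeasure_blockLaw (p := p) (lam := lam)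
  have hstep : (hopPollLaw p lam).map
      (fun x => ((x.1 0, x.2 0), (dropSeq 1 x.1, dropSeq 1 x.2))) =
      ((expMeasure lam).prod (pollLaw p)).prod (hopPollLaw p lam) := by
    rw [← (measurePreserving_prodProdProdComm (expMeasure lam) (iidLaw (expMeasure lam))
      (pollLaw p) (iidLaw (pollLaw p))).map_eq, ← map_head_tail_iidLaw, ← map_head_tail_iidLaw,
      Measure.map_prod_map _ _ ((measurable_pi_apply 0).prodMk (measurable_dropSeq 1))
        ((measurable_pi_apply 0).prodMk (measurable_dropSeq 1)),
      Measure.map_map (measurePreserving_prodProdProdComm (expMeasure lam)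
        (iidLaw (expMeasure lam)) (pollLaw p) (iidLaw (pollLaw p))).measurable]
    · rfl
    · exact (((measurable_pi_apply 0).prodMk (measurable_dropSeq 1)).prodMap
        ((measurable_pi_apply 0).prodMk (measurable_dropSeq 1)))
  have hG : Measurable fun q : (ℝ × Bool) × ℝ × ℝ × ℝ =>
      extendStats q.1.1 (if q.1.2 = true then 0 else q.2) := by
    refine measurable_extendStats.comp (Measurable.prodMk (by fun_prop) ?_)
    exact Measurable.ite (measurableSet_eq_fun (by fun_prop) measurable_const) measurable_const
      measurable_snd
  have hK : blockLaw p lam = (((expMeasure lam).prod (pollLaw p)).prod (blockLaw p lam)).map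
      fun q => extendStats q.1.1 (if q.1.2 = true then 0 else q.2) := by
    have e : ((expMeasure lam).prod (pollLaw p)).prod (blockLaw p lam) =
        (((expMeasure lam).prod (pollLaw p)).prod (hopPollLaw p lam)).map
          (Prod.map id blockStats) := by
      rw [← Measure.map_prod_map _ _ measurable_id measurable_blockStats, Measure.map_id, blockLaw]
    have hs : Measurable fun x : (ℕ → ℝ) × (ℕ → Bool) =>
        ((x.1 0, x.2 0), (dropSeq 1 x.1, dropSeq 1 x.2)) :=
      Measurable.prodMk (by fun_prop) (Measurable.prodMk
        ((measurable_dropSeq 1).comp measurable_fst) ((measurable_dropSeq 1).comp measurable_snd))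
    rw [e, Measure.map_map hG (measurable_id.prodMap measurable_blockStats), ← hstep,
      Measure.map_map (hG.comp (measurable_id.prodMap measurable_blockStats)) hs, blockLaw]
    refine Measure.map_congr ?_
    filter_upwards [ae_exists_polled_hopPollLaw (lam := lam) hp hp1] with x hx
    exact blockStats_eq hx
  have hc : ∀ c : Bool, ((expMeasure lam).prod (Measure.dirac c)).prod (blockLaw p lam) =
      ((expMeasure lam).prod (blockLaw p lam)).map (Prod.map (fun y => (y, c)) id) := fun c => by
    rw [Measure.prod_dirac, ← Measure.map_prod_map _ _ measurable_prodMk_right measurable_id,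
      Measure.map_id]
  have hm : ∀ c : Bool, Measurable (Prod.map (fun y : ℝ => (y, c)) (id : ℝ × ℝ × ℝ → _)) :=
    fun c => measurable_prodMk_right.prodMap measurable_id
  have h1 : (((expMeasure lam).prod (blockLaw p lam)).map fun q => extendStats q.1 0) =
      (expMeasure lam).map fun y => extendStats y 0 := by
    have hm0 : Measurable fun y : ℝ => extendStats y 0 := by unfold extendStats; fun_prop
    have e := Measure.map_map (μ := (expMeasure lam).prod (blockLaw p lam)) hm0 measurable_fst
    rw [Measure.map_fst_prod, measure_univ, one_smul] at e
    exact e.symm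
  conv_lhs => rw [hK]
  rw [pollLaw, Measure.prod_add, Measure.prod_smul_right, Measure.prod_smul_right,
    Measure.add_prod, Measure.prod_smul_left, Measure.prod_smul_left, hc, hc,
    Measure.map_add _ _ hG, Measure.map_smul, Measure.map_smul, Measure.map_map hG (hm _),
    Measure.map_map hG (hm _), ← h1]
  rfl

/-- The first-step decomposition for expectations. -/
lemma integral_blockLaw_eq {E : Type*} [NormedAddCommGroup E] [NormedSpace ℝ E] (hlam : 0 < lam)
    (hp : 0 < p) (hp1 : p ≤ 1) {f : ℝ × ℝ × ℝ → E} (hm : StronglyMeasurable f)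
    (hf : Integrable f (blockLaw p lam)) :
    ∫ z, f z ∂(blockLaw p lam) = p • ∫ y, f (extendStats y 0) ∂(expMeasure lam) +
      (1 - p) • ∫ q, f (extendStats q.1 q.2) ∂((expMeasure lam).prod (blockLaw p lam)) := by
  have e := blockLaw_eq hlam hp hp1
  have hm0 : Measurable fun y : ℝ => extendStats y 0 := by unfold extendStats; fun_prop
  have hf' := hf
  rw [e] at hf'
  conv_lhs => rw [e]
  rw [integral_add_measure hf'.left_of_add_measure hf'.right_of_add_measure,
    integral_smul_measure, integral_smul_measure, integral_map hm0.aemeasurable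
      hm.aestronglyMeasurable, integral_map measurable_extendStats.aemeasurable
      hm.aestronglyMeasurable, ENNReal.toReal_ofReal hp.le, ENNReal.toReal_ofReal (by linarith)]

/-- A geometric number of exponential hops lasts an exponential time: the polled updates form a
Poisson process of rate `p λ`. -/
theorem map_fst_blockLaw (hlam : 0 < lam) (hp : 0 < p) (hp1 : p ≤ 1) :
    (blockLaw p lam).map Prod.fst = expMeasure (p * lam) := by
  have := isProbabilityMeasure_expMeasure hlam
  have := isProbabilityMeasure_pollLaw hp hp1
  have := isProbabilityMeasure_blockLaw (p := p) (lam := lam)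
  have := isProbabilityMeasure_expMeasure (mul_pos hp hlam)
  have : IsProbabilityMeasure ((blockLaw p lam).map Prod.fst) :=
    Measure.isProbabilityMeasure_map measurable_fst.aemeasurable
  refine Measure.ext_of_charFun (funext fun t => ?_)
  rw [charFun_expMeasure (mul_pos hp hlam), charFun_apply_real,
    integral_map measurable_fst.aemeasurable (by fun_prop)]
  have hsm : StronglyMeasurable fun z : ℝ × ℝ × ℝ => Complex.exp (t * z.1 * Complex.I) := by
    fun_prop
  have hint : Integrable (fun z : ℝ × ℝ × ℝ => Complex.exp (t * z.1 * Complex.I))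
      (blockLaw p lam) := by
    refine Integrable.of_bound hsm.aestronglyMeasurable 1 (Eventually.of_forall fun z => ?_)
    have := Complex.norm_exp_ofReal_mul_I (t * z.1)
    push_cast at this
    exact this.le
  have h := integral_blockLaw_eq hlam hp hp1 hsm hint
  have hφ := charFun_expMeasure hlam t
  rw [charFun_apply_real] at hφ
  have h2 : ∫ q : ℝ × ℝ × ℝ × ℝ, Complex.exp (t * (extendStats q.1 q.2).1 * Complex.I)
      ∂((expMeasure lam).prod (blockLaw p lam)) =
      (∫ y : ℝ, Complex.exp (t * y * Complex.I) ∂(expMeasure lam)) *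
        ∫ z : ℝ × ℝ × ℝ, Complex.exp (t * z.1 * Complex.I) ∂(blockLaw p lam) := by
    rw [← integral_prod_mul]
    refine integral_congr_ae (Eventually.of_forall fun q => ?_)
    simp only [extendStats]
    rw [← Complex.exp_add]
    push_cast
    congr 1; ring
  rw [h2] at h
  have h3 : ∀ y : ℝ, (extendStats y 0).1 = y := fun y => by simp [extendStats]
  simp only [h3] at h
  rw [hφ] at h
  set χ := ∫ z : ℝ × ℝ × ℝ, Complex.exp (t * z.1 * Complex.I) ∂(blockLaw p lam)
  have hne : ∀ r : ℝ, 0 < r → (r : ℂ) - t * Complex.I ≠ 0 := fun r hr h0 => by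
    have := congrArg Complex.re h0
    simp at this
    exact hr.ne' this
  have n1 := hne lam hlam
  have n2 := hne (p * lam) (mul_pos hp hlam)
  simp only [Complex.real_smul] at h
  rw [eq_div_iff n2]
  field_simp at h
  push_cast at h ⊢
  linear_combination h

lemma integral_blockLaw_fst {E : Type*} [NormedAddCommGroup E] [NormedSpace ℝ E] (hlam : 0 < lam)
    (hp : 0 < p) (hp1 : p ≤ 1) {f : ℝ → E} (hf : StronglyMeasurable f) :
    ∫ z, f z.1 ∂(blockLaw p lam) = ∫ x, f x ∂(expMeasure (p * lam)) := by
  rw [← map_fst_blockLaw hlam hp hp1, integral_map measurable_fst.aemeasurable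
    hf.aestronglyMeasurable]

lemma integrable_blockLaw_fst {E : Type*} [NormedAddCommGroup E] (hlam : 0 < lam)
    (hp : 0 < p) (hp1 : p ≤ 1) {f : ℝ → E} (hf : Integrable f (expMeasure (p * lam))) :
    Integrable (fun z => f z.1) (blockLaw p lam) := by
  rw [← map_fst_blockLaw hlam hp hp1] at hf
  exact hf.comp_measurable measurable_fst

lemma ae_blockLaw_fst_pos (hlam : 0 < lam) (hp : 0 < p) (hp1 : p ≤ 1) :
    ∀ᵐ z ∂(blockLaw p lam), 0 < z.1 := by
  have h := ae_pos_expMeasure (r := p * lam)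
  rw [← map_fst_blockLaw hlam hp hp1] at h
  exact ae_of_ae_map measurable_fst.aemeasurable h

lemma hopStats_bounds (n : ℕ) {h : ℕ → ℝ} (hh : ∀ k, 0 ≤ h k) :
    0 ≤ (hopStats n h).1 ∧ 0 ≤ (hopStats n h).2.1 ∧ 0 ≤ (hopStats n h).2.2 ∧
      (hopStats n h).2.1 ≤ (hopStats n h).1 ^ 2 ∧ (hopStats n h).2.2 ≤ (hopStats n h).1 ^ 3 := by
  have h2 : ∑ j ∈ Finset.range n, h j ^ 2 ≤ (∑ j ∈ Finset.range n, h j) ^ 2 :=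
    Finset.sum_sq_le_sq_sum_of_nonneg fun j _ => hh j
  have h1 : 0 ≤ ∑ j ∈ Finset.range n, h j := Finset.sum_nonneg fun j _ => hh j
  have h3 : ∀ j ∈ Finset.range n, 0 ≤ h j ^ 3 / 3 + h j * ∑ l ∈ Finset.range j, h l ^ 2 := by
    intro j _
    have := hh j
    have : 0 ≤ ∑ l ∈ Finset.range j, h l ^ 2 := Finset.sum_nonneg fun l _ => sq_nonneg _
    positivity
  have h4 : 0 ≤ ∑ j ∈ Finset.range n, h j ^ 2 := Finset.sum_nonneg fun j _ => sq_nonneg _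
  refine ⟨h1, h4, Finset.sum_nonneg h3, h2, ?_⟩
  simp only [hopStats]
  calc ∑ j ∈ Finset.range n, (h j ^ 3 / 3 + h j * ∑ l ∈ Finset.range j, h l ^ 2)
        ≤ ∑ j ∈ Finset.range n, h j * ∑ l ∈ Finset.range n, h l ^ 2 := by
          refine Finset.sum_le_sum fun j hj => ?_
          have hj0 := hh j
          have hsub : ∑ l ∈ Finset.range (j + 1), h l ^ 2 ≤ ∑ l ∈ Finset.range n, h l ^ 2 :=
            Finset.sum_le_sum_of_subset_of_nonneg
              (Finset.range_subset_range.2 (Finset.mem_range.1 hj)) fun l _ _ => sq_nonneg _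
          rw [Finset.sum_range_succ] at hsub
          nlinarith [mul_le_mul_of_nonneg_left hsub hj0, pow_nonneg hj0 3]
      _ = (∑ j ∈ Finset.range n, h j) * ∑ l ∈ Finset.range n, h l ^ 2 := by rw [Finset.sum_mul]
      _ ≤ (∑ j ∈ Finset.range n, h j) * (∑ j ∈ Finset.range n, h j) ^ 2 := by gcongr
      _ = _ := by ring

lemma ae_hop_pos (hlam : 0 < lam) : ∀ᵐ h ∂(iidLaw (expMeasure lam)), ∀ k, 0 < h k := by
  have := isProbabilityMeasure_expMeasure hlam
  rw [ae_all_iff]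
  intro k
  have h := ae_pos_expMeasure (r := lam)
  rw [← Measure.infinitePi_map_eval (fun _ : ℕ => expMeasure lam) k] at h
  exact ae_of_ae_map (measurable_pi_apply k).aemeasurable h

lemma ae_blockLaw_bounds (hlam : 0 < lam) (hp : 0 < p) (hp1 : p ≤ 1) :
    ∀ᵐ z ∂(blockLaw p lam), 0 ≤ z.2.1 ∧ 0 ≤ z.2.2 ∧ z.2.1 ≤ z.1 ^ 2 ∧ z.2.2 ≤ z.1 ^ 3 := by
  have := isProbabilityMeasure_expMeasure hlam
  have := isProbabilityMeasure_pollLaw hp hp1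
  have hms : MeasurableSet {z : ℝ × ℝ × ℝ | 0 ≤ z.2.1 ∧ 0 ≤ z.2.2 ∧ z.2.1 ≤ z.1 ^ 2 ∧
      z.2.2 ≤ z.1 ^ 3} := by
    have m1 : Measurable fun z : ℝ × ℝ × ℝ => z.2.1 := by fun_prop
    have m2 : Measurable fun z : ℝ × ℝ × ℝ => z.2.2 := by fun_prop
    have m3 : ∀ n : ℕ, Measurable fun z : ℝ × ℝ × ℝ => z.1 ^ n := fun n => by fun_prop
    exact (measurableSet_le measurable_const m1).inter
      ((measurableSet_le measurable_const m2).inter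
        ((measurableSet_le m1 (m3 2)).inter (measurableSet_le m2 (m3 3))))
  refine (ae_map_iff measurable_blockStats.aemeasurable hms).2 ?_
  filter_upwards [Measure.quasiMeasurePreserving_fst.ae (ae_hop_pos hlam)] with x hx
  exact (hopStats_bounds _ fun k => (hx k).le).2

/-- Products of block statistics are dominated by a power of the block duration. -/
lemma integrable_blockLaw_of_le (hlam : 0 < lam) (hp : 0 < p) (hp1 : p ≤ 1)
    {f : ℝ × ℝ × ℝ → ℝ} (hf : Measurable f) (n : ℕ)
    (hb : ∀ z : ℝ × ℝ × ℝ, 0 < z.1 → 0 ≤ z.2.1 → 0 ≤ z.2.2 → z.2.1 ≤ z.1 ^ 2 → z.2.2 ≤ z.1 ^ 3 →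
      |f z| ≤ z.1 ^ n) : Integrable f (blockLaw p lam) := by
  refine (integrable_blockLaw_fst hlam hp hp1 (integrable_pow_expMeasure (mul_pos hp hlam) n)).mono'
    hf.aestronglyMeasurable ?_
  filter_upwards [ae_blockLaw_fst_pos hlam hp hp1, ae_blockLaw_bounds hlam hp hp1] with z h1 h2
  exact hb z h1 h2.1 h2.2.1 h2.2.2.1 h2.2.2.2

lemma integrable_blockLaw_sq (hlam : 0 < lam) (hp : 0 < p) (hp1 : p ≤ 1) :
    Integrable (fun z : ℝ × ℝ × ℝ => z.2.1) (blockLaw p lam) :=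
  integrable_blockLaw_of_le hlam hp hp1 (by fun_prop) 2 fun z _ h2 _ h4 _ => by
    rwa [abs_of_nonneg h2]

lemma integrable_blockLaw_area (hlam : 0 < lam) (hp : 0 < p) (hp1 : p ≤ 1) :
    Integrable (fun z : ℝ × ℝ × ℝ => z.2.2) (blockLaw p lam) :=
  integrable_blockLaw_of_le hlam hp hp1 (by fun_prop) 3 fun z _ _ h3 _ h5 => by
    rwa [abs_of_nonneg h3]

lemma integrable_blockLaw_sq_mul_exp (hlam : 0 < lam) (hp : 0 < p) (hp1 : p ≤ 1) {s : ℝ}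
    (hs : 0 ≤ s) :
    Integrable (fun z : ℝ × ℝ × ℝ => z.2.1 * Real.exp (-(s * z.1))) (blockLaw p lam) :=
  integrable_blockLaw_of_le hlam hp hp1 (by fun_prop) 2 fun z h1 h2 _ h4 _ => by
    rw [abs_of_nonneg (by positivity)]
    refine (mul_le_of_le_one_right h2 (Real.exp_le_one_iff.2 ?_)).trans h4
    have := mul_nonneg hs h1.le
    linarith

lemma integral_blockLaw_sq_mul_exp (hlam : 0 < lam) (hp : 0 < p) (hp1 : p ≤ 1) {s : ℝ}
    (hs : 0 ≤ s) :
    ∫ z : ℝ × ℝ × ℝ, z.2.1 * Real.exp (-(s * z.1)) ∂(blockLaw p lam) =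
      2 * p * lam / ((lam + s) * (p * lam + s) ^ 2) := by
  have := isProbabilityMeasure_expMeasure hlam
  have := isProbabilityMeasure_pollLaw hp hp1
  have := isProbabilityMeasure_blockLaw (p := p) (lam := lam)
  have hpl := mul_pos hp hlam
  have hls : 0 < lam + s := by linarith
  have hpls : 0 < p * lam + s := by linarith
  have h := integral_blockLaw_eq hlam hp hp1
    (by fun_prop : StronglyMeasurable fun z : ℝ × ℝ × ℝ => z.2.1 * Real.exp (-(s * z.1)))
    (integrable_blockLaw_sq_mul_exp hlam hp hp1 hs)
  have e1 : ∀ y : ℝ, (extendStats y 0).2.1 * Real.exp (-(s * (extendStats y 0).1)) =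
      y ^ 2 * Real.exp (-(s * y)) := fun y => by simp [extendStats]
  have e2 : ∀ q : ℝ × ℝ × ℝ × ℝ, (extendStats q.1 q.2).2.1 *
      Real.exp (-(s * (extendStats q.1 q.2).1)) =
      (q.1 ^ 2 * Real.exp (-(s * q.1))) * Real.exp (-(s * q.2.1)) +
        Real.exp (-(s * q.1)) * (q.2.2.1 * Real.exp (-(s * q.2.1))) := fun q => by
    simp only [extendStats]
    rw [mul_add, neg_add, Real.exp_add]; ring
  simp only [e1, e2] at h
  have i1 := integrable_pow_mul_exp_expMeasure hlam 2 hls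
  have i2 := integrable_blockLaw_fst hlam hp hp1 (integrable_exp_expMeasure hpl hpls)
  have i3 := integrable_exp_expMeasure hlam hls
  have i4 := integrable_blockLaw_sq_mul_exp hlam hp hp1 hs
  rw [integral_add (i1.mul_prod i2) (i3.mul_prod i4),
    integral_prod_mul (fun y => y ^ 2 * Real.exp (-(s * y)))
      (fun z : ℝ × ℝ × ℝ => Real.exp (-(s * z.1))),
    integral_prod_mul (fun y => Real.exp (-(s * y)))
      (fun z : ℝ × ℝ × ℝ => z.2.1 * Real.exp (-(s * z.1))),
    integral_pow_mul_exp_expMeasure hlam 2 hls, integral_exp_expMeasure hlam hls,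
    integral_blockLaw_fst hlam hp hp1
      (by fun_prop : StronglyMeasurable fun x : ℝ => Real.exp (-(s * x))),
    integral_exp_expMeasure hpl hpls] at h
  set W := ∫ z : ℝ × ℝ × ℝ, z.2.1 * Real.exp (-(s * z.1)) ∂(blockLaw p lam)
  simp only [smul_eq_mul, Nat.factorial] at h
  -- the first-step decomposition is a linear equation for `W`
  have h6 : (lam + s) ^ 2 * (W * ((lam + s) * (p * lam + s) ^ 2)) =
      (lam + s) ^ 2 * (2 * p * lam) := by
    field_simp at h
    push_cast at h
    linear_combination h
  rw [eq_div_iff (by positivity)]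
  exact mul_left_cancel₀ (pow_ne_zero 2 hls.ne') h6

lemma integral_blockLaw_sq (hlam : 0 < lam) (hp : 0 < p) (hp1 : p ≤ 1) :
    ∫ z : ℝ × ℝ × ℝ, z.2.1 ∂(blockLaw p lam) = 2 / (p * lam ^ 2) := by
  have h := integral_blockLaw_sq_mul_exp hlam hp hp1 le_rfl
  simp only [zero_mul, neg_zero, Real.exp_zero, mul_one, add_zero] at h
  rw [h]
  field_simp

lemma integral_blockLaw_area (hlam : 0 < lam) (hp : 0 < p) (hp1 : p ≤ 1) :
    ∫ z : ℝ × ℝ × ℝ, z.2.2 ∂(blockLaw p lam) =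
      2 * ((1 - p) / (p ^ 2 * lam ^ 3)) + 2 / (p * lam ^ 3) := by
  have := isProbabilityMeasure_expMeasure hlam
  have := isProbabilityMeasure_pollLaw hp hp1
  have := isProbabilityMeasure_blockLaw (p := p) (lam := lam)
  have hpl := mul_pos hp hlam
  have h := integral_blockLaw_eq hlam hp hp1
    (by fun_prop : StronglyMeasurable fun z : ℝ × ℝ × ℝ => z.2.2)
    (integrable_blockLaw_area hlam hp hp1)
  have e1 : ∀ y : ℝ, (extendStats y 0).2.2 = y ^ 3 / 3 := fun y => by simp [extendStats]
  have e2 : ∀ q : ℝ × ℝ × ℝ × ℝ, (extendStats q.1 q.2).2.2 =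
      q.1 ^ 3 / 3 + (q.1 ^ 2 * q.2.1 + q.2.2.2) := fun q => by
    simp only [extendStats, add_assoc]
  simp only [e1, e2] at h
  have i1 := ((integrable_pow_expMeasure hlam 3).div_const 3).comp_fst (blockLaw p lam)
  have i2 : Integrable (fun z : ℝ × ℝ × ℝ => z.1) (blockLaw p lam) := by
    simpa using integrable_blockLaw_fst hlam hp hp1 (integrable_pow_expMeasure hpl 1)
  have i3 := (integrable_blockLaw_area hlam hp hp1).comp_snd (expMeasure lam)
  have i4 := (integrable_pow_expMeasure hlam 2).mul_prod i2
  have h1 : ∫ z : ℝ × ℝ × ℝ, z.1 ∂(blockLaw p lam) = 1 / (p * lam) := by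
    have := integral_pow_expMeasure hpl 1
    rw [integral_blockLaw_fst (f := fun x : ℝ => x) hlam hp hp1 (by fun_prop)]
    simpa using this
  rw [integral_add i1 (i4.add i3 : Integrable (fun q => _ + _) _), integral_add i4 i3,
    integral_fun_fst (fun y : ℝ => y ^ 3 / 3), integral_fun_snd (fun z : ℝ × ℝ × ℝ => z.2.2),
    integral_prod_mul (fun y => y ^ 2) (fun z : ℝ × ℝ × ℝ => z.1), integral_div,
    integral_pow_expMeasure hlam 2, integral_pow_expMeasure hlam 3, h1] at h
  set W := ∫ z : ℝ × ℝ × ℝ, z.2.2 ∂(blockLaw p lam)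
  simp only [smul_eq_mul, Nat.factorial, probReal_univ, one_mul] at h
  push_cast at h
  have h6 : p * W = p * (2 * ((1 - p) / (p ^ 2 * lam ^ 3)) + 2 / (p * lam ^ 3)) := by
    field_simp at h ⊢
    linear_combination h / 3
  exact mul_left_cancel₀ hp.ne' h6

end BlockLaw

/-! ### A strong law under geometric decay of correlations -/

section StrongLaw

variable {Ω : Type*} [MeasurableSpace Ω] {P : Measure Ω}

lemma ae_tendsto_zero_of_summable_integral {f : ℕ → Ω → ℝ} (hf : ∀ n, Integrable (f n) P)
    (h0 : ∀ n, 0 ≤ f n) (hs : Summable fun n => ∫ ω, f n ω ∂P) :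
    ∀ᵐ ω ∂P, Tendsto (fun n => f n ω) atTop (𝓝 0) := by
  have h1 : ∫⁻ ω, ∑' n, ENNReal.ofReal (f n ω) ∂P ≠ ⊤ := by
    rw [lintegral_tsum fun n => (hf n).aestronglyMeasurable.aemeasurable.ennreal_ofReal]
    simp_rw [← fun n => ofReal_integral_eq_lintegral_ofReal (hf n) (Eventually.of_forall (h0 n))]
    rw [← ENNReal.ofReal_tsum_of_nonneg (fun n => integral_nonneg (h0 n)) hs]
    exact ENNReal.ofReal_ne_top
  have hm : AEMeasurable (fun ω => ∑' n, ENNReal.ofReal (f n ω)) P :=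
    AEMeasurable.tsum fun n => (hf n).aestronglyMeasurable.aemeasurable.ennreal_ofReal
  filter_upwards [ae_lt_top' hm h1] with ω hω
  have := ENNReal.tendsto_atTop_zero_of_tsum_ne_top hω.ne
  have h2 := (ENNReal.tendsto_toReal ENNReal.zero_ne_top).comp this
  simpa [Function.comp_def, ENNReal.toReal_ofReal (h0 _ _)] using h2

variable {Φ : Ω → Ω} {q : Ω → ℝ} {C r : ℝ}

/-- Along the orbit of a measure preserving map a square integrable function grows at most like the
square root of the time. -/
lemma ae_tendsto_iterate_div (hΦ : MeasurePreserving Φ P P) (hq : MemLp q 2 P) :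
    ∀ᵐ ω ∂P, Tendsto (fun n : ℕ => q (Φ^[n] ω) / n) atTop (𝓝 0) := by
  have hg : ∀ n, MemLp (fun ω => q (Φ^[n] ω)) 2 P := fun n =>
    hq.comp_measurePreserving (hΦ.iterate n)
  have hi : ∀ n : ℕ, ∫ ω, (q (Φ^[n] ω) / n) ^ 2 ∂P = (∫ ω, q ω ^ 2 ∂P) * (1 / (n : ℝ) ^ 2) := by
    intro n
    simp_rw [div_pow, div_eq_mul_one_div (_ ^ 2) ((n : ℝ) ^ 2)]
    rw [integral_mul_const]
    congr 1
    have := (hΦ.iterate n).map_eq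
    conv_rhs => rw [← this]
    rw [integral_map (hΦ.iterate n).measurable.aemeasurable]
    rw [this]
    exact (hq.aestronglyMeasurable.pow 2)
  have h := ae_tendsto_zero_of_summable_integral (P := P) (f := fun n ω => (q (Φ^[n] ω) / n) ^ 2)
    (fun n => by
      simp_rw [div_pow]
      exact (hg n).integrable_sq.div_const _)
    (fun n ω => sq_nonneg _)
    (by
      simp_rw [hi]
      exact (Real.summable_one_div_nat_pow.2 one_lt_two).mul_left _)
  filter_upwards [h] with ω hω
  have := hω.sqrt
  rw [Real.sqrt_zero] at this
  simp_rw [Real.sqrt_sq_eq_abs] at this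
  exact (tendsto_zero_iff_abs_tendsto_zero _).2 this

variable [IsProbabilityMeasure P]

/-- Under one-sided geometric decay of the correlations, the variance of the partial sums is at most
linear. -/
lemma integral_sq_sum_iterate_le (hΦ : MeasurePreserving Φ P P) (hq : MemLp q 2 P) (hC : 0 ≤ C)
    (hr0 : 0 ≤ r) (hr1 : r < 1)
    (hcov : ∀ k, ∫ ω, q ω * q (Φ^[k + 1] ω) ∂P ≤ (∫ ω, q ω ∂P) ^ 2 + C * r ^ k) (n : ℕ) :
    ∫ ω, (∑ i ∈ Finset.range n, (q (Φ^[i] ω) - ∫ ω, q ω ∂P)) ^ 2 ∂P ≤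
      n * (∫ ω, (q ω - ∫ ω, q ω ∂P) ^ 2 ∂P + 2 * (C * (1 - r)⁻¹)) := by
  set a := ∫ ω, q ω ∂P with ha
  have hmap : ∀ (n : ℕ) (f : Ω → ℝ), AEStronglyMeasurable f P →
      ∫ ω, f (Φ^[n] ω) ∂P = ∫ ω, f ω ∂P := fun n f hf => by
    have := (hΦ.iterate n).map_eq
    conv_rhs => rw [← this]
    rw [integral_map (hΦ.iterate n).measurable.aemeasurable (by rwa [this])]
  have hg : ∀ n, MemLp (fun ω => q (Φ^[n] ω) - a) 2 P := fun n =>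
    (hq.comp_measurePreserving (hΦ.iterate n)).sub (memLp_const a)
  have hgi : ∀ n, Integrable (fun ω => q (Φ^[n] ω)) P := fun n =>
    (hq.comp_measurePreserving (hΦ.iterate n)).integrable one_le_two
  have hcov' : ∀ i k, ∫ ω, (q (Φ^[i] ω) - a) * (q (Φ^[i + (k + 1)] ω) - a) ∂P ≤ C * r ^ k := by
    intro i k
    have e1 : ∫ ω, (q (Φ^[i] ω) - a) * (q (Φ^[i + (k + 1)] ω) - a) ∂P =
        ∫ ω, (q ω - a) * (q (Φ^[k + 1] ω) - a) ∂P := by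
      rw [← hmap i (fun ω => (q ω - a) * (q (Φ^[k + 1] ω) - a))
        ((hg 0).aestronglyMeasurable.mul (hg (k + 1)).aestronglyMeasurable)]
      refine integral_congr_ae (Eventually.of_forall fun ω => ?_)
      simp only [add_comm i, Function.iterate_add_apply Φ (k + 1) i ω]
    have e2 : ∀ ω, (q ω - a) * (q (Φ^[k + 1] ω) - a) =
        q ω * q (Φ^[k + 1] ω) - (a * q ω + (a * q (Φ^[k + 1] ω) - a ^ 2)) := fun ω => by ring
    have i1 : Integrable (fun ω => q ω * q (Φ^[k + 1] ω)) P :=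
      hq.integrable_mul (hq.comp_measurePreserving (hΦ.iterate (k + 1)))
    have i2 : Integrable (fun ω => a * q ω) P := (hgi 0).const_mul a
    have i3 : Integrable (fun ω => a * q (Φ^[k + 1] ω) - a ^ 2) P :=
      ((hgi (k + 1)).const_mul a).sub (integrable_const _)
    rw [e1]
    simp_rw [e2]
    rw [integral_sub i1 (i2.add i3 : Integrable (fun ω => _ + _) P), integral_add i2 i3,
      integral_sub ((hgi (k + 1)).const_mul a) (integrable_const _), integral_const_mul,
      integral_const_mul, hmap (k + 1) q hq.aestronglyMeasurable, ← ha, integral_const]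
    simp only [probReal_univ, one_smul]
    have := hcov k
    nlinarith
  induction n with
  | zero => simp
  | succ n ih =>
    have hsum : MemLp (fun ω => ∑ i ∈ Finset.range n, (q (Φ^[i] ω) - a)) 2 P :=
      memLp_finsetSum _ fun i _ => hg i
    have e : ∀ ω, (∑ i ∈ Finset.range (n + 1), (q (Φ^[i] ω) - a)) ^ 2 =
        (∑ i ∈ Finset.range n, (q (Φ^[i] ω) - a)) ^ 2 +
        (2 * (∑ i ∈ Finset.range n, (q (Φ^[i] ω) - a) * (q (Φ^[n] ω) - a)) +
          (q (Φ^[n] ω) - a) ^ 2) := fun ω => by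
      rw [Finset.sum_range_succ, ← Finset.sum_mul]; ring
    have i2 : ∀ i, Integrable (fun ω => (q (Φ^[i] ω) - a) * (q (Φ^[n] ω) - a)) P :=
      fun i => (hg i).integrable_mul (hg n)
    have i3 : Integrable (fun ω => 2 * ∑ i ∈ Finset.range n,
        (q (Φ^[i] ω) - a) * (q (Φ^[n] ω) - a)) P :=
      (integrable_finsetSum _ fun i _ => i2 i).const_mul 2
    have i4 : Integrable (fun ω => (q (Φ^[n] ω) - a) ^ 2) P := (hg n).integrable_sq
    simp_rw [e]
    rw [integral_add hsum.integrable_sq (i3.add i4 : Integrable (fun ω => _ + _) P),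
      integral_add i3 i4, integral_const_mul, integral_finsetSum _ fun i _ => i2 i,
      hmap n (fun ω => (q ω - a) ^ 2) ((hg 0).aestronglyMeasurable.pow 2)]
    have hb : ∑ i ∈ Finset.range n, ∫ ω, (q (Φ^[i] ω) - a) * (q (Φ^[n] ω) - a) ∂P ≤
        C * (1 - r)⁻¹ := by
      calc ∑ i ∈ Finset.range n, ∫ ω, (q (Φ^[i] ω) - a) * (q (Φ^[n] ω) - a) ∂P
          ≤ ∑ i ∈ Finset.range n, C * r ^ (n - 1 - i) := by
            refine Finset.sum_le_sum fun i hi => ?_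
            have hi' := Finset.mem_range.1 hi
            have := hcov' i (n - 1 - i)
            rwa [show i + (n - 1 - i + 1) = n by omega] at this
        _ = C * ∑ i ∈ Finset.range n, r ^ i := by
            rw [← Finset.mul_sum, Finset.sum_range_reflect (fun i => r ^ i) n]
        _ ≤ C * (1 - r)⁻¹ := by
            refine mul_le_mul_of_nonneg_left ?_ hC
            rw [← tsum_geometric_of_lt_one hr0 hr1]
            exact (summable_geometric_of_lt_one hr0 hr1).sum_le_tsum _ fun i _ => pow_nonneg hr0 i
    push_cast
    nlinarith

/-- The strong law of large numbers along the orbit of a measure preserving map, for a nonnegative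
square integrable function whose correlations decay geometrically: the variance bound gives
convergence along the squares, and monotonicity of the partial sums fills the gaps. -/
theorem ae_tendsto_average_iterate (hΦ : MeasurePreserving Φ P P) (hq : MemLp q 2 P)
    (hq0 : ∀ᵐ ω ∂P, 0 ≤ q ω) (hC : 0 ≤ C) (hr0 : 0 ≤ r) (hr1 : r < 1)
    (hcov : ∀ k, ∫ ω, q ω * q (Φ^[k + 1] ω) ∂P ≤ (∫ ω, q ω ∂P) ^ 2 + C * r ^ k) :
    ∀ᵐ ω ∂P, Tendsto (fun n : ℕ => (∑ i ∈ Finset.range n, q (Φ^[i] ω)) / n) atTop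
      (𝓝 (∫ ω, q ω ∂P)) := by
  have hvar := integral_sq_sum_iterate_le hΦ hq hC hr0 hr1 hcov
  set a := ∫ ω, q ω ∂P with ha
  set V := ∫ ω, (q ω - a) ^ 2 ∂P + 2 * (C * (1 - r)⁻¹)
  have hg : ∀ n, MemLp (fun ω => q (Φ^[n] ω) - a) 2 P := fun n =>
    (hq.comp_measurePreserving (hΦ.iterate n)).sub (memLp_const a)
  have hint : ∀ n : ℕ, Integrable (fun ω =>
      ((∑ i ∈ Finset.range n, (q (Φ^[i] ω) - a)) / n) ^ 2) P := fun n => by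
    simp_rw [div_pow]
    exact (memLp_finsetSum (Finset.range n) fun i _ => hg i).integrable_sq.div_const _
  have hle : ∀ k : ℕ, ∫ ω, ((∑ i ∈ Finset.range (k ^ 2), (q (Φ^[i] ω) - a)) / (k ^ 2 : ℕ)) ^ 2 ∂P ≤
      V * (1 / (k : ℝ) ^ 2) := by
    intro k
    simp_rw [div_pow]
    rw [integral_div]
    rcases Nat.eq_zero_or_pos k with rfl | hk
    · simp
    · rw [div_le_iff₀ (by positivity)]
      refine (hvar (k ^ 2)).trans_eq ?_
      push_cast
      field_simp
  have hsub := ae_tendsto_zero_of_summable_integral (P := P)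
    (f := fun k ω => ((∑ i ∈ Finset.range (k ^ 2), (q (Φ^[i] ω) - a)) / (k ^ 2 : ℕ)) ^ 2)
    (fun k => hint (k ^ 2)) (fun k ω => sq_nonneg _)
    (Summable.of_nonneg_of_le (fun k => integral_nonneg fun ω => sq_nonneg _) hle
      ((Real.summable_one_div_nat_pow.2 one_lt_two).mul_left _))
  have hnn : ∀ᵐ ω ∂P, ∀ n : ℕ, 0 ≤ q (Φ^[n] ω) :=
    ae_all_iff.2 fun n => (hΦ.iterate n).quasiMeasurePreserving.ae hq0
  filter_upwards [hsub, hnn] with ω h1 h2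
  have h3 : Tendsto (fun k : ℕ => (∑ i ∈ Finset.range (k ^ 2), q (Φ^[i] ω)) / (k ^ 2 : ℕ)) atTop
      (𝓝 a) := by
    have := h1.sqrt
    rw [Real.sqrt_zero] at this
    simp_rw [Real.sqrt_sq_eq_abs] at this
    have := ((tendsto_zero_iff_abs_tendsto_zero _).2 this).add_const a
    rw [zero_add] at this
    refine this.congr' ?_
    filter_upwards [eventually_gt_atTop 0] with k hk
    rw [Finset.sum_sub_distrib, Finset.sum_const, Finset.card_range, nsmul_eq_mul]
    have : ((k ^ 2 : ℕ) : ℝ) ≠ 0 := by positivity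
    field_simp
    ring
  refine tendsto_div_of_monotone_of_exists_subseq_tendsto_div
    (fun n => ∑ i ∈ Finset.range n, q (Φ^[i] ω)) a
    (fun n m hnm => Finset.sum_le_sum_of_subset_of_nonneg (Finset.range_subset_range.2 hnm)
      fun i _ _ => h2 i) fun b hb => ⟨fun k => k ^ 2, ?_, ?_, h3⟩
  · have hlim : Tendsto (fun k : ℕ => (1 + 1 / (k : ℝ)) ^ 2) atTop (𝓝 1) := by
      have := ((tendsto_one_div_atTop_nhds_zero_nat (𝕜 := ℝ)).const_add 1).pow 2
      simpa using this
    filter_upwards [hlim.eventually_lt_const hb, eventually_gt_atTop 0] with k hk hk0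
    have hk0' : (0 : ℝ) < k := by exact_mod_cast hk0
    have : ((k + 1 : ℕ) ^ 2 : ℝ) = (1 + 1 / (k : ℝ)) ^ 2 * k ^ 2 := by
      push_cast; field_simp
    push_cast at this ⊢
    rw [this]
    gcongr
  · exact tendsto_pow_atTop two_ne_zero

end StrongLaw

/-! ### The stationary law of the system time -/

/-- The law of the statistics of one block of hops together with an independent service time. -/
def innovLaw (p lam mu : ℝ) : Measure ((ℝ × ℝ × ℝ) × ℝ) := (blockLaw p lam).prod (expMeasure mu)

/-- Lindley's recursion: the system time of an update, from the system time `f` of the preceding one,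
the interarrival time `z.1.1` and the service time `z.2`. -/
def lindley (f : ℝ) (z : (ℝ × ℝ × ℝ) × ℝ) : ℝ := max (f - z.1.1) 0 + z.2

lemma measurable_lindley : Measurable fun q : ℝ × (ℝ × ℝ × ℝ) × ℝ => lindley q.1 q.2 := by
  unfold lindley; fun_prop

section Lindley

variable {p lam mu : ℝ}

lemma isProbabilityMeasure_innovLaw (hlam : 0 < lam) (hmu : 0 < mu) (hp : 0 < p) (hp1 : p ≤ 1) :
    IsProbabilityMeasure (innovLaw p lam mu) := by
  have := isProbabilityMeasure_expMeasure hlam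
  have := isProbabilityMeasure_expMeasure hmu
  have := isProbabilityMeasure_pollLaw hp hp1
  have := isProbabilityMeasure_blockLaw (p := p) (lam := lam)
  rw [innovLaw]
  infer_instance

lemma ae_innovLaw_bounds (hlam : 0 < lam) (hmu : 0 < mu) (hp : 0 < p) (hp1 : p ≤ 1) :
    ∀ᵐ z ∂(innovLaw p lam mu), (0 < z.1.1 ∧ 0 ≤ z.1.2.1 ∧ 0 ≤ z.1.2.2 ∧ z.1.2.1 ≤ z.1.1 ^ 2 ∧
      z.1.2.2 ≤ z.1.1 ^ 3) ∧ 0 < z.2 := by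
  have := isProbabilityMeasure_expMeasure hlam
  have := isProbabilityMeasure_expMeasure hmu
  have := isProbabilityMeasure_pollLaw hp hp1
  have := isProbabilityMeasure_blockLaw (p := p) (lam := lam)
  have h1 : ∀ᵐ z ∂(innovLaw p lam mu), 0 < z.1.1 :=
    Measure.quasiMeasurePreserving_fst.ae (ae_blockLaw_fst_pos hlam hp hp1)
  have h2 := Measure.quasiMeasurePreserving_fst (μ := blockLaw p lam) (ν := expMeasure mu) |>.ae
    (ae_blockLaw_bounds hlam hp hp1)
  have h3 := Measure.quasiMeasurePreserving_snd (μ := blockLaw p lam) (ν := expMeasure mu) |>.ae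
    (ae_pos_expMeasure (r := mu))
  filter_upwards [h1, h2, h3] with z h1 h2 h3
  exact ⟨⟨h1, h2⟩, h3⟩

/-- A law of the system time that is invariant under Lindley's recursion is exponential of rate
`mu - p * lam`. Indeed the recursion determines the characteristic function up to the constant
`∫ exp (-(p * lam) * f)`, and the value at `0` fixes this constant. -/
theorem eq_expMeasure_of_map_lindley {ρ : Measure ℝ} [IsProbabilityMeasure ρ] (hlam : 0 < lam)
    (hp : 0 < p) (hp1 : p ≤ 1) (hstab : p * lam < mu)
    (hρ : (ρ.prod (innovLaw p lam mu)).map (fun q => lindley q.1 q.2) = ρ) :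
    ρ = expMeasure (mu - p * lam) := by
  have hβ := mul_pos hp hlam
  have hmu : 0 < mu := hβ.trans hstab
  have := isProbabilityMeasure_expMeasure hlam
  have := isProbabilityMeasure_expMeasure hmu
  have := isProbabilityMeasure_pollLaw hp hp1
  have := isProbabilityMeasure_blockLaw (p := p) (lam := lam)
  have := isProbabilityMeasure_innovLaw hlam hmu hp hp1
  have hα : 0 < mu - p * lam := sub_pos.2 hstab
  have := isProbabilityMeasure_expMeasure hα
  have hpos : ∀ᵐ f ∂ρ, 0 ≤ f := by
    rw [← hρ, ae_map_iff measurable_lindley.aemeasurable measurableSet_Ici]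
    filter_upwards [Measure.quasiMeasurePreserving_snd.ae (ae_innovLaw_bounds hlam hmu hp hp1)]
      with q hq
    have := le_max_right (q.1 - q.2.1.1) 0
    have := hq.2
    unfold lindley
    linarith
  set K : ℝ := ∫ f, Real.exp (-(p * lam * f)) ∂ρ with hK
  have hKi : Integrable (fun f => Real.exp (-(p * lam * f))) ρ := by
    refine Integrable.of_bound (by fun_prop) 1 ?_
    filter_upwards [hpos] with f hf
    rw [Real.norm_eq_abs, abs_of_pos (Real.exp_pos _), Real.exp_le_one_iff]
    have := mul_nonneg hβ.le hf
    linarith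
  have hbd : ∀ (s g : ℝ), ‖Complex.exp (s * g * Complex.I)‖ = 1 := fun s g => by
    have := Complex.norm_exp_ofReal_mul_I (s * g)
    push_cast at this
    exact this
  have hne : ∀ r s : ℝ, 0 < r → (r : ℂ) + s * Complex.I ≠ 0 := fun r s hr h0 => by
    have := congrArg Complex.re h0
    simp at this
    exact hr.ne' this
  have hne' : ∀ r s : ℝ, 0 < r → (r : ℂ) - s * Complex.I ≠ 0 := fun r s hr h0 => by
    refine hne r (-s) hr ?_
    push_cast
    linear_combination h0
  have key : ∀ s : ℝ, charFun ρ s =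
      (p * lam * charFun ρ s + s * Complex.I * K) / (p * lam + s * Complex.I) *
        (mu / (mu - s * Complex.I)) := by
    intro s
    conv_lhs => rw [← hρ]
    rw [charFun_apply_real, integral_map measurable_lindley.aemeasurable (by fun_prop),
      integral_prod]
    · have h1 : ∀ f : ℝ, 0 ≤ f →
          ∫ z, Complex.exp (s * (lindley f z : ℝ) * Complex.I) ∂(innovLaw p lam mu) =
          (p * lam * Complex.exp (s * f * Complex.I) +
            s * Complex.I * Real.exp (-(p * lam * f))) / (p * lam + s * Complex.I) *
          (mu / (mu - s * Complex.I)) := by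
        intro f hf
        have h2 := integral_blockLaw_fst (f := fun x : ℝ =>
          Complex.exp (s * (max (f - x) 0 : ℝ) * Complex.I)) hlam hp hp1
          (Measurable.stronglyMeasurable (by fun_prop))
        rw [integral_cexp_posPart_expMeasure hβ hf s] at h2
        push_cast at h2
        rw [← charFun_expMeasure hmu, charFun_apply_real]
        push_cast
        rw [← h2, ← integral_prod_mul, innovLaw]
        refine integral_congr_ae (Eventually.of_forall fun z => ?_)
        simp only [lindley]
        rw [← Complex.exp_add]
        push_cast
        congr 1; ring
      rw [integral_congr_ae (g := fun f : ℝ => (p * lam * Complex.exp (s * f * Complex.I) +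
            s * Complex.I * Real.exp (-(p * lam * f))) / (p * lam + s * Complex.I) *
          (mu / (mu - s * Complex.I))) (hpos.mono fun f hf => h1 f hf)]
      rw [integral_mul_const, integral_div, integral_add, integral_const_mul, integral_const_mul,
        integral_complex_ofReal, ← charFun_apply_real]
      · refine Integrable.const_mul ?_ _
        exact Integrable.of_bound (by fun_prop) 1 (Eventually.of_forall fun f => (hbd s f).le)
      · exact hKi.ofReal.const_mul _
    · refine Integrable.of_bound ?_ 1 (Eventually.of_forall fun q => (hbd s _).le)
      have := measurable_lindley
      exact Measurable.aestronglyMeasurable (by fun_prop)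
  have key2 : ∀ s : ℝ, s ≠ 0 →
      charFun ρ s * ((mu - p * lam : ℝ) - s * Complex.I) = mu * K := by
    intro s hs
    have h := key s
    have n1 := hne (p * lam) s hβ
    have n2 := hne' mu s hmu
    push_cast at n1
    have hI : (s : ℂ) * Complex.I ≠ 0 := by simp [hs]
    refine mul_left_cancel₀ hI ?_
    rw [div_mul_div_comm, eq_div_iff (mul_ne_zero n1 n2)] at h
    push_cast
    linear_combination h
  have hcont : Continuous fun s : ℝ => charFun ρ s * ((mu - p * lam : ℝ) - s * Complex.I) := by
    have := continuous_charFun (μ := ρ)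
    fun_prop
  have hall : (fun s : ℝ => charFun ρ s * ((mu - p * lam : ℝ) - s * Complex.I)) =
      fun _ => (mu * K : ℂ) :=
    hcont.ext_on (dense_compl_singleton (0 : ℝ)) continuous_const fun s hs => key2 s hs
  have h0 := congrFun hall 0
  simp only [charFun_zero, probReal_univ] at h0
  refine Measure.ext_of_charFun (funext fun s => ?_)
  rw [charFun_expMeasure hα, eq_div_iff (hne' _ s hα)]
  refine (congrFun hall s).trans ?_
  rw [← h0]
  simp

end Lindley

/-! ### The queue driven by independent blocks -/

/-- The area attributed to an update, in terms of the system time `f` of the preceding update and of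
the block `z`. -/
def blockArea (v f : ℝ) (z : (ℝ × ℝ × ℝ) × ℝ) : ℝ := v ^ 2 * (z.1.2.2 + z.1.2.1 * lindley f z)

lemma measurable_blockArea (v : ℝ) :
    Measurable fun q : ℝ × (ℝ × ℝ × ℝ) × ℝ => blockArea v q.1 q.2 := by
  have := measurable_lindley
  unfold blockArea; fun_prop

/-- One step of the queue: a state is the system time of an update and the randomness `x` that drives
the later ones; `z x` is the first block in `x` and `σ x` is what follows it. -/
def queueStep {E : Type*} (z : E → (ℝ × ℝ × ℝ) × ℝ) (σ : E → E) (s : ℝ × E) : ℝ × E :=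
  (lindley s.1 (z s.2), σ s.2)

/-- The area attributed to the next update, in a given state of the queue. -/
def orbitArea {E : Type*} (v : ℝ) (z : E → (ℝ × ℝ × ℝ) × ℝ) (s : ℝ × E) : ℝ :=
  blockArea v s.1 (z s.2)

/-- The effect on the `k`-th area of a perturbation of the initial system time is at most `1 / θ` times
this quantity, up to the exponential of the size of the perturbation. -/
def couplingBound {E : Type*} (v θ : ℝ) (z : E → (ℝ × ℝ × ℝ) × ℝ) (σ : E → E) : ℕ → E → ℝ
  | 0, y => v ^ 2 * (z y).1.2.1
  | k + 1, y => Real.exp (θ * ((z y).2 - (z y).1.1)) * couplingBound v θ z σ k (σ y)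

section Coupling

variable {E : Type*} {z : E → (ℝ × ℝ × ℝ) × ℝ} {σ : E → E} {v θ : ℝ}

lemma lindley_coupling {f f₀ R : ℝ} {w : (ℝ × ℝ × ℝ) × ℝ} (h : f ≤ max f₀ R) :
    lindley f w ≤ max (lindley f₀ w) (R - w.1.1 + w.2) := by
  unfold lindley
  rw [max_add_add_right]
  suffices max (f - w.1.1) 0 ≤ max (max (f₀ - w.1.1) 0) (R - w.1.1) by linarith
  rcases le_max_iff.1 h with h | h
  · exact (max_le_max (sub_le_sub_right h _) le_rfl).trans (le_max_left _ _)
  · refine max_le ((sub_le_sub_right h _).trans (le_max_right _ _)) ?_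
    exact (le_max_right _ _).trans (le_max_left _ _)

/-- Comparison of the orbits of two initial system times. -/
lemma orbitArea_iterate_le (hθ : 0 < θ) (k : ℕ) {y : E}
    (hy : ∀ k, 0 ≤ (z (σ^[k] y)).1.1 ∧ 0 ≤ (z (σ^[k] y)).1.2.1 ∧ 0 ≤ (z (σ^[k] y)).2)
    {f f₀ R : ℝ} (hf₀ : 0 ≤ f₀) (h : f ≤ max f₀ R) :
    orbitArea v z ((queueStep z σ)^[k] (f, y)) ≤
      orbitArea v z ((queueStep z σ)^[k] (f₀, y)) +
        Real.exp (θ * R) * couplingBound v θ z σ k y / θ := by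
  induction k generalizing y f f₀ R with
  | zero =>
    obtain ⟨hX, hH, hS⟩ := hy 0
    simp only [Function.iterate_zero, id] at hX hH hS
    simp only [Function.iterate_zero, id, orbitArea, blockArea, couplingBound]
    have h1 : lindley f (z y) ≤ lindley f₀ (z y) + Real.exp (θ * R) / θ := by
      have he : R ≤ Real.exp (θ * R) / θ := by
        rw [le_div_iff₀ hθ]
        have := Real.add_one_le_exp (θ * R)
        linarith
      have hp : 0 ≤ Real.exp (θ * R) / θ := by positivity
      refine (lindley_coupling h).trans (max_le (by linarith) ?_)
      have : (z y).2 ≤ lindley f₀ (z y) := by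
        unfold lindley
        linarith [le_max_right (f₀ - (z y).1.1) 0]
      linarith
    have h2 := mul_le_mul_of_nonneg_left h1 (mul_nonneg (sq_nonneg v) hH)
    have h3 : Real.exp (θ * R) * (v ^ 2 * (z y).1.2.1) / θ =
      v ^ 2 * (z y).1.2.1 * (Real.exp (θ * R) / θ) := by ring
    rw [h3]
    linarith
  | succ k ih =>
    have h0 := (hy 0).2.2
    simp only [Function.iterate_zero, id] at h0
    have := ih (y := σ y) (fun k => by
      have := hy (k + 1)
      rwa [Function.iterate_succ_apply] at this) (f₀ := lindley f₀ (z y))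
      (by unfold lindley; linarith [le_max_right (f₀ - (z y).1.1) 0]) (lindley_coupling h)
    rw [Function.iterate_succ_apply, Function.iterate_succ_apply]
    refine this.trans_eq ?_
    simp only [queueStep, couplingBound]
    rw [← mul_assoc, ← Real.exp_add]
    congr 4; ring

end Coupling

section Dynamics

variable {p lam mu α v : ℝ}

lemma integrable_innovLaw_mul (hmu : 0 < mu) {f : ℝ × ℝ × ℝ → ℝ} {g : ℝ → ℝ}
    (hf : Integrable f (blockLaw p lam)) (hg : Integrable g (expMeasure mu)) :
    Integrable (fun z => f z.1 * g z.2) (innovLaw p lam mu) := by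
  have := isProbabilityMeasure_expMeasure hmu
  exact hf.mul_prod hg

lemma integrable_innovLaw_fst (hmu : 0 < mu) {f : ℝ × ℝ × ℝ → ℝ}
    (hf : Integrable f (blockLaw p lam)) :
    Integrable (fun z => f z.1) (innovLaw p lam mu) := by
  have := isProbabilityMeasure_expMeasure hmu
  simpa using integrable_innovLaw_mul hmu hf (integrable_const (1 : ℝ))

/-- The area of a block is square integrable. -/
lemma memLp_blockArea (hlam : 0 < lam) (hmu : 0 < mu) (hp : 0 < p) (hp1 : p ≤ 1) (hα : 0 < α) :
    MemLp (fun q : ℝ × (ℝ × ℝ × ℝ) × ℝ => blockArea v q.1 q.2) 2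
      ((expMeasure α).prod (innovLaw p lam mu)) := by
  have := isProbabilityMeasure_innovLaw hlam hmu hp hp1
  have := isProbabilityMeasure_expMeasure hα
  have hG : Integrable (fun z : ℝ × ℝ × ℝ => z.2.2 ^ 2) (blockLaw p lam) :=
    integrable_blockLaw_of_le hlam hp hp1 (by fun_prop) 6 fun z h1 h2 h3 h4 h5 => by
      rw [abs_of_nonneg (by positivity)]
      calc z.2.2 ^ 2 ≤ (z.1 ^ 3) ^ 2 := by gcongr
        _ = z.1 ^ 6 := by ring
  have hH : Integrable (fun z : ℝ × ℝ × ℝ => z.2.1 ^ 2) (blockLaw p lam) :=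
    integrable_blockLaw_of_le hlam hp hp1 (by fun_prop) 4 fun z h1 h2 h3 h4 h5 => by
      rw [abs_of_nonneg (by positivity)]
      calc z.2.1 ^ 2 ≤ (z.1 ^ 2) ^ 2 := by gcongr
        _ = z.1 ^ 4 := by ring
  have m1 : MemLp (fun q : ℝ × (ℝ × ℝ × ℝ) × ℝ => q.2.1.2.2) 2
      ((expMeasure α).prod (innovLaw p lam mu)) := by
    rw [memLp_two_iff_integrable_sq (Measurable.aestronglyMeasurable (by fun_prop))]
    simpa using (integrable_const (1 : ℝ)).mul_prod (μ := expMeasure α)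
      (integrable_innovLaw_fst hmu hG)
  have m2 : MemLp (fun q : ℝ × (ℝ × ℝ × ℝ) × ℝ => q.1 * q.2.1.2.1) 2
      ((expMeasure α).prod (innovLaw p lam mu)) := by
    rw [memLp_two_iff_integrable_sq (Measurable.aestronglyMeasurable (by fun_prop))]
    simp_rw [mul_pow]
    exact (integrable_pow_expMeasure hα 2).mul_prod (integrable_innovLaw_fst hmu hH)
  have m3 : MemLp (fun q : ℝ × (ℝ × ℝ × ℝ) × ℝ => q.2.1.2.1 * q.2.2) 2
      ((expMeasure α).prod (innovLaw p lam mu)) := by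
    rw [memLp_two_iff_integrable_sq (Measurable.aestronglyMeasurable (by fun_prop))]
    simp_rw [mul_pow]
    simpa using (integrable_const (1 : ℝ)).mul_prod (μ := expMeasure α)
      (integrable_innovLaw_mul hmu hH (integrable_pow_expMeasure hmu 2))
  refine (((m1.add m2).add m3).const_mul (v ^ 2)).mono
    (measurable_blockArea v).aestronglyMeasurable ?_
  filter_upwards [Measure.quasiMeasurePreserving_fst.ae (ae_pos_expMeasure (r := α)),
    Measure.quasiMeasurePreserving_snd.ae (ae_innovLaw_bounds hlam hmu hp hp1)] with q h1 h2
  obtain ⟨⟨hX, hH, hG, -⟩, hS⟩ := h2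
  have hl : lindley q.1 q.2 ≤ q.1 + q.2.2 := by
    unfold lindley
    gcongr
    exact max_le (by linarith) h1.le
  have hl0 : 0 ≤ lindley q.1 q.2 := by unfold lindley; positivity
  rw [Real.norm_eq_abs, Real.norm_eq_abs, blockArea, abs_of_nonneg (by positivity)]
  refine le_trans ?_ (le_abs_self _)
  simp only [Pi.add_apply]
  have := mul_le_mul_of_nonneg_left hl hH
  refine mul_le_mul_of_nonneg_left ?_ (sq_nonneg v)
  linarith

/-- The mean area. The waiting time enters through the Laplace transform of the duration of the block,
weighted by the sum of the squares of its hops. -/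
lemma integral_blockArea (hlam : 0 < lam) (hp : 0 < p) (hp1 : p ≤ 1) (hα : 0 < α)
    (hmu : p * lam + α = mu) :
    ∫ q : ℝ × (ℝ × ℝ × ℝ) × ℝ, blockArea v q.1 q.2 ∂((expMeasure α).prod (innovLaw p lam mu)) =
      v ^ 2 * (2 * ((1 - p) / (p ^ 2 * lam ^ 3)) + 2 / (p * lam ^ 3) +
        2 * p * lam / ((lam + α) * mu ^ 2) / α + 2 / (p * lam ^ 2) / mu) := by
  have hmu0 : 0 < mu := by have := mul_pos hp hlam; linarith
  have := isProbabilityMeasure_expMeasure hlam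
  have := isProbabilityMeasure_pollLaw hp hp1
  have := isProbabilityMeasure_blockLaw (p := p) (lam := lam)
  have := isProbabilityMeasure_innovLaw hlam hmu0 hp hp1
  have := isProbabilityMeasure_expMeasure hα
  have := isProbabilityMeasure_expMeasure hmu0
  have iG := integrable_innovLaw_fst hmu0 (integrable_blockLaw_area hlam hp hp1)
  have iE := (integrable_innovLaw_fst hmu0
    (integrable_blockLaw_sq_mul_exp hlam hp hp1 hα.le)).div_const α
  have iS := integrable_innovLaw_mul hmu0 (integrable_blockLaw_sq hlam hp hp1)
    (integrable_pow_expMeasure hmu0 1)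
  rw [integral_prod_symm _
    ((memLp_blockArea hlam hmu0 hp hp1 hα).integrable one_le_two)]
  have h1 : ∀ᵐ z ∂(innovLaw p lam mu), ∫ f, blockArea v f z ∂(expMeasure α) =
      v ^ 2 * (z.1.2.2 + (z.1.2.1 * Real.exp (-(α * z.1.1)) / α + z.1.2.1 * z.2 ^ 1)) := by
    filter_upwards [ae_innovLaw_bounds hlam hmu0 hp hp1] with z hz
    have i1 : Integrable (fun f => max (f - z.1.1) 0) (expMeasure α) := by
      refine (integrable_pow_expMeasure hα 1).mono' (by fun_prop) ?_
      filter_upwards [ae_pos_expMeasure (r := α)] with f hf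
      rw [Real.norm_eq_abs, abs_of_nonneg (le_max_right _ _), pow_one]
      exact max_le (by linarith [hz.1.1]) hf.le
    simp only [blockArea, lindley]
    rw [integral_const_mul, integral_add (integrable_const _)
      ((i1.add (integrable_const _) : Integrable (fun f => _ + _) _).const_mul _),
      integral_const_mul,
      integral_add i1 (integrable_const _), integral_posPart_sub_expMeasure hα hz.1.1.le]
    simp only [integral_const, probReal_univ, smul_eq_mul, one_mul]
    ring
  rw [integral_congr_ae h1, integral_const_mul,
    integral_add iG (iE.add iS : Integrable (fun z => _ + _) _), integral_add iE iS, integral_div]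
  have hfst : ∀ f : ℝ × ℝ × ℝ → ℝ, ∫ z, f z.1 ∂(innovLaw p lam mu) = ∫ z, f z ∂(blockLaw p lam) :=
    fun f => by
      have := integral_prod_mul (μ := blockLaw p lam) (ν := expMeasure mu) f (fun _ => (1 : ℝ))
      simpa [innovLaw] using this
  have hS : ∫ z, z.1.2.1 * z.2 ^ 1 ∂(innovLaw p lam mu) = 2 / (p * lam ^ 2) / mu := by
    have := integral_prod_mul (μ := blockLaw p lam) (ν := expMeasure mu)
      (fun z => z.2.1) (fun s => s ^ 1)
    rw [integral_blockLaw_sq hlam hp hp1, integral_pow_expMeasure hmu0] at this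
    rw [innovLaw, this]
    simp
    ring
  rw [hfst fun z => z.2.2, hfst fun z => z.2.1 * Real.exp (-(α * z.1)), hS,
    integral_blockLaw_area hlam hp hp1, integral_blockLaw_sq_mul_exp hlam hp hp1 hα.le, hmu]
  ring

end Dynamics

/-! ### Long-run averages of the driven queue -/

section Averages

variable {p lam mu α v : ℝ} {E : Type*} [MeasurableSpace E] {D : Measure E}
  [IsProbabilityMeasure D] {z : E → (ℝ × ℝ × ℝ) × ℝ} {σ : E → E}

/-- Regenerating driving randomness: the first block is independent of what follows it, and what
follows it has the original law. -/
abbrev IsRegenerating (p lam mu : ℝ) (D : Measure E) (z : E → (ℝ × ℝ × ℝ) × ℝ) (σ : E → E) : Prop :=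
  MeasurePreserving (fun x => (z x, σ x)) D ((innovLaw p lam mu).prod D)

lemma measurePreserving_shift (hlam : 0 < lam) (hmu : 0 < mu) (hp : 0 < p) (hp1 : p ≤ 1)
    (hD : IsRegenerating p lam mu D z σ) : MeasurePreserving σ D D := by
  have := isProbabilityMeasure_innovLaw hlam hmu hp hp1
  exact measurePreserving_snd.comp hD

lemma measurePreserving_block (hD : IsRegenerating p lam mu D z σ) :
    MeasurePreserving z D (innovLaw p lam mu) :=
  measurePreserving_fst.comp hD

/-- Along almost every orbit the hops and the service times are nonnegative. -/
lemma ae_forall_block (hlam : 0 < lam) (hmu : 0 < mu) (hp : 0 < p) (hp1 : p ≤ 1)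
    (hD : IsRegenerating p lam mu D z σ) :
    ∀ᵐ y ∂D, ∀ k, 0 ≤ (z (σ^[k] y)).1.1 ∧ 0 ≤ (z (σ^[k] y)).1.2.1 ∧ 0 ≤ (z (σ^[k] y)).2 := by
  rw [ae_all_iff]
  intro k
  have h := (measurePreserving_block hD).comp
    ((measurePreserving_shift hlam hmu hp hp1 hD).iterate k)
  filter_upwards [h.quasiMeasurePreserving.ae (ae_innovLaw_bounds hlam hmu hp hp1)] with y hy
  exact ⟨hy.1.1.le, hy.1.2.1, hy.2.le⟩

/-- The state, the first block and the remaining randomness are independent. -/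
lemma measurePreserving_split {ρ : Measure ℝ} [IsProbabilityMeasure ρ] (hlam : 0 < lam)
    (hmu : 0 < mu) (hp : 0 < p) (hp1 : p ≤ 1) (hD : IsRegenerating p lam mu D z σ) :
    MeasurePreserving (fun s : ℝ × E => ((s.1, z s.2), σ s.2)) (ρ.prod D)
      ((ρ.prod (innovLaw p lam mu)).prod D) := by
  have := isProbabilityMeasure_innovLaw hlam hmu hp hp1
  exact (measurePreserving_prodAssoc ρ (innovLaw p lam mu) D).symm.comp
    ((MeasurePreserving.id ρ).prod hD)

lemma measurePreserving_queueStep {ρ : Measure ℝ} [IsProbabilityMeasure ρ] (hlam : 0 < lam)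
    (hmu : 0 < mu) (hp : 0 < p) (hp1 : p ≤ 1) (hD : IsRegenerating p lam mu D z σ)
    (hρ : (ρ.prod (innovLaw p lam mu)).map (fun q => lindley q.1 q.2) = ρ) :
    MeasurePreserving (queueStep z σ) (ρ.prod D) (ρ.prod D) := by
  have := isProbabilityMeasure_innovLaw hlam hmu hp hp1
  have h1 : MeasurePreserving (fun q : ℝ × (ℝ × ℝ × ℝ) × ℝ => lindley q.1 q.2)
      (ρ.prod (innovLaw p lam mu)) ρ := ⟨measurable_lindley, hρ⟩
  exact (h1.prod (MeasurePreserving.id D)).comp (measurePreserving_split hlam hmu hp hp1 hD)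

lemma integrable_split_mul {ρ : Measure ℝ} [IsProbabilityMeasure ρ] (hlam : 0 < lam)
    (hmu : 0 < mu) (hp : 0 < p) (hp1 : p ≤ 1) (hD : IsRegenerating p lam mu D z σ)
    {F : ℝ × (ℝ × ℝ × ℝ) × ℝ → ℝ} {G : E → ℝ} (hF : Integrable F (ρ.prod (innovLaw p lam mu)))
    (hG : Integrable G D) : Integrable (fun s : ℝ × E => F (s.1, z s.2) * G (σ s.2)) (ρ.prod D) :=
  (measurePreserving_split (ρ := ρ) hlam hmu hp hp1 hD).integrable_comp_of_integrable
    (hF.mul_prod hG)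

lemma integral_split_mul {ρ : Measure ℝ} [IsProbabilityMeasure ρ] (hlam : 0 < lam)
    (hmu : 0 < mu) (hp : 0 < p) (hp1 : p ≤ 1) (hD : IsRegenerating p lam mu D z σ)
    {F : ℝ × (ℝ × ℝ × ℝ) × ℝ → ℝ} {G : E → ℝ} (hF : Integrable F (ρ.prod (innovLaw p lam mu)))
    (hG : Integrable G D) :
    ∫ s : ℝ × E, F (s.1, z s.2) * G (σ s.2) ∂(ρ.prod D) =
      (∫ q, F q ∂(ρ.prod (innovLaw p lam mu))) * ∫ y, G y ∂D := by
  have := isProbabilityMeasure_innovLaw hlam hmu hp hp1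
  have h := measurePreserving_split (ρ := ρ) hlam hmu hp hp1 hD
  rw [← integral_prod_mul, ← h.map_eq, integral_map h.measurable.aemeasurable]
  rw [h.map_eq]
  exact (hF.mul_prod hG).aestronglyMeasurable

/-- The mean of the coupling bound decays geometrically. -/
lemma couplingBound_integral (hlam : 0 < lam) (hp : 0 < p) (hp1 : p ≤ 1)
    (hmu : p * lam < mu) (hD : IsRegenerating p lam mu D z σ) {θ : ℝ} (hθ : 0 < θ)
    (hθ1 : θ < mu - p * lam) (k : ℕ) :
    Integrable (couplingBound v θ z σ k) D ∧
      ∫ y, couplingBound v θ z σ k y ∂D =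
        (p * lam / (p * lam + θ) * (mu / (mu - θ))) ^ k * (v ^ 2 * (2 / (p * lam ^ 2))) := by
  have hβ := mul_pos hp hlam
  have hmu0 : 0 < mu := hβ.trans hmu
  have := isProbabilityMeasure_innovLaw hlam hmu0 hp hp1
  have := isProbabilityMeasure_expMeasure hmu0
  have := isProbabilityMeasure_expMeasure hlam
  have := isProbabilityMeasure_pollLaw hp hp1
  have := isProbabilityMeasure_blockLaw (p := p) (lam := lam)
  have hz := measurePreserving_block hD
  induction k with
  | zero =>
    have hi := (integrable_innovLaw_fst hmu0 (integrable_blockLaw_sq hlam hp hp1)).const_mul (v ^ 2)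
    refine ⟨hz.integrable_comp_of_integrable hi, ?_⟩
    have h1 : ∫ y, couplingBound v θ z σ 0 y ∂D =
        ∫ q, v ^ 2 * q.1.2.1 ∂(innovLaw p lam mu) := by
      rw [← hz.map_eq, integral_map hz.measurable.aemeasurable (by rw [hz.map_eq]; exact hi.1)]
      rfl
    have h2 := integral_prod_mul (μ := blockLaw p lam) (ν := expMeasure mu)
      (fun q => q.2.1) (fun _ => (1 : ℝ))
    simp only [mul_one, integral_const, probReal_univ, smul_eq_mul] at h2
    rw [h1, integral_const_mul, innovLaw, h2, integral_blockLaw_sq hlam hp hp1]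
    simp
  | succ k ih =>
    have i1 := integrable_blockLaw_fst hlam hp hp1
      (integrable_exp_expMeasure hβ (s := θ) (by linarith))
    have i2 := integrable_exp_expMeasure hmu0 (s := -θ) (by linarith)
    have hi := integrable_innovLaw_mul hmu0 i1 i2
    have he : ∀ y, couplingBound v θ z σ (k + 1) y =
        (Real.exp (-(θ * (z y).1.1)) * Real.exp (-(-θ * (z y).2))) *
          couplingBound v θ z σ k (σ y) := fun y => by
      rw [couplingBound, ← Real.exp_add]
      congr 2; ring
    have hm := hi.mul_prod ih.1
    have hfun : couplingBound v θ z σ (k + 1) = fun y =>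
        (Real.exp (-(θ * (z y).1.1)) * Real.exp (-(-θ * (z y).2))) *
          couplingBound v θ z σ k (σ y) := funext he
    refine ⟨?_, ?_⟩
    · rw [hfun]
      exact hD.integrable_comp_of_integrable hm
    · have h1 : ∫ y, couplingBound v θ z σ (k + 1) y ∂D =
          ∫ q : ((ℝ × ℝ × ℝ) × ℝ) × E, (Real.exp (-(θ * q.1.1.1)) * Real.exp (-(-θ * q.1.2))) *
            couplingBound v θ z σ k q.2 ∂((innovLaw p lam mu).prod D) := by
        rw [← hD.map_eq, integral_map hD.measurable.aemeasurable (by rw [hD.map_eq]; exact hm.1)]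
        rw [hfun]
      rw [h1, integral_prod_mul (μ := innovLaw p lam mu) (fun q : (ℝ × ℝ × ℝ) × ℝ =>
        Real.exp (-(θ * q.1.1)) * Real.exp (-(-θ * q.2))), ih.2, innovLaw,
        integral_prod_mul (fun q : ℝ × ℝ × ℝ => Real.exp (-(θ * q.1)))
          (fun s : ℝ => Real.exp (-(-θ * s))),
        integral_blockLaw_fst (f := fun x => Real.exp (-(θ * x))) hlam hp hp1
          (Measurable.stronglyMeasurable (by fun_prop)),
        integral_exp_expMeasure hβ (by linarith), integral_exp_expMeasure hmu0 (by linarith)]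
      rw [pow_succ]
      ring

lemma memLp_orbitArea (hlam : 0 < lam) (hmu : 0 < mu) (hp : 0 < p) (hp1 : p ≤ 1) (hα : 0 < α)
    (hD : IsRegenerating p lam mu D z σ) :
    MemLp (orbitArea v z) 2 ((expMeasure α).prod D) := by
  have := isProbabilityMeasure_expMeasure hα
  have := isProbabilityMeasure_innovLaw hlam hmu hp hp1
  exact (memLp_blockArea hlam hmu hp hp1 hα).comp_measurePreserving
    ((MeasurePreserving.id _).prod (measurePreserving_block hD))

lemma integral_orbitArea (hlam : 0 < lam) (hmu : 0 < mu) (hp : 0 < p) (hp1 : p ≤ 1) (hα : 0 < α)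
    (hD : IsRegenerating p lam mu D z σ) :
    ∫ s, orbitArea v z s ∂((expMeasure α).prod D) =
      ∫ q, blockArea v q.1 q.2 ∂((expMeasure α).prod (innovLaw p lam mu)) := by
  have := isProbabilityMeasure_expMeasure hα
  have := isProbabilityMeasure_innovLaw hlam hmu hp hp1
  have h := (MeasurePreserving.id (expMeasure α)).prod (measurePreserving_block hD)
  rw [← h.map_eq, integral_map h.measurable.aemeasurable
    (measurable_blockArea v).aestronglyMeasurable]
  rfl

/-- The correlations of the areas decay geometrically: the influence of the initial system time is
controlled by a coupling with an independent stationary queue. -/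
lemma orbitArea_covariance_le (hlam : 0 < lam) (hp : 0 < p) (hp1 : p ≤ 1) (hα : 0 < α)
    (hmu : p * lam + α = mu) (hD : IsRegenerating p lam mu D z σ)
    (hρ : ((expMeasure α).prod (innovLaw p lam mu)).map (fun q => lindley q.1 q.2) =
      expMeasure α) :
    ∃ C r : ℝ, 0 ≤ C ∧ 0 ≤ r ∧ r < 1 ∧ ∀ k,
      ∫ s, orbitArea v z s * orbitArea v z ((queueStep z σ)^[k + 1] s) ∂((expMeasure α).prod D) ≤
        (∫ s, orbitArea v z s ∂((expMeasure α).prod D)) ^ 2 + C * r ^ k := by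
  have hβ := mul_pos hp hlam
  have hmu0 : 0 < mu := by linarith
  have := isProbabilityMeasure_expMeasure hα
  have := isProbabilityMeasure_innovLaw hlam hmu0 hp hp1
  set π := (expMeasure α).prod D with hπ
  set W := innovLaw p lam mu with hW
  obtain ⟨θ, hθ, hθα⟩ : ∃ θ : ℝ, 0 < θ ∧ 2 * θ < α := ⟨α / 4, by linarith, by linarith⟩
  have hT := measurePreserving_queueStep hlam hmu0 hp hp1 hD hρ
  have hq := memLp_orbitArea (v := v) hlam hmu0 hp hp1 hα hD
  have hQ := memLp_blockArea (v := v) hlam hmu0 hp hp1 hα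
  -- exponential moment of the next system time, of order `θ < α / 2`
  have hexp : MemLp (fun q : ℝ × (ℝ × ℝ × ℝ) × ℝ => Real.exp (θ * lindley q.1 q.2)) 2
      ((expMeasure α).prod W) := by
    have h1 : MemLp (fun f : ℝ => Real.exp (θ * f)) 2 (expMeasure α) := by
      rw [memLp_two_iff_integrable_sq (by fun_prop)]
      refine (integrable_exp_expMeasure hα (s := -(2 * θ)) (by linarith)).congr
        (Eventually.of_forall fun f => ?_)
      simp only
      rw [← Real.exp_nat_mul]
      congr 1; push_cast; ring
    exact h1.comp_measurePreserving (f := fun q : ℝ × (ℝ × ℝ × ℝ) × ℝ => lindley q.1 q.2)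
      ⟨measurable_lindley, hρ⟩
  have hQe := hQ.integrable_mul hexp
  set F : ℝ × (ℝ × ℝ × ℝ) × ℝ → ℝ := fun q =>
    blockArea v q.1 q.2 * Real.exp (θ * lindley q.1 q.2) / θ
  have hF : Integrable F ((expMeasure α).prod W) := hQe.div_const θ
  have hQ0 : ∀ᵐ q ∂((expMeasure α).prod W), 0 ≤ blockArea v q.1 q.2 := by
    filter_upwards [Measure.quasiMeasurePreserving_snd.ae (ae_innovLaw_bounds hlam hmu0 hp hp1)]
      with q h2
    obtain ⟨⟨hX, hH, hG, -⟩, hS⟩ := h2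
    unfold blockArea lindley
    positivity
  set r := p * lam / (p * lam + θ) * (mu / (mu - θ)) with hr
  have hr0 : 0 ≤ r := by
    have : 0 < mu - θ := by linarith
    positivity
  have hr1 : r < 1 := by
    have : 0 < mu - θ := by linarith
    rw [hr, div_mul_div_comm, div_lt_one (by positivity)]
    nlinarith
  refine ⟨(∫ q, F q ∂((expMeasure α).prod W)) * (v ^ 2 * (2 / (p * lam ^ 2))), r, ?_, hr0, hr1,
    fun k => ?_⟩
  · refine mul_nonneg (integral_nonneg_of_ae ?_) (by positivity)
    filter_upwards [hQ0] with q hq0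
    exact div_nonneg (mul_nonneg hq0 (Real.exp_pos _).le) hθ.le
  obtain ⟨hBi, hB⟩ := couplingBound_integral (v := v) hlam hp hp1 (by linarith) hD hθ
    (by linarith) k
  have hqk : Integrable (fun s => orbitArea v z ((queueStep z σ)^[k] s)) π :=
    (hq.comp_measurePreserving (hT.iterate k)).integrable one_le_two
  set A : E → ℝ := fun y => ∫ f, orbitArea v z ((queueStep z σ)^[k] (f, y)) ∂(expMeasure α) with hA
  have hAi : Integrable A D := hqk.integral_prod_right
  have hAint : ∫ y, A y ∂D = ∫ s, orbitArea v z s ∂π := by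
    rw [hA, ← integral_prod_symm _ hqk]
    have h := hT.iterate k
    conv_rhs => rw [hπ, ← h.map_eq]
    rw [integral_map h.measurable.aemeasurable (by rw [h.map_eq]; exact hq.1)]
  -- comparison with the stationary queue, for almost every driving randomness
  have hcmp : ∀ᵐ y ∂D, ∀ f, orbitArea v z ((queueStep z σ)^[k] (f, y)) ≤
      A y + Real.exp (θ * f) * couplingBound v θ z σ k y / θ := by
    filter_upwards [ae_forall_block hlam hmu0 hp hp1 hD, hqk.prod_left_ae] with y hy hyi f
    have h1 : ∫ _ : ℝ, orbitArea v z ((queueStep z σ)^[k] (f, y)) ∂(expMeasure α) ≤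
        ∫ f₀, (orbitArea v z ((queueStep z σ)^[k] (f₀, y)) +
          Real.exp (θ * f) * couplingBound v θ z σ k y / θ) ∂(expMeasure α) := by
      refine integral_mono_ae (integrable_const _) (hyi.add (integrable_const _)) ?_
      filter_upwards [ae_pos_expMeasure (r := α)] with f₀ hf₀
      exact orbitArea_iterate_le hθ k hy hf₀.le (le_max_right _ _)
    rw [integral_add hyi (integrable_const _)] at h1
    simpa using h1
  have hσ := measurePreserving_shift hlam hmu0 hp hp1 hD
  calc ∫ s, orbitArea v z s * orbitArea v z ((queueStep z σ)^[k + 1] s) ∂π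
      ≤ ∫ s, (blockArea v s.1 (z s.2) * A (σ s.2) +
          F (s.1, z s.2) * couplingBound v θ z σ k (σ s.2)) ∂π := by
        refine integral_mono_ae (hq.integrable_mul (hq.comp_measurePreserving (hT.iterate (k + 1))))
          ((integrable_split_mul hlam hmu0 hp hp1 hD (hQ.integrable one_le_two) hAi).add
            (integrable_split_mul hlam hmu0 hp hp1 hD hF hBi)) ?_
        have h1 := (MeasurePreserving.id (expMeasure α)).prod
          (measurePreserving_block hD) |>.quasiMeasurePreserving.ae hQ0
        have h2 := (Measure.quasiMeasurePreserving_snd (μ := expMeasure α) (ν := D)).ae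
          (hσ.quasiMeasurePreserving.ae hcmp)
        filter_upwards [h1, h2] with s h1 h2
        have h3 := mul_le_mul_of_nonneg_left (h2 (lindley s.1 (z s.2))) h1
        simp only [Prod.map, id] at h3
        refine h3.trans_eq ?_
        simp only [F]
        ring
    _ = (∫ s, orbitArea v z s ∂π) * (∫ s, orbitArea v z s ∂π) +
          (∫ q, F q ∂((expMeasure α).prod W)) *
            (r ^ k * (v ^ 2 * (2 / (p * lam ^ 2)))) := by
        rw [integral_add (integrable_split_mul hlam hmu0 hp hp1 hD (hQ.integrable one_le_two) hAi)
          (integrable_split_mul hlam hmu0 hp hp1 hD hF hBi),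
          integral_split_mul hlam hmu0 hp hp1 hD (hQ.integrable one_le_two) hAi,
          integral_split_mul hlam hmu0 hp hp1 hD hF hBi, hAint, hB,
          ← integral_orbitArea hlam hmu0 hp hp1 hα hD]
    _ = _ := by ring

/-- The long-run average of the areas is their mean. -/
theorem ae_tendsto_average_orbitArea (hlam : 0 < lam) (hp : 0 < p) (hp1 : p ≤ 1) (hα : 0 < α)
    (hmu : p * lam + α = mu) (hD : IsRegenerating p lam mu D z σ)
    (hρ : ((expMeasure α).prod (innovLaw p lam mu)).map (fun q => lindley q.1 q.2) =
      expMeasure α) :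
    ∀ᵐ s ∂((expMeasure α).prod D), Tendsto (fun n : ℕ =>
      (∑ i ∈ Finset.range n, orbitArea v z ((queueStep z σ)^[i] s)) / n) atTop
      (𝓝 (∫ s, orbitArea v z s ∂((expMeasure α).prod D))) := by
  have hβ := mul_pos hp hlam
  have hmu0 : 0 < mu := by linarith
  have := isProbabilityMeasure_expMeasure hα
  obtain ⟨C, r, hC, hr0, hr1, hcov⟩ :=
    orbitArea_covariance_le (v := v) hlam hp hp1 hα hmu hD hρ
  refine ae_tendsto_average_iterate (measurePreserving_queueStep hlam hmu0 hp hp1 hD hρ)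
    (memLp_orbitArea hlam hmu0 hp hp1 hα hD) ?_ hC hr0 hr1 hcov
  have h : ∀ᵐ s ∂((expMeasure α).prod D), (0 < (z s.2).1.1 ∧ 0 ≤ (z s.2).1.2.1 ∧
      0 ≤ (z s.2).1.2.2 ∧ (z s.2).1.2.1 ≤ (z s.2).1.1 ^ 2 ∧ (z s.2).1.2.2 ≤ (z s.2).1.1 ^ 3) ∧
      0 < (z s.2).2 :=
    Measure.quasiMeasurePreserving_snd.ae ((measurePreserving_block hD).quasiMeasurePreserving.ae
      (ae_innovLaw_bounds hlam hmu0 hp hp1))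
  filter_upwards [h] with s hs
  obtain ⟨⟨hX, hH, hG, -⟩, hS⟩ := hs
  unfold orbitArea blockArea lindley
  positivity

/-- The long-run average of the block durations is their mean. -/
theorem ae_tendsto_average_duration (hlam : 0 < lam) (hmu : 0 < mu) (hp : 0 < p) (hp1 : p ≤ 1)
    (hD : IsRegenerating p lam mu D z σ) :
    ∀ᵐ y ∂D, Tendsto (fun n : ℕ => (∑ i ∈ Finset.range n, (z (σ^[i] y)).1.1) / n) atTop
      (𝓝 (p * lam)⁻¹) := by
  have hβ := mul_pos hp hlam
  have := isProbabilityMeasure_innovLaw hlam hmu hp hp1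
  have := isProbabilityMeasure_expMeasure hmu
  have := isProbabilityMeasure_expMeasure hlam
  have := isProbabilityMeasure_pollLaw hp hp1
  have := isProbabilityMeasure_blockLaw (p := p) (lam := lam)
  have hz := measurePreserving_block hD
  have hσ := measurePreserving_shift hlam hmu hp hp1 hD
  have hX : MemLp (fun q : (ℝ × ℝ × ℝ) × ℝ => q.1.1) 2 (innovLaw p lam mu) := by
    rw [memLp_two_iff_integrable_sq (Measurable.aestronglyMeasurable (by fun_prop))]
    exact integrable_innovLaw_fst hmu
      (integrable_blockLaw_fst hlam hp hp1 (integrable_pow_expMeasure hβ 2))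
  have hq : MemLp (fun y => (z y).1.1) 2 D := hX.comp_measurePreserving hz
  have hmean : ∫ q, q.1.1 ∂(innovLaw p lam mu) = (p * lam)⁻¹ := by
    have h := integral_prod_mul (μ := blockLaw p lam) (ν := expMeasure mu)
      (fun q => q.1) (fun _ => (1 : ℝ))
    rw [integral_blockLaw_fst (f := fun x : ℝ => x) hlam hp hp1 stronglyMeasurable_id] at h
    have h1 := integral_pow_expMeasure hβ 1
    simp only [pow_one, Nat.factorial_one, Nat.cast_one, one_div] at h1
    rw [h1] at h
    simpa [innovLaw] using h
  have hmean' : ∫ y, (z y).1.1 ∂D = (p * lam)⁻¹ := by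
    rw [← hmean, ← hz.map_eq, integral_map hz.measurable.aemeasurable
      (Measurable.aestronglyMeasurable (by fun_prop))]
  rw [← hmean']
  refine ae_tendsto_average_iterate (C := 0) (r := 0) hσ hq ?_ le_rfl le_rfl one_pos fun k => ?_
  · filter_upwards [ae_forall_block hlam hmu hp hp1 hD] with y hy
    exact (hy 0).1
  · have hk : MemLp (fun y => (z (σ^[k] y)).1.1) 2 D := hq.comp_measurePreserving (hσ.iterate k)
    have hint := hk.integrable one_le_two
    have hm := (hX.integrable one_le_two).mul_prod hint
    have h1 : ∫ y, (z y).1.1 * (z (σ^[k + 1] y)).1.1 ∂D =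
        ∫ q : ((ℝ × ℝ × ℝ) × ℝ) × E, q.1.1.1 * (z (σ^[k] q.2)).1.1
          ∂((innovLaw p lam mu).prod D) := by
      rw [← hD.map_eq, integral_map hD.measurable.aemeasurable (by rw [hD.map_eq]; exact hm.1)]
      rfl
    have h2 : ∫ y, (z (σ^[k] y)).1.1 ∂D = (p * lam)⁻¹ := by
      rw [← hmean']
      have h := hσ.iterate k
      conv_rhs => rw [← h.map_eq]
      rw [integral_map h.measurable.aemeasurable (by rw [h.map_eq]; exact hq.1)]
    rw [h1, integral_prod_mul (μ := innovLaw p lam mu) (fun q : (ℝ × ℝ × ℝ) × ℝ => q.1.1)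
      (fun y => (z (σ^[k] y)).1.1), hmean, h2, hmean']
    exact (by ring : _ = _).le

/-- The system times grow more slowly than the cube root of their index. -/
theorem ae_tendsto_systemTime_pow_div (hlam : 0 < lam) (hmu : 0 < mu) (hp : 0 < p) (hp1 : p ≤ 1)
    (hα : 0 < α) (hD : IsRegenerating p lam mu D z σ)
    (hρ : ((expMeasure α).prod (innovLaw p lam mu)).map (fun q => lindley q.1 q.2) =
      expMeasure α) :
    ∀ᵐ s ∂((expMeasure α).prod D), Tendsto (fun n : ℕ =>
      ((queueStep z σ)^[n] s).1 ^ 3 / n) atTop (𝓝 0) := by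
  have := isProbabilityMeasure_expMeasure hα
  refine ae_tendsto_iterate_div (q := fun s : ℝ × E => s.1 ^ 3)
    (measurePreserving_queueStep hlam hmu hp hp1 hD hρ) ?_
  have h : MemLp (fun f : ℝ => f ^ 3) 2 (expMeasure α) := by
    rw [memLp_two_iff_integrable_sq (by fun_prop)]
    simp_rw [← pow_mul]
    exact integrable_pow_expMeasure hα _
  exact h.comp_measurePreserving measurePreserving_fst

end Averages

/-! ### The timing as an orbit of the driven queue -/

lemma dropSeq_dropSeq {α : Type*} (m n : ℕ) (f : ℕ → α) :
    dropSeq m (dropSeq n f) = dropSeq (n + m) f := by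
  funext k; simp only [dropSeq, add_assoc]

/-- The law of the hop durations, the polling indicators and the service times. -/
def drivingLaw (p lam mu : ℝ) : Measure (((ℕ → ℝ) × (ℕ → Bool)) × (ℕ → ℝ)) :=
  (hopPollLaw p lam).prod (iidLaw (expMeasure mu))

/-- The block of hops up to the next polled update, and the service time of that update. -/
def drivingBlock (x : ((ℕ → ℝ) × (ℕ → Bool)) × (ℕ → ℝ)) : (ℝ × ℝ × ℝ) × ℝ :=
  (blockStats x.1, x.2 0)

/-- The randomness that remains after the next polled update. -/
def drivingShift (x : ((ℕ → ℝ) × (ℕ → Bool)) × (ℕ → ℝ)) : ((ℕ → ℝ) × (ℕ → Bool)) × (ℕ → ℝ) :=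
  (nextBlock x.1, dropSeq 1 x.2)

section DrivingLaw

variable {p lam mu : ℝ}

lemma isProbabilityMeasure_drivingLaw (hlam : 0 < lam) (hmu : 0 < mu) (hp : 0 < p) (hp1 : p ≤ 1) :
    IsProbabilityMeasure (drivingLaw p lam mu) := by
  have := isProbabilityMeasure_expMeasure hlam
  have := isProbabilityMeasure_expMeasure hmu
  have := isProbabilityMeasure_pollLaw hp hp1
  rw [drivingLaw]
  infer_instance

/-- The polled updates are regeneration times. -/
lemma isRegenerating_drivingLaw (hlam : 0 < lam) (hmu : 0 < mu) (hp : 0 < p) (hp1 : p ≤ 1) :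
    IsRegenerating p lam mu (drivingLaw p lam mu) drivingBlock drivingShift := by
  have := isProbabilityMeasure_expMeasure hlam
  have := isProbabilityMeasure_expMeasure hmu
  have := isProbabilityMeasure_pollLaw hp hp1
  have := isProbabilityMeasure_blockLaw (p := p) (lam := lam)
  have h1 : MeasurePreserving (fun x => (blockStats x, nextBlock x)) (hopPollLaw p lam)
      ((blockLaw p lam).prod (hopPollLaw p lam)) :=
    ⟨measurable_blockStats.prodMk measurable_nextBlock, map_blockStats_nextBlock hp hp1⟩
  have h2 : MeasurePreserving (fun x : ℕ → ℝ => (x 0, dropSeq 1 x)) (iidLaw (expMeasure mu))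
      ((expMeasure mu).prod (iidLaw (expMeasure mu))) :=
    ⟨(measurable_pi_apply 0).prodMk (measurable_dropSeq 1), map_head_tail_iidLaw _⟩
  exact (measurePreserving_prodProdProdComm _ _ _ _).comp (h1.prod h2)

end DrivingLaw

namespace Timing

/-- The randomness that drives the queue from time `0` on. Update `0` is polled in any case, whence
the shift of the polling indicators and of the service times. -/
def driving (τ : Timing) : ((ℕ → ℝ) × (ℕ → Bool)) × (ℕ → ℝ) :=
  ((τ.hop, fun n => τ.poll (n + 1)), fun i => τ.service (i + 1))

variable {τ : Timing}

lemma updateHop_succ (hp : {n | τ.poll n = true}.Infinite) (i : ℕ) :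
    τ.updateHop (i + 1) =
      τ.updateHop i + blockLen (dropSeq (τ.updateHop i) fun n => τ.poll (n + 1)) := by
  have hinf : (Set.ofPred fun n => n = 0 ∨ τ.poll n = true).Infinite :=
    hp.mono fun _ h => Or.inr h
  have hlt : τ.updateHop i < τ.updateHop (i + 1) := Nat.nth_strictMono hinf i.lt_succ_self
  obtain ⟨l, hl⟩ : ∃ l, τ.updateHop (i + 1) = τ.updateHop i + (l + 1) :=
    ⟨τ.updateHop (i + 1) - τ.updateHop i - 1, by omega⟩
  rw [hl, blockLen_of_mem_firstPolled (l := l)]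
  constructor
  · have h := Nat.nth_mem_of_infinite hinf (i + 1)
    rw [← updateHop, hl] at h
    exact h.resolve_left (by omega)
  · intro k hk
    by_contra hne
    have h : τ.updateHop i + (k + 1) ≤ τ.updateHop i :=
      Nat.le_nth_of_lt_nth_succ (p := fun n => n = 0 ∨ τ.poll n = true)
        (by rw [← updateHop, hl]; omega)
        (Or.inr (by simpa [dropSeq, add_assoc] using hne))
    omega

lemma iterate_drivingShift (hp : {n | τ.poll n = true}.Infinite) (i : ℕ) :
    drivingShift^[i] τ.driving =
      ((dropSeq (τ.updateHop i) τ.hop, dropSeq (τ.updateHop i) fun n => τ.poll (n + 1)),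
        dropSeq i fun n => τ.service (n + 1)) := by
  induction i with
  | zero =>
    rw [updateHop_zero]
    simp only [Function.iterate_zero, id, driving]
    congr <;> funext k <;> simp [dropSeq]
  | succ i ih =>
    rw [Function.iterate_succ_apply', ih, updateHop_succ hp]
    simp only [drivingShift, nextBlock, dropSeq_dropSeq]

lemma drivingBlock_iterate_duration (hp : {n | τ.poll n = true}.Infinite) (i : ℕ) :
    (drivingBlock (drivingShift^[i] τ.driving)).1.1 =
      τ.updateInstant (i + 1) - τ.updateInstant i := by
  rw [iterate_drivingShift hp, updateInstant, updateInstant, updateHop_succ hp, hopInstant,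
    Finset.sum_range_add, hopInstant, add_sub_cancel_left]
  rfl

lemma updateInstant_eq_sum (hp : {n | τ.poll n = true}.Infinite) (n : ℕ) :
    τ.updateInstant n =
      ∑ i ∈ Finset.range n, (drivingBlock (drivingShift^[i] τ.driving)).1.1 := by
  simp_rw [drivingBlock_iterate_duration hp]
  rw [Finset.sum_range_sub, updateInstant_zero, sub_zero]

/-- The system times follow Lindley's recursion along the driving randomness. -/
lemma iterate_queueStep (hp : {n | τ.poll n = true}.Infinite) (i : ℕ) :
    (queueStep drivingBlock drivingShift)^[i] (τ.first, τ.driving) =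
      (τ.sysTime i, drivingShift^[i] τ.driving) := by
  induction i with
  | zero => simp [sysTime, departure, updateInstant_zero]
  | succ i ih =>
    rw [Function.iterate_succ_apply', ih, queueStep, Function.iterate_succ_apply']
    refine Prod.ext ?_ rfl
    simp only [lindley, drivingBlock_iterate_duration hp]
    rw [sysTime, sysTime, departure, iterate_drivingShift hp]
    simp only [drivingBlock, dropSeq, add_zero]
    rw [add_sub_right_comm, ← max_sub_sub_right, sub_self]
    congr 2; ring

lemma areas_eq_orbitArea (hp : {n | τ.poll n = true}.Infinite) (v : ℝ) (i : ℕ) :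
    τ.areaG1 v i + τ.areaG2 v i + τ.areaG3 v i =
      orbitArea v drivingBlock
        ((queueStep drivingBlock drivingShift)^[i] (τ.first, τ.driving)) := by
  have hT : lindley (τ.sysTime i) (drivingBlock (drivingShift^[i] τ.driving)) =
      τ.sysTime (i + 1) := by
    have h := iterate_queueStep hp (i + 1)
    rw [Function.iterate_succ_apply', iterate_queueStep hp] at h
    exact congrArg Prod.fst h
  rw [iterate_queueStep hp, orbitArea, blockArea, hT, iterate_drivingShift hp, areaG1, areaG2,
    areaG3, hopsBetween, updateHop_succ hp]
  simp only [Finset.sum_Ico_eq_sum_range, add_tsub_cancel_left, drivingBlock, blockStats, hopStats,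
    Finset.sum_add_distrib, ← Finset.mul_sum, ← Finset.sum_div]
  simp only [dropSeq]
  have h2 : ∀ j, τ.hop (τ.updateHop i + j) *
      (v ^ 2 * ∑ l ∈ Finset.range j, τ.hop (τ.updateHop i + l) ^ 2) =
      v ^ 2 * (τ.hop (τ.updateHop i + j) *
        ∑ l ∈ Finset.range j, τ.hop (τ.updateHop i + l) ^ 2) := fun j => by ring
  simp_rw [h2, ← Finset.mul_sum]
  ring

end Timing

namespace IsStationaryMM1

variable {Ω : Type*} [MeasurableSpace Ω] {P : Measure Ω}
  {lam mu p : ℝ} {τ : Ω → Timing}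

lemma aemeasurable_first (hτ : IsStationaryMM1 P lam mu p τ) :
    AEMeasurable (fun ω => (τ ω).first) P := by
  refine (hτ.stationary 0).aemeasurable_fst.congr (Eventually.of_forall fun ω => ?_)
  simp [Timing.sysTime, Timing.departure, Timing.updateInstant_zero]

lemma aemeasurable_driving (hτ : IsStationaryMM1 P lam mu p τ) :
    AEMeasurable (fun ω => (τ ω).driving) P :=
  ((aemeasurable_pi_iff.2 fun n => (hτ.hop_law n).aemeasurable).prodMk
    (aemeasurable_pi_iff.2 fun n => (hτ.poll_meas (n + 1)).aemeasurable)).prodMk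
    (aemeasurable_pi_iff.2 fun n => (hτ.service_law (n + 1)).aemeasurable)

variable [IsProbabilityMeasure P]

lemma map_poll (hτ : IsStationaryMM1 P lam mu p τ) (hp : 0 < p) (n : ℕ) :
    P.map (fun ω => (τ ω).poll n) = pollLaw p := by
  have h1 : P ((fun ω => (τ ω).poll n) ⁻¹' {true}) = ENNReal.ofReal p := hτ.poll_law n
  refine Measure.ext_of_singleton fun b => ?_
  rw [Measure.map_apply (hτ.poll_meas n) (measurableSet_singleton b)]
  cases b with
  | true => rw [h1]; simp [pollLaw]
  | false =>
    have h2 : (fun ω => (τ ω).poll n) ⁻¹' {false} = ((fun ω => (τ ω).poll n) ⁻¹' {true})ᶜ := by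
      ext ω; simp
    rw [h2, prob_compl_eq_one_sub (hτ.poll_meas n (measurableSet_singleton true)), h1,
      ← ENNReal.ofReal_one, ← ENNReal.ofReal_sub _ hp.le]
    simp [pollLaw]

lemma map_driving (hτ : IsStationaryMM1 P lam mu p τ) (hlam : 0 < lam) (hmu : 0 < mu) (hp : 0 < p)
    (hp1 : p ≤ 1) : P.map (fun ω => (τ ω).driving) = drivingLaw p lam mu := by
  have := isProbabilityMeasure_expMeasure hlam
  have := isProbabilityMeasure_expMeasure hmu
  have := isProbabilityMeasure_pollLaw hp hp1
  have mh : AEMeasurable (fun ω => (τ ω).hop) P :=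
    aemeasurable_pi_iff.2 fun n => (hτ.hop_law n).aemeasurable
  have mb : AEMeasurable (fun ω n => (τ ω).poll (n + 1)) P :=
    aemeasurable_pi_iff.2 fun n => (hτ.poll_meas (n + 1)).aemeasurable
  have ms : AEMeasurable (fun ω i => (τ ω).service (i + 1)) P :=
    aemeasurable_pi_iff.2 fun n => (hτ.service_law (n + 1)).aemeasurable
  have lh : P.map (fun ω => (τ ω).hop) = iidLaw (expMeasure lam) := by
    have h := hτ.hop_indep.map_fun_eq_infinitePi_map₀' fun n => (hτ.hop_law n).aemeasurable
    simp_rw [fun n => (hτ.hop_law n).map_eq] at h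
    exact h
  have lb : P.map (fun ω n => (τ ω).poll (n + 1)) = iidLaw (pollLaw p) := by
    have h := (hτ.poll_indep.precomp (add_left_injective 1)).map_fun_eq_infinitePi_map₀'
      fun n => (hτ.poll_meas (n + 1)).aemeasurable
    simp_rw [hτ.map_poll hp] at h
    exact h
  have ls : P.map (fun ω i => (τ ω).service (i + 1)) = iidLaw (expMeasure mu) := by
    have h := (hτ.service_indep.precomp (add_left_injective 1)).map_fun_eq_infinitePi_map₀'
      fun n => (hτ.service_law (n + 1)).aemeasurable
    simp_rw [fun n => (hτ.service_law n).map_eq] at h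
    exact h
  have msh : ∀ {α : Type} [MeasurableSpace α],
      Measurable fun (b : ℕ → α) (n : ℕ) => b (n + 1) := fun {α} _ =>
    measurable_pi_lambda _ fun n => measurable_pi_apply (n + 1)
  have i1 : IndepFun (fun ω n => (τ ω).poll (n + 1)) (fun ω i => (τ ω).service (i + 1)) P :=
    hτ.indep_poll.comp msh msh
  have i2 : IndepFun (fun ω => (τ ω).hop)
      (fun ω => ((fun n => (τ ω).poll (n + 1)), fun i => (τ ω).service (i + 1))) P :=
    hτ.indep_hop.comp measurable_id
      ((msh.comp measurable_fst).prodMk (msh.comp measurable_snd))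
  have e1 := i1.map_prod_eq_prod_map_map mb ms
  have e2 := i2.map_prod_eq_prod_map_map mh (mb.prodMk ms)
  rw [e1, lh, lb, ls] at e2
  have h := (measurePreserving_prodAssoc (iidLaw (expMeasure lam)) (iidLaw (pollLaw p))
    (iidLaw (expMeasure mu))).symm
  have h2 := h.map_eq
  rw [← e2, AEMeasurable.map_map_of_aemeasurable h.measurable.aemeasurable
    (mh.prodMk (mb.prodMk ms))] at h2
  exact h2

/-- The initial system time is independent of the driving randomness. -/
lemma map_first_driving (hτ : IsStationaryMM1 P lam mu p τ) (hlam : 0 < lam) (hmu : 0 < mu)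
    (hp : 0 < p) (hp1 : p ≤ 1) :
    P.map (fun ω => ((τ ω).first, (τ ω).driving)) =
      (P.map fun ω => (τ ω).first).prod (drivingLaw p lam mu) := by
  have msh : ∀ {α : Type} [MeasurableSpace α],
      Measurable fun (b : ℕ → α) (n : ℕ) => b (n + 1) := fun {α} _ =>
    measurable_pi_lambda _ fun n => measurable_pi_apply (n + 1)
  have i : IndepFun (fun ω => (τ ω).first) (fun ω => (τ ω).driving) P :=
    hτ.indep_first.comp measurable_id
      (ψ := fun x : (ℕ → ℝ) × (ℕ → Bool) × (ℕ → ℝ) =>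
        ((x.1, fun n => x.2.1 (n + 1)), fun n => x.2.2 (n + 1)))
      ((measurable_fst.prodMk (msh.comp (measurable_fst.comp measurable_snd))).prodMk
        (msh.comp (measurable_snd.comp measurable_snd)))
  rw [i.map_prod_eq_prod_map_map hτ.aemeasurable_first hτ.aemeasurable_driving,
    hτ.map_driving hlam hmu hp hp1]

lemma ae_poll_infinite (hτ : IsStationaryMM1 P lam mu p τ) (hlam : 0 < lam) (hmu : 0 < mu)
    (hp : 0 < p) (hp1 : p ≤ 1) : ∀ᵐ ω ∂P, {n | (τ ω).poll n = true}.Infinite := by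
  have := isProbabilityMeasure_expMeasure hlam
  have := isProbabilityMeasure_expMeasure hmu
  have := isProbabilityMeasure_pollLaw hp hp1
  have h1 : ∀ᵐ b ∂(iidLaw (pollLaw p)), ∀ n, ∃ k, dropSeq n b k = true := by
    rw [ae_all_iff]
    intro n
    have h := ae_exists_polled hp hp1
    rw [← map_dropSeq_iidLaw (pollLaw p) n] at h
    exact ae_of_ae_map (measurable_dropSeq n).aemeasurable h
  have h2 : ∀ᵐ x ∂(drivingLaw p lam mu), ∀ n, ∃ k, dropSeq n x.1.2 k = true :=
    Measure.quasiMeasurePreserving_fst.ae (Measure.quasiMeasurePreserving_snd.ae h1)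
  rw [← hτ.map_driving hlam hmu hp hp1] at h2
  filter_upwards [ae_of_ae_map hτ.aemeasurable_driving h2] with ω hω
  refine Set.infinite_of_forall_exists_gt fun n => ?_
  obtain ⟨k, hk⟩ := hω n
  exact ⟨n + k + 1, hk, by omega⟩

/-- The law of the initial system time: it is invariant under Lindley's recursion, because the system
times of the updates `0` and `1` have the same law. -/
theorem map_first (hτ : IsStationaryMM1 P lam mu p τ) (hlam : 0 < lam) (hp : 0 < p) (hp1 : p ≤ 1)
    (hstab : p * lam < mu) :
    P.map (fun ω => (τ ω).first) = expMeasure (mu - p * lam) ∧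
      ((expMeasure (mu - p * lam)).prod (innovLaw p lam mu)).map (fun q => lindley q.1 q.2) =
        expMeasure (mu - p * lam) := by
  have hmu : 0 < mu := (mul_pos hp hlam).trans hstab
  have := isProbabilityMeasure_drivingLaw hlam hmu hp hp1
  have := isProbabilityMeasure_innovLaw hlam hmu hp hp1
  have : IsProbabilityMeasure (P.map fun ω => (τ ω).first) :=
    Measure.isProbabilityMeasure_map hτ.aemeasurable_first
  have hD := isRegenerating_drivingLaw hlam hmu hp hp1
  have h0 : ∀ ω, (τ ω).sysTime 0 = (τ ω).first := fun ω => by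
    simp [Timing.sysTime, Timing.departure, Timing.updateInstant_zero]
  have hinv : ((P.map fun ω => (τ ω).first).prod (innovLaw p lam mu)).map
      (fun q => lindley q.1 q.2) = P.map fun ω => (τ ω).first := by
    have hpr := (MeasurePreserving.id (P.map fun ω => (τ ω).first)).prod
      (measurePreserving_block hD)
    have hf := hτ.aemeasurable_first.prodMk hτ.aemeasurable_driving
    have h1 := (hτ.stationary 1).map_eq
    simp_rw [h0] at h1
    refine Eq.trans ?_ h1
    rw [← hpr.map_eq, Measure.map_map measurable_lindley hpr.measurable,
      ← hτ.map_first_driving hlam hmu hp hp1, AEMeasurable.map_map_of_aemeasurable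
        (measurable_lindley.comp hpr.measurable).aemeasurable hf]
    refine Measure.map_congr ?_
    filter_upwards [hτ.ae_poll_infinite hlam hmu hp hp1] with ω hω
    exact congrArg Prod.fst (Timing.iterate_queueStep hω 1)
  have h := eq_expMeasure_of_map_lindley hlam hp hp1 hstab hinv
  exact ⟨h, h ▸ hinv⟩

end IsStationaryMM1

/-! ### The age of positioning -/

namespace IsStationaryMM1

variable {Ω : Type*} [MeasurableSpace Ω] {P : Measure Ω} [IsProbabilityMeasure P]
  {lam mu p : ℝ} {τ : Ω → Timing}

/-- Polled updates are generated at rate `p * lam`. -/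
lemma ae_tendsto_updateInstant_div (hτ : IsStationaryMM1 P lam mu p τ) (hlam : 0 < lam)
    (hmu : 0 < mu) (hp : 0 < p) (hp1 : p ≤ 1) :
    ∀ᵐ ω ∂P, Tendsto (fun n : ℕ => (τ ω).updateInstant n / n) atTop (𝓝 (p * lam)⁻¹) := by
  have := isProbabilityMeasure_drivingLaw hlam hmu hp hp1
  have h := ae_tendsto_average_duration hlam hmu hp hp1
    (isRegenerating_drivingLaw hlam hmu hp hp1)
  rw [← hτ.map_driving hlam hmu hp hp1] at h
  filter_upwards [hτ.ae_poll_infinite hlam hmu hp hp1,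
    ae_of_ae_map hτ.aemeasurable_driving h] with ω h1 h2
  simpa only [Timing.updateInstant_eq_sum h1] using h2

lemma ae_isRegular (hτ : IsStationaryMM1 P lam mu p τ) (hlam : 0 < lam) (hp : 0 < p)
    (hp1 : p ≤ 1) (hstab : p * lam < mu) : ∀ᵐ ω ∂P, (τ ω).IsRegular := by
  have hmu : 0 < mu := (mul_pos hp hlam).trans hstab
  have h1 : ∀ᵐ ω ∂P, ∀ n, 0 < (τ ω).hop n := ae_all_iff.2 fun n =>
    ae_of_ae_map (hτ.hop_law n).aemeasurable ((hτ.hop_law n).map_eq ▸ ae_pos_expMeasure)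
  have h2 : ∀ᵐ ω ∂P, ∀ n, 0 < (τ ω).service n := ae_all_iff.2 fun n =>
    ae_of_ae_map (hτ.service_law n).aemeasurable ((hτ.service_law n).map_eq ▸ ae_pos_expMeasure)
  have h3 : ∀ᵐ ω ∂P, 0 < (τ ω).first := ae_of_ae_map hτ.aemeasurable_first
    ((hτ.map_first hlam hp hp1 hstab).1 ▸ ae_pos_expMeasure)
  filter_upwards [h1, h2, h3, hτ.ae_poll_infinite hlam hmu hp hp1,
    hτ.ae_tendsto_updateInstant_div hlam hmu hp hp1] with ω h1 h2 h3 h4 h5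
  refine ⟨h1, ?_, h4, fun i => (h2 _).le, h3.le⟩
  -- the hop instants are monotone and, by the law of large numbers, unbounded
  have hmono : Monotone (τ ω).hopInstant := monotone_nat_of_le_succ fun n => by
    rw [Timing.hopInstant_succ]; linarith [h1 n]
  have h6 : Tendsto (τ ω).updateInstant atTop atTop := by
    have hβ := inv_pos.2 (mul_pos hp hlam)
    refine (h5.pos_mul_atTop hβ tendsto_natCast_atTop_atTop).congr' ?_
    filter_upwards [eventually_ne_atTop 0] with n hn
    have : (n : ℝ) ≠ 0 := by exact_mod_cast hn
    field_simp
  refine tendsto_atTop_atTop_of_monotone hmono fun b => ?_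
  obtain ⟨n, hn⟩ := (h6.eventually_ge_atTop b).exists
  exact ⟨_, hn⟩

/-- All the areas `Q` have the law of the first area in the stationary driven queue. -/
lemma areaQ_mean (hτ : IsStationaryMM1 P lam mu p τ) (hlam : 0 < lam) (hp : 0 < p)
    (hp1 : p ≤ 1) (hstab : p * lam < mu) (v : ℝ) (i : ℕ) :
    Integrable (fun ω => (τ ω).areaQ v i) P ∧
      ∫ ω, (τ ω).areaQ v i ∂P = ∫ s, orbitArea v drivingBlock s
        ∂((expMeasure (mu - p * lam)).prod (drivingLaw p lam mu)) := by
  have hmu : 0 < mu := (mul_pos hp hlam).trans hstab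
  have hα : 0 < mu - p * lam := sub_pos.2 hstab
  have := isProbabilityMeasure_expMeasure hα
  have := isProbabilityMeasure_drivingLaw hlam hmu hp hp1
  have hD := isRegenerating_drivingLaw hlam hmu hp hp1
  obtain ⟨h1, hinv⟩ := hτ.map_first hlam hp hp1 hstab
  have hT := (measurePreserving_queueStep hlam hmu hp hp1 hD hinv).iterate i
  have hq := memLp_orbitArea (v := v) hlam hmu hp hp1 hα hD
  have hf := hτ.aemeasurable_first.prodMk hτ.aemeasurable_driving
  have hlaw := hτ.map_first_driving hlam hmu hp hp1
  rw [h1] at hlaw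
  have hqi : Integrable (fun s => orbitArea v drivingBlock
      ((queueStep drivingBlock drivingShift)^[i] s))
      ((expMeasure (mu - p * lam)).prod (drivingLaw p lam mu)) :=
    (hq.comp_measurePreserving hT).integrable one_le_two
  have hae : (fun ω => (τ ω).areaQ v i) =ᵐ[P] fun ω => orbitArea v drivingBlock
      ((queueStep drivingBlock drivingShift)^[i] ((τ ω).first, (τ ω).driving)) := by
    filter_upwards [hτ.ae_isRegular hlam hp hp1 hstab] with ω hω
    rw [hω.areaQ_eq, Timing.areas_eq_orbitArea hω.poll_infinite]
  refine ⟨?_, ?_⟩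
  · rw [integrable_congr hae]
    rw [← hlaw] at hqi
    exact hqi.comp_aemeasurable hf
  · rw [integral_congr_ae hae, ← integral_map hf (f := fun s => orbitArea v drivingBlock
      ((queueStep drivingBlock drivingShift)^[i] s)) (by rw [hlaw]; exact hqi.1), hlaw]
    conv_rhs => rw [← hT.map_eq]
    rw [integral_map hT.measurable.aemeasurable (by rw [hT.map_eq]; exact hq.1)]

/-- The long-run average of the current uncertainty. -/
theorem ae_tendsto_average_currentGrowth (hτ : IsStationaryMM1 P lam mu p τ) (hlam : 0 < lam)
    (hp : 0 < p) (hp1 : p ≤ 1) (hstab : p * lam < mu) (v : ℝ) (i : ℕ) :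
    ∀ᵐ ω ∂P, Tendsto (fun T : ℝ => (1 / T) * ∫ t in (0 : ℝ)..T, (τ ω).currentGrowth v t) atTop
      (𝓝 (p * lam * ∫ ω, (τ ω).areaQ v i ∂P)) := by
  have hmu : 0 < mu := (mul_pos hp hlam).trans hstab
  have hα : 0 < mu - p * lam := sub_pos.2 hstab
  have := isProbabilityMeasure_drivingLaw hlam hmu hp hp1
  have hD := isRegenerating_drivingLaw hlam hmu hp hp1
  obtain ⟨h1, hinv⟩ := hτ.map_first hlam hp hp1 hstab
  have hf := hτ.aemeasurable_first.prodMk hτ.aemeasurable_driving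
  have hlaw := hτ.map_first_driving hlam hmu hp hp1
  rw [h1] at hlaw
  have hQ := ae_tendsto_average_orbitArea (v := v) hlam hp hp1 hα (by ring) hD hinv
  have hS := ae_tendsto_systemTime_pow_div hlam hmu hp hp1 hα hD hinv
  rw [← hlaw] at hS
  rw [← (hτ.areaQ_mean hlam hp hp1 hstab v i).2, ← hlaw] at hQ
  filter_upwards [hτ.ae_isRegular hlam hp hp1 hstab, ae_of_ae_map hf hQ, ae_of_ae_map hf hS,
    hτ.ae_tendsto_updateInstant_div hlam hmu hp hp1] with ω hω hQω hSω huω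
  refine hω.tendsto_average_currentGrowth v (mul_pos hp hlam) ?_ huω ?_
  · simpa only [hω.areaQ_eq, Timing.areas_eq_orbitArea hω.poll_infinite] using hQω
  · simpa only [Timing.iterate_queueStep hω.poll_infinite] using hSω

end IsStationaryMM1

/-- A trajectory that exceeds its baseline by `κ` times the current uncertainty has an age of
positioning. -/
lemma Timing.IsRegular.isAoP {τ : Timing} (hτ : τ.IsRegular) {v κ b a : ℝ} {f : ℝ → ℝ}
    (hf : ∀ t, 0 ≤ t → f t = b + κ * τ.currentGrowth v t)
    (ha : Tendsto (fun T : ℝ => (1 / T) * ∫ t in (0 : ℝ)..T, τ.currentGrowth v t) atTop (𝓝 a)) :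
    IsAoP f b (κ * a) := by
  have h : ∀ T : ℝ, 0 ≤ T →
      Set.EqOn (fun t => κ * τ.currentGrowth v t) (fun t => f t - b) (Set.uIcc 0 T) := by
    intro T hT t ht
    rw [Set.uIcc_of_le hT] at ht
    simp only [hf t ht.1, add_sub_cancel_left]
  refine ⟨fun T hT => ?_, (ha.const_mul κ).congr' ?_⟩
  · exact ((hτ.intervalIntegrable_currentGrowth v hT).const_mul κ).congr
      ((h T hT).mono Set.uIoc_subset_uIcc)
  · filter_upwards [eventually_ge_atTop 0] with T hT
    rw [← intervalIntegral.integral_congr (h T hT), intervalIntegral.integral_const_mul]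
    ring

end

theorem theorem1 {Ω Ω' : Type*} [MeasurableSpace Ω] [MeasurableSpace Ω']
    (P : Measure Ω) [IsProbabilityMeasure P] (P' : Measure Ω') [IsProbabilityMeasure P']
    (lam mu p v ε c rho rhoe : ℝ) (hlam : 0 < lam) (hmu : 0 < mu) (hp : 0 < p) (hp1 : p ≤ 1)
    (hε : 0 < ε) (hc : c = 0 ∨ c = 1)
    (hrho : rho = p * lam / mu) (hrho1 : rho < 1)
    (hrhoe : rhoe = lam / (mu * (1 - rho) + lam))
    (x₀ : Fin 2 → ℝ) (Co : Matrix (Fin 2) (Fin 2) ℝ)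
    (τ : Ω → Timing) (hτ : IsStationaryMM1 P lam mu p τ)
    (M : Ω' → Motion) (hM : IsRWPMotion P' ε Co M) :
    (∀ i : ℕ,
      (∀ᵐ ω ∂P, (τ ω).areaQ v i = (τ ω).areaG1 v i + (τ ω).areaG2 v i + (τ ω).areaG3 v i) ∧
      Integrable (fun ω => (τ ω).areaQ v i) P ∧
      ∫ ω, (τ ω).areaQ v i ∂P =
        2 * v ^ 2 * ((1 - p) / (p ^ 2 * lam ^ 3)) + 2 * v ^ 2 / (p * lam ^ 3)
          + 2 * v ^ 2 / (p * lam ^ 2 * mu)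
          + 2 * v ^ 2 * p * rhoe / (mu * (1 - rho))
            * (1 / ((mu * (1 - rho) + lam) ^ 2 * (1 - rhoe * (1 - p)) ^ 2)) ∧
      (∀ᵐ ω ∂P, IsAoP (fun t => peb P' c x₀ v (τ ω) M t) Co.trace
        (p * kappaExact c ε * lam * ∫ ω, (τ ω).areaQ v i ∂P)) ∧
      (∀ᵐ ω ∂P, IsAoP (fun t => pebSmallAngle Co.trace c ε v (τ ω) t) Co.trace
        (p * kappa c ε * lam * ∫ ω, (τ ω).areaQ v i ∂P))) ∧
    (c = 0 → kappaExact c ε = 1 ∧ kappa c ε = 1) ∧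
    (c = 1 → kappa c ε = ε ^ 2 / 3 ∧
      0 ≤ kappa c ε - kappaExact c ε ∧ kappa c ε - kappaExact c ε ≤ ε ^ 4 / 60) := by
  have hβ := mul_pos hp hlam
  have hstab : p * lam < mu := by rwa [hrho, div_lt_one hmu] at hrho1
  have hα : 0 < mu - p * lam := sub_pos.2 hstab
  have := isProbabilityMeasure_drivingLaw hlam hmu hp hp1
  have hreg := hτ.ae_isRegular hlam hp hp1 hstab
  refine ⟨fun i => ⟨?_, (hτ.areaQ_mean hlam hp hp1 hstab v i).1, ?_, ?_, ?_⟩, ?_, ?_⟩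
  · filter_upwards [hreg] with ω hω
    exact hω.areaQ_eq v i
  · have hα' : mu * (1 - rho) = mu - p * lam := by
      rw [hrho]; field_simp
    rw [(hτ.areaQ_mean hlam hp hp1 hstab v i).2, integral_orbitArea hlam hmu hp hp1 hα
      (isRegenerating_drivingLaw hlam hmu hp hp1),
      integral_blockArea hlam hp hp1 hα (by ring), hrhoe, hα']
    have h1 : 0 < mu - p * lam + lam := by linarith
    -- the last denominator of the stated formula is the squared service rate
    have h2 : (mu - p * lam + lam) ^ 2 * (1 - lam / (mu - p * lam + lam) * (1 - p)) ^ 2 =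
        mu ^ 2 := by
      rw [← mul_pow]
      congr 1
      field_simp
      ring
    rw [h2, add_comm lam (mu - p * lam)]
    have := hα.ne'
    field_simp
    ring
  · filter_upwards [hreg, hτ.ae_tendsto_average_currentGrowth hlam hp hp1 hstab v i] with ω hω hT
    have h := hω.isAoP (fun t ht => hω.peb_eq hM c x₀ v ht) hT
    convert h using 1
    ring
  · filter_upwards [hreg, hτ.ae_tendsto_average_currentGrowth hlam hp hp1 hstab v i] with ω hω hT
    have h := hω.isAoP (f := fun t => pebSmallAngle Co.trace c ε v (τ ω) t)
      (fun t _ => rfl) hT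
    convert h using 1
    ring
  · rintro rfl
    exact kappa_zero ε
  · rintro rfl
    exact ⟨kappa_one hε, kappa_sub_kappaExact_one hε⟩
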